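/- **Conventions.** Let $R=\bigoplus_{n\in\mathbb Z}R^n$ be a graded commutative noetherian ring (so $rs=(-1)^{|r||s|}sr$ for homogeneous $r,s$), and let $\operatorname{Spec}R$ be its set of homogeneous prime ideals. Modules are graded, localisation is homogeneous, $\operatorname{Hom}_R$ denotes degree-zero homomorphisms, and $I(\mathfrak p)$ is an injective hull of $R/\mathfrak p$ among graded modules. Let $\mathsf T$ be a triangulated category with suspension $\Sigma$ and set-indexed coproducts, compactly generated by a set of objects; $\mathsf T^c$ is its full subcategory of compact objects. Put $\operatorname{Hom}^*_{\mathsf T}(X,Y)=\bigoplus_i\operatorname{Hom}_{\mathsf T}(X,\Sigma^iY)$. Suppose $\mathsf T$ is $R$-linear: there are homomorphisms of graded rings $\phi_X\colon R\to\operatorname{End}^*_{\mathsf T}(X)$ with $\phi_Y(r)\alpha=(-1)^{|r||\alpha|}\alpha\phi_X(r)$ for $\alpha\in\operatorname{Hom}^*_{\mathsf T}(X,Y)$. An exact functor is $R$-linear if the maps it induces on $\operatorname{Hom}^*$ are. Fix $\mathfrak p\in\operatorname{Spec}R$. A module $M$ is $\mathfrak p$-local if $M\to M_{\mathfrak p}$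 is invertible, and $\mathfrak p$-torsion if $M_{\mathfrak q}=0$ for all $\mathfrak q\not\supseteq\mathfrak p$; an object $X$ of $\mathsf T$ is $\mathfrak p$-local (resp. $\mathfrak p$-torsion) if $\operatorname{Hom}^*_{\mathsf T}(C,X)$ is so for all $C\in\mathsf T^c$. Let $\mathsf T_{\mathfrak p}$ be the full subcategory of $\mathfrak p$-local objects and $\Gamma_{\mathfrak p}\mathsf T$ that of $\mathfrak p$-local and $\mathfrak p$-torsion objects. Write $X\mapsto X_{\mathfrak p}$ for the left adjoint of $\mathsf T_{\mathfrak p}\hookrightarrow\mathsf T$, and $\Gamma_{\mathfrak p}$ for its composite with the right adjoint of $\Gamma_{\mathfrak p}\mathsf T\hookrightarrow\mathsf T_{\mathfrak p}$. Set $\operatorname{supp}_R(\mathsf T)=\{\mathfrak p\mid\Gamma_{\mathfrak p}\ne0\}$. Let $T_{\mathfrak p}\colon\mathsf T^c\to\mathsf T$ be the functor determined by a natural isomorphism $\operatorname{Hom}_R(\operatorname{Hom}^*_{\mathsf T}(C,Y),I(\mathfrak p))\cong\operatorname{Hom}_{\mathsf T}(Y,T_{\mathfrak p}(C))$. **Statement.**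 Suppose $\mathsf T$ is Gorenstein with global Serre functor $F$ and shifts $\{d(\mathfrak p)\}$: that is, $F\colon\mathsf T^c\to\mathsf T^c$ is an $R$-linear triangle equivalence and, for every $\mathfrak p\in\operatorname{supp}_R(\mathsf T)$, there is a natural isomorphism $\Gamma_{\mathfrak p}\circ F\cong\Sigma^{d(\mathfrak p)}\circ T_{\mathfrak p}$ of functors $\mathsf T^c\to\mathsf T$. (1) Let $\mathfrak p\in\operatorname{supp}_R(\mathsf T)$. Then $C\mapsto C_{\mathfrak p}$ takes $\mathsf T^c$ to $(\mathsf T_{\mathfrak p})^c$, one has $(\Gamma_{\mathfrak p}\mathsf T)^c\subseteq(\mathsf T_{\mathfrak p})^c$, and there is a functor $F_{\mathfrak p}\colon(\mathsf T_{\mathfrak p})^c\to(\mathsf T_{\mathfrak p})^c$ with $F_{\mathfrak p}(C_{\mathfrak p})\cong F(C)_{\mathfrak p}$ naturally in $C\in\mathsf T^c$. For every such $F_{\mathfrak p}$ there is an isomorphism $$\operatorname{Hom}_R(\operatorname{Hom}^*_{\mathsf T}(X,Y),I(\mathfrak p))\cong\operatorname{Hom}_{\mathsf T}(Y,\Sigma^{-d(\mathfrak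 p)}F_{\mathfrak p}(X)),$$ natural in $X\in(\Gamma_{\mathfrak p}\mathsf T)^c$ and $Y\in\mathsf T_{\mathfrak p}$. (2) Consequently $\mathsf C=\mathsf T^c$ satisfies local Serre duality: there is an $R$-linear triangle equivalence $F\colon\mathsf C\to\mathsf C$ such that for every $\mathfrak p\in\operatorname{Spec}R$ and some integer $d$ the functor $\Sigma^{-d}F_{\mathfrak p}$ is an $R$-linear triangle equivalence $\gamma_{\mathfrak p}\mathsf C\to\gamma_{\mathfrak p}\mathsf C$ with an isomorphism $$\operatorname{Hom}_R(\operatorname{Hom}^*_{\mathsf C_{\mathfrak p}}(X,Y),I(\mathfrak p))\cong\operatorname{Hom}_{\mathsf C_{\mathfrak p}}(Y,\Sigma^{-d}F_{\mathfrak p}X)$$ natural in $X,Y\in\gamma_{\mathfrak p}\mathsf C$. Here $\mathsf C_{\mathfrak p}$ is the triangulated category with the objects of $\mathsf C$ and $\operatorname{Hom}^*_{\mathsf C_{\mathfrak p}}(X,Y)=\operatorname{Hom}^*_{\mathsf C}(X,Y)_{\mathfrak p}$, $\gamma_{\mathfrak p}\mathsf C$ is its full subcategory of objects $X$ with $\operatorname{End}^*_{\mathsf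 C_{\mathfrak p}}(X)$ $\mathfrak p$-torsion, and $F_{\mathfrak p}$ is the functor on $\mathsf C_{\mathfrak p}$, restricting to $\gamma_{\mathfrak p}\mathsf C$, induced by $F$. -/

import Mathlib

open CategoryTheory CategoryTheory.Limits CategoryTheory.Pretriangulated

universe v w w'

namespace LocalSerre

/-! ### Graded rings, graded modules, homogeneous primes -/

section GradedAlgebra

variable {R : Type v} [Ring R] (𝒜 : ℤ → AddSubgroup R)

/-- Graded commutativity: `a * b = (-1)^(|a| |b|) b * a` for homogeneous `a`, `b`. -/
def IsGradedCommutative : Prop :=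
  ∀ (i j : ℤ) (a b : R), a ∈ 𝒜 i → b ∈ 𝒜 j → a * b = (i * j).negOnePow • (b * a)

variable [GradedRing 𝒜]

/-- A graded ring is noetherian if its homogeneous ideals are finitely generated. -/
def IsGradedNoetherian : Prop :=
  ∀ J : Ideal R, J.IsHomogeneous 𝒜 → J.FG

/-- `Spec R`: the homogeneous prime ideals of `R`.  In a graded commutative ring homogeneous
left ideals are two-sided. -/
structure HSpec where
  ideal : Ideal R
  homogeneous : ideal.IsHomogeneous 𝒜
  ne_top : ideal ≠ ⊤
  mem_or_mem : ∀ (i j : ℤ) (a b : R), a ∈ 𝒜 i → b ∈ 𝒜 j → a * b ∈ ideal →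
    a ∈ ideal ∨ b ∈ ideal

/-- A graded (left) module, given by its homogeneous components and the action of the
homogeneous elements of `R`. -/
structure GrMod where
  carrier : ℤ → Type v
  [addCommGroup : ∀ i, AddCommGroup (carrier i)]
  smul : ∀ {a i j : ℤ}, a + i = j → (𝒜 a →+ carrier i →+ carrier j)
  one_smul : ∀ {i : ℤ} (m : carrier i),
    smul (zero_add i) ⟨(1 : R), SetLike.GradedOne.one_mem⟩ m = m
  mul_smul : ∀ {a b i j k : ℤ} (h : b + i = j) (h' : a + j = k) (h'' : (a + b) + i = k)
    (r : 𝒜 a) (s : 𝒜 b) (m : carrier i),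
    smul h'' ⟨(r : R) * (s : R), SetLike.mul_mem_graded r.2 s.2⟩ m = smul h' r (smul h s m)

attribute [instance] GrMod.addCommGroup

variable {𝒜}

/-- `Hom_R(M, N)`: the group of homomorphisms of graded modules (of degree zero). -/
def grHom (M N : GrMod 𝒜) : AddSubgroup (∀ i, M.carrier i →+ N.carrier i) where
  carrier := {f | ∀ {a i j : ℤ} (h : a + i = j) (r : 𝒜 a) (m : M.carrier i),
    f j (M.smul h r m) = N.smul h r (f i m)}
  add_mem' hf hg := by
    intro a i j h r m
    simp only [Pi.add_apply, AddMonoidHom.add_apply, map_add]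
    rw [hf h r m, hg h r m]
  zero_mem' := by
    intro a i j h r m
    simp
  neg_mem' hf := by
    intro a i j h r m
    simp only [Pi.neg_apply, AddMonoidHom.neg_apply, map_neg]
    rw [hf h r m]

/-- Composition of homomorphisms of graded modules. -/
def grComp {M N P : GrMod 𝒜} (f : grHom M N) (g : grHom N P) : grHom M P :=
  ⟨fun i => (g.1 i).comp (f.1 i), fun h r m => by
    simp only [AddMonoidHom.comp_apply]
    rw [f.2 h r m, g.2 h r]⟩

/-- Vanishing of the localisation of the graded module `M` at `q`. -/
def LocalisationVanishes (q : HSpec 𝒜) (M : GrMod 𝒜) : Prop :=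
  ∀ (i : ℤ) (m : M.carrier i), ∃ (a : ℤ) (s : 𝒜 a), (s : R) ∉ q.ideal ∧
    M.smul (rfl : a + i = a + i) s m = 0

/-- `M` is `p`-torsion: `M_q = 0` for all homogeneous primes `q` not containing `p`. -/
def IsTorsionModule (p : HSpec 𝒜) (M : GrMod 𝒜) : Prop :=
  ∀ q : HSpec 𝒜, ¬ p.ideal ≤ q.ideal → LocalisationVanishes q M

/-- `M` is `p`-local: the homogeneous elements outside `p` act bijectively on `M`, that is,
the map `M → M_p` is invertible. -/
def IsLocalModule (p : HSpec 𝒜) (M : GrMod 𝒜) : Prop :=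
  ∀ {a i j : ℤ} (h : a + i = j) (s : 𝒜 a), (s : R) ∉ p.ideal → Function.Bijective (M.smul h s)

/-- `f : M → N` exhibits `N` as the (homogeneous) localisation `M_p`. -/
structure IsLocalisationMap (p : HSpec 𝒜) {M N : GrMod 𝒜} (f : grHom M N) : Prop where
  isLocal : IsLocalModule p N
  exists_of_eq_zero : ∀ (i : ℤ) (m : M.carrier i), f.1 i m = 0 →
    ∃ (a : ℤ) (s : 𝒜 a), (s : R) ∉ p.ideal ∧ M.smul (rfl : a + i = a + i) s m = 0
  surj : ∀ (i : ℤ) (n : N.carrier i), ∃ (a : ℤ) (s : 𝒜 a), (s : R) ∉ p.ideal ∧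
    ∃ m : M.carrier (a + i), f.1 (a + i) m = N.smul (rfl : a + i = a + i) s n

/-- The degree `i` part of the homogeneous ideal `p`, inside the degree `i` part of `R`. -/
def HSpec.component (p : HSpec 𝒜) (i : ℤ) : AddSubgroup (𝒜 i) :=
  p.ideal.toAddSubgroup.comap (𝒜 i).subtype

/-- The graded module `R / p`. -/
def residue (p : HSpec 𝒜) : GrMod 𝒜 where
  carrier i := 𝒜 i ⧸ p.component i
  smul {a i j} h :=
    { toFun := fun r => QuotientAddGroup.map (p.component i) (p.component j)
        { toFun := fun x => ⟨(r : R) * (x : R), h ▸ SetLike.mul_mem_graded r.2 x.2⟩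
          map_zero' := by ext; simp
          map_add' := fun x y => by ext; simp [mul_add] }
        (fun x hx => p.ideal.mul_mem_left _ hx)
      map_zero' := by
        ext x
        refine (QuotientAddGroup.eq_zero_iff _).2 ?_
        change (((0 : 𝒜 a) : R) * (x : R)) ∈ p.ideal
        simp
      map_add' := fun r s => by
        ext x
        refine congrArg (QuotientAddGroup.mk (s := p.component j)) ?_
        ext
        exact add_mul _ _ _ }
  one_smul m := by
    induction m using QuotientAddGroup.induction_on with
    | H x =>
      refine congrArg (QuotientAddGroup.mk (s := p.component _)) ?_
      ext
      exact _root_.one_mul _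
  mul_smul h h' h'' r s m := by
    induction m using QuotientAddGroup.induction_on with
    | H x =>
      refine congrArg (QuotientAddGroup.mk (s := p.component _)) ?_
      ext
      exact mul_assoc _ _ _

/-- Injective objects of the category of graded modules. -/
def IsInjectiveModule (I : GrMod 𝒜) : Prop :=
  ∀ (M N : GrMod 𝒜) (u : grHom M N), (∀ i, Function.Injective (u.1 i)) →
    ∀ f : grHom M I, ∃ g : grHom N I, grComp u g = f

/-- `I` is an injective hull of `N` in the category of graded modules: `I` is injective and
there is an embedding `N → I` that is essential, i.e. each nonzero homogeneous element of `I`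
has a nonzero homogeneous multiple in the image of `N`. -/
def IsInjectiveHull (N I : GrMod 𝒜) : Prop :=
  IsInjectiveModule I ∧ ∃ e : grHom N I, (∀ i, Function.Injective (e.1 i)) ∧
    ∀ (i : ℤ) (x : I.carrier i), x ≠ 0 → ∃ (a : ℤ) (r : 𝒜 a) (n : N.carrier (a + i)),
      n ≠ 0 ∧ I.smul (rfl : a + i = a + i) r x = e.1 (a + i) n

end GradedAlgebra

/-! ### Triangulated categories with central action -/

section Linear

variable {R : Type v} [Ring R] (𝒜 : ℤ → AddSubgroup R) [GradedRing 𝒜]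

/-- An `R`-linear structure on a triangulated category: homomorphisms of graded rings
`R → End^*(X)` whose left and right actions on `Hom^*(X, Y)` agree up to the usual sign.
(`α.comp β` is the product `β α` in `Hom^*`.) -/
class RLinear (C : Type w) [Category.{v} C] [Preadditive C] [HasShift C ℤ] where
  act : ∀ (X : C) (n : ℤ), 𝒜 n →+ ShiftedHom X X n
  act_one : ∀ X : C, act X 0 ⟨(1 : R), SetLike.GradedOne.one_mem⟩ = ShiftedHom.mk₀ 0 rfl (𝟙 X)
  act_mul : ∀ (X : C) {m n k : ℤ} (h : m + n = k) (r : 𝒜 m) (s : 𝒜 n),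
    act X k ⟨(r : R) * (s : R), h ▸ SetLike.mul_mem_graded r.2 s.2⟩ =
      (act X n s).comp (act X m r) h
  act_comm : ∀ {X Y : C} {m n k : ℤ} (h : m + n = k) (h' : n + m = k) (r : 𝒜 m)
    (α : ShiftedHom X Y n),
    α.comp (act Y m r) h = (m * n).negOnePow • (act X m r).comp α h'

variable {C : Type w} [Category.{v} C] [Preadditive C] [HasShift C ℤ]
  [∀ n : ℤ, (shiftFunctor C n).Additive] [RLinear 𝒜 C]

/-- The graded `R`-module `Hom^*(X, Y)`. -/
noncomputable def homMod (X Y : C) : GrMod 𝒜 where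
  carrier i := ShiftedHom X Y i
  smul {a i j} h :=
    { toFun := fun r =>
        { toFun := fun α => α.comp (RLinear.act Y a r) h
          map_zero' := by simp
          map_add' := by intros; simp }
      map_zero' := by ext; simp
      map_add' := by intros; ext; simp }
  one_smul m := by
    change ShiftedHom.comp m (RLinear.act Y 0 _) _ = m
    rw [RLinear.act_one, ShiftedHom.comp_mk₀_id]
  mul_smul {a b i j k} h h' h'' r s m := by
    change ShiftedHom.comp m (RLinear.act Y (a + b) _) _ =
      ShiftedHom.comp (ShiftedHom.comp m (RLinear.act Y b s) h) (RLinear.act Y a r) h'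
    rw [RLinear.act_mul Y rfl r s, ShiftedHom.comp_assoc _ _ _ h rfl h'']

/-- Postcomposition `Hom^*(X, Y) → Hom^*(X, Y')` with a morphism `Y → Y'`. -/
noncomputable def homPost (X : C) {Y Y' : C} (g : Y ⟶ Y') :
    grHom (homMod 𝒜 X Y) (homMod 𝒜 X Y') :=
  ⟨fun i =>
    { toFun := fun α => (show X ⟶ Y⟦i⟧ from α) ≫ g⟦i⟧'
      map_zero' := zero_comp
      map_add' := fun _ _ => Preadditive.add_comp _ _ _ _ _ _ }, by
    intro a i j h r α
    change ShiftedHom X Y i at α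
    change ShiftedHom.comp α (RLinear.act Y a r) h ≫ g⟦j⟧' =
      ShiftedHom.comp (α ≫ g⟦i⟧' : X ⟶ Y'⟦i⟧) (RLinear.act Y' a r) h
    have hc := RLinear.act_comm (𝒜 := 𝒜) (add_zero a) (zero_add a) r (ShiftedHom.mk₀ 0 rfl g)
    rw [mul_zero, Int.negOnePow_zero, one_smul] at hc
    rw [← ShiftedHom.comp_mk₀ _ 0 rfl, ← ShiftedHom.comp_mk₀ _ 0 rfl,
      ShiftedHom.comp_assoc (a₁₂ := j) (a₂₃ := a) _ _ _ h (zero_add a) (by lia), ← hc,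
      ShiftedHom.comp_assoc (a₁₂ := i) (a₂₃ := a) _ _ _ (zero_add i) (add_zero a) (by lia)]⟩

/-- Precomposition `Hom^*(X', Y) → Hom^*(X, Y)` with a morphism `X → X'`. -/
noncomputable def homPre {X X' : C} (f : X ⟶ X') (Y : C) :
    grHom (homMod 𝒜 X' Y) (homMod 𝒜 X Y) :=
  ⟨fun i =>
    { toFun := fun α => f ≫ (show X' ⟶ Y⟦i⟧ from α)
      map_zero' := comp_zero
      map_add' := fun _ _ => Preadditive.comp_add _ _ _ _ _ _ }, by
    intro a i j h r α
    exact (Category.assoc _ _ _).symm⟩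

/-- A natural isomorphism of groups `Hom_R(Hom^*(U a, V b), I) ≅ Hom(V b, W a)`, natural in
`a` (covariantly) and in `b` (contravariantly). -/
structure DualityIso {A : Type*} {B : Type*} [Category A] [Category B]
    (U : A ⥤ C) (V : B ⥤ C) (W : A ⥤ C) (I : GrMod 𝒜) where
  equiv : ∀ (a : A) (b : B), grHom (homMod 𝒜 (U.obj a) (V.obj b)) I ≃+ (V.obj b ⟶ W.obj a)
  naturality_left : ∀ {a a' : A} (f : a ⟶ a') (b : B)
    (φ : grHom (homMod 𝒜 (U.obj a) (V.obj b)) I),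
    equiv a' b (grComp (homPre 𝒜 (U.map f) (V.obj b)) φ) = equiv a b φ ≫ W.map f
  naturality_right : ∀ (a : A) {b b' : B} (g : b ⟶ b')
    (φ : grHom (homMod 𝒜 (U.obj a) (V.obj b')) I),
    equiv a b (grComp (homPost 𝒜 (U.obj a) (V.map g)) φ) = V.map g ≫ equiv a b' φ

section Functors

variable {D : Type w'} [Category.{v} D] [Preadditive D] [HasShift D ℤ]
  [∀ n : ℤ, (shiftFunctor D n).Additive] [RLinear 𝒜 D]

/-- A functor commuting with shifts is `R`-linear if the maps
`Hom^*(X, Y) → Hom^*(FX, FY)` are. -/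
def IsRLinearFunctor (F : C ⥤ D) [F.CommShift ℤ] : Prop :=
  ∀ (X Y : C) {a i j : ℤ} (h : a + i = j) (r : 𝒜 a) (α : ShiftedHom X Y i),
    (α.comp (RLinear.act Y a r) h).map F = (α.map F).comp (RLinear.act (F.obj Y) a r) h

/-- The homomorphism `Hom^*(X, Y) → Hom^*(FX, FY)` given by an `R`-linear functor. -/
noncomputable def homMap (F : C ⥤ D) [F.CommShift ℤ] [F.Additive] (hF : IsRLinearFunctor 𝒜 F)
    (X Y : C) : grHom (homMod 𝒜 X Y) (homMod 𝒜 (F.obj X) (F.obj Y)) :=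
  ⟨fun i =>
    { toFun := fun α => ShiftedHom.map (show ShiftedHom X Y i from α) F
      map_zero' := ShiftedHom.map_zero F
      map_add' := fun α β => ShiftedHom.map_add (X := X) (Y := Y) α β F },
    fun h r α => hF X Y h r α⟩

variable [HasZeroObject C] [HasZeroObject D] [Pretriangulated C] [Pretriangulated D]

/-- `F` is an `R`-linear triangle equivalence: an equivalence that carries a structure of exact
(i.e. triangulated) functor for which it is `R`-linear. -/
def IsRLinearTriangleEquivalence (F : C ⥤ D) : Prop :=
  F.IsEquivalence ∧ ∃ _ : F.CommShift ℤ, F.IsTriangulated ∧ IsRLinearFunctor 𝒜 F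

end Functors

/-- Triangulated (or merely shift stable) full subcategories inherit the `R`-linear structure. -/
noncomputable instance rLinearFullSubcategory (P : ObjectProperty C) [P.IsStableUnderShift ℤ] :
    RLinear 𝒜 P.FullSubcategory where
  act X n :=
    { toFun := fun r => ObjectProperty.homMk
        (RLinear.act X.obj n r ≫ (P.ι.commShiftIso n).inv.app X)
      map_zero' := by ext; simp
      map_add' := fun r s => P.ι.map_injective (by
        rw [Functor.map_add]; simp) }
  act_one X := by
    have key : ∀ {Y Z : P.FullSubcategory} {n : ℤ} (α β : ShiftedHom Y Z n),
        α.map P.ι = β.map P.ι → α = β := fun α β h =>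
      P.ι.map_injective ((cancel_mono _).1 h)
    refine key _ _ ?_
    rw [ShiftedHom.map_mk₀, CategoryTheory.Functor.map_id]
    refine Eq.trans ?_ (RLinear.act_one (𝒜 := 𝒜) X.obj)
    simp [ShiftedHom.map]
  act_mul X m n k h r s := by
    have key : ∀ {Y Z : P.FullSubcategory} {n : ℤ} (α β : ShiftedHom Y Z n),
        α.map P.ι = β.map P.ι → α = β := fun α β h =>
      P.ι.map_injective ((cancel_mono _).1 h)
    refine key _ _ ?_
    rw [ShiftedHom.map_comp]
    refine Eq.trans ?_ ((RLinear.act_mul (𝒜 := 𝒜) X.obj h r s).trans ?_)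
    · simp [ShiftedHom.map]
    · simp [ShiftedHom.map]
  act_comm {X Y m n k} h h' r α := by
    have key : ∀ {Y Z : P.FullSubcategory} {n : ℤ} (α β : ShiftedHom Y Z n),
        α.map P.ι = β.map P.ι → α = β := fun α β h =>
      P.ι.map_injective ((cancel_mono _).1 h)
    refine key _ _ ?_
    have e : ∀ (Z : P.FullSubcategory), ShiftedHom.map (X := Z) (Y := Z) (a := m)
        (ObjectProperty.homMk (RLinear.act Z.obj m r ≫ (P.ι.commShiftIso m).inv.app Z)) P.ι =
        RLinear.act Z.obj m r := fun Z => by simp [ShiftedHom.map]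
    have hs : ∀ (u : ℤˣ) {n : ℤ} (β : ShiftedHom X Y n),
        (u • β).map P.ι = u • β.map P.ι := fun u n β => by
      rcases Int.units_eq_one_or u with rfl | rfl
      · simp
      · rw [Units.smul_def, Units.smul_def]
        simp only [Units.val_neg, Units.val_one, neg_smul, one_smul]
        rw [ShiftedHom.map, ShiftedHom.map, Functor.map_neg, Preadditive.neg_comp]
    change (α.comp (ObjectProperty.homMk _ : Y ⟶ _) h).map P.ι =
      ((m * n).negOnePow • ShiftedHom.comp (ObjectProperty.homMk _ : X ⟶ _) α h').map P.ι
    rw [hs, ShiftedHom.map_comp, ShiftedHom.map_comp, e, e]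
    exact RLinear.act_comm h h' r _

end Linear

/-! ### Compact objects -/

section Compact

/-- An object of a preadditive category is compact if each morphism from it to a coproduct
factors through a finite subcoproduct, i.e. `⨁ Hom(X, Y_j) → Hom(X, ∐ Y_j)` is bijective (its
injectivity is automatic). -/
def IsCompactObject {C : Type w} [Category.{v} C] [Preadditive C] (X : C) : Prop :=
  ∀ (J : Type v) (Y : J → C) (c : Cofan Y) (_ : IsColimit c) (f : X ⟶ c.pt),
    ∃ (S : Finset J) (g : ∀ j, X ⟶ Y j), f = ∑ j ∈ S, g j ≫ c.inj j

variable (T : Type w) [Category.{v} T] [Preadditive T]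

/-- The full subcategory of compact objects (as a property of objects). -/
def compacts : ObjectProperty T := fun X => IsCompactObject X

variable {T} in
/-- The objects of the full subcategory `P` that are compact in the category `P`. -/
def compactIn (P : ObjectProperty T) : ObjectProperty T :=
  fun X => ∃ h : P X, IsCompactObject (⟨X, h⟩ : P.FullSubcategory)

variable {T}

lemma IsCompactObject.of_iso {X X' : T} (e : X ≅ X') (h : IsCompactObject X) :
    IsCompactObject X' := by
  intro J Y c hc f
  obtain ⟨S, g, hg⟩ := h J Y c hc (e.hom ≫ f)
  refine ⟨S, fun j => e.inv ≫ g j, ?_⟩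
  rw [← cancel_epi e.hom, hg, Preadditive.comp_sum]
  simp

instance : (compacts T).IsClosedUnderIsomorphisms where
  of_iso e h := h.of_iso e

lemma eq_zero_of_sum_inj_eq_zero {J : Type v} {Y : J → T} (c : Cofan Y) (hc : IsColimit c)
    {X : T} (S : Finset J) (g : ∀ j, X ⟶ Y j) (h : ∑ j ∈ S, g j ≫ c.inj j = 0)
    (j : J) (hj : j ∈ S) : g j = 0 := by
  classical
  let π : c.pt ⟶ Y j := Cofan.IsColimit.desc hc
    (fun i => if hi : i = j then eqToHom (by rw [hi]) else 0)
  have h1 : c.inj j ≫ π = 𝟙 _ := by simp [π]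
  have h2 : ∀ i, i ≠ j → c.inj i ≫ π = 0 := fun i hi => by simp [π, hi]
  have h3 := congrArg (· ≫ π) h
  simp only [Preadditive.sum_comp, Category.assoc, zero_comp] at h3
  rw [Finset.sum_eq_single_of_mem j hj (fun i _ hi => by rw [h2 i hi, comp_zero]), h1,
    Category.comp_id] at h3
  exact h3

variable [HasShift T ℤ] [∀ n : ℤ, (shiftFunctor T n).Additive]

lemma IsCompactObject.shift {X : T} (h : IsCompactObject X) (n : ℤ) :
    IsCompactObject (X⟦n⟧) := by
  intro J Y c hc f
  let G : T ⥤ T := shiftFunctor T (-n)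
  let c' : Cofan (fun j => G.obj (Y j)) := Cofan.mk (G.obj c.pt) (fun j => G.map (c.inj j))
  have hc' : IsColimit c' := by
    have : PreservesColimit (Discrete.functor Y) G := inferInstance
    exact isColimitMapCoconeCofanMkEquiv G Y (fun j => c.inj j)
      (isColimitOfPreserves G (hc.ofIsoColimit (Cocone.ext (Iso.refl _))))
  obtain ⟨S, g, hg⟩ := h J _ c' hc' ((shiftShiftNeg X n).inv ≫ f⟦-n⟧')
  refine ⟨S, fun j => (g j)⟦n⟧' ≫ (shiftNegShift (Y j) n).hom, ?_⟩
  have h1 : f = ((shiftShiftNeg X n).inv ≫ f⟦-n⟧')⟦n⟧' ≫ (shiftNegShift c.pt n).hom := by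
    simp only [Functor.map_comp, Category.assoc]
    have e1 : f⟦-n⟧'⟦n⟧' ≫ (shiftNegShift c.pt n).hom = (shiftNegShift (X⟦n⟧) n).hom ≫ f :=
      (shiftFunctorCompIsoId T (-n) n (neg_add_cancel n)).hom.naturality f
    have e2 : ((shiftShiftNeg X n).inv)⟦n⟧' ≫ (shiftNegShift (X⟦n⟧) n).hom = 𝟙 _ := by
      have e3 := shift_shiftFunctorCompIsoId_add_neg_cancel_hom_app (n := n) X
      refine (congrArg _ e3.symm).trans ?_
      rw [← Functor.map_comp]
      exact (congrArg _ ((shiftFunctorCompIsoId T n (-n) (add_neg_cancel n)).inv_hom_id_app X)).trans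
        (CategoryTheory.Functor.map_id _ _)
    rw [e1, reassoc_of% e2]
  rw [h1, hg]
  simp only [Functor.map_sum, Functor.map_comp, Preadditive.sum_comp, Category.assoc]
  refine Finset.sum_congr rfl fun j _ => ?_
  congr 1
  exact (shiftFunctorCompIsoId T (-n) n (neg_add_cancel n)).hom.naturality (c.inj j)

variable [HasZeroObject T] [Pretriangulated T]

open scoped ZeroObject in
instance : (compacts T).IsTriangulated where
  exists_zero := ⟨0, isZero_zero T, fun J Y c hc f =>
    ⟨∅, fun j => 0, (isZero_zero T).eq_of_src _ _⟩⟩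
  isStableUnderShiftBy n := ⟨fun X hX => IsCompactObject.shift hX n⟩
  toIsTriangulatedClosed₂ := .mk' (by
    intro Δ hΔ h₁ h₃ J Y c hc f
    obtain ⟨S, g, hg⟩ := h₁ J Y c hc (Δ.mor₁ ≫ f)
    have h0 : ∀ j ∈ S, (Δ.invRotate.mor₁) ≫ g j = 0 := by
      refine eq_zero_of_sum_inj_eq_zero c hc S _ ?_
      have : Δ.invRotate.mor₁ ≫ Δ.mor₁ = 0 :=
        comp_distTriang_mor_zero₁₂ _ (inv_rot_of_distTriang _ hΔ)
      refine (Finset.sum_congr rfl fun j _ => Category.assoc _ (g j) (c.inj j)).trans ?_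
      refine (Preadditive.comp_sum _ _ _).symm.trans ?_
      refine (congrArg (Δ.invRotate.mor₁ ≫ ·) hg.symm).trans ?_
      refine (Category.assoc _ _ _).symm.trans ?_
      exact (congrArg (· ≫ f) this).trans zero_comp
    have h4 : ∀ j, ∃ g' : Δ.obj₂ ⟶ Y j, j ∈ S → g j = Δ.mor₁ ≫ g' := by
      intro j
      by_cases hj : j ∈ S
      · obtain ⟨g', hg'⟩ := Triangle.yoneda_exact₂ _ (inv_rot_of_distTriang _ hΔ) (g j) (h0 j hj)
        exact ⟨g', fun _ => hg'⟩
      · exact ⟨0, fun h => (hj h).elim⟩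
    choose g' hg' using h4
    obtain ⟨k, hk⟩ := Triangle.yoneda_exact₂ _ hΔ (f - ∑ j ∈ S, g' j ≫ c.inj j) (by
      rw [Preadditive.comp_sub, hg, Preadditive.comp_sum, sub_eq_zero]
      exact Finset.sum_congr rfl fun j hj => by rw [hg' j hj, Category.assoc])
    obtain ⟨S', k', hk'⟩ := h₃ J Y c hc k
    classical
    refine ⟨S ∪ S', fun j => (if j ∈ S then g' j else 0) +
      (if j ∈ S' then Δ.mor₂ ≫ k' j else 0), ?_⟩
    rw [sub_eq_iff_eq_add] at hk
    rw [hk, hk', Preadditive.comp_sum]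
    simp only [Preadditive.add_comp, Finset.sum_add_distrib, ite_comp, zero_comp,
      Category.assoc]
    rw [add_comm]
    congr 1
    · rw [Finset.sum_ite_mem, Finset.union_inter_cancel_left]
    · rw [Finset.sum_ite_mem, Finset.union_inter_cancel_right])

variable (T) in
/-- `T` is compactly generated: there is a set of compact objects such that an object `X` is
zero as soon as all morphisms from their shifts to `X` are (`T` is assumed to have coproducts). -/
def IsCompactlyGenerated : Prop :=
  ∃ (J : Type v) (G : J → T), (∀ j, IsCompactObject (G j)) ∧
    ∀ X : T, (∀ (j : J) (n : ℤ) (f : G j ⟶ X⟦n⟧), f = 0) → IsZero X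

end Compact

/-! ### Localisation and local cohomology -/

section Localisation

variable {R : Type v} [Ring R] {𝒜 : ℤ → AddSubgroup R} [GradedRing 𝒜]
  (T : Type w) [Category.{v} T] [Preadditive T] [HasShift T ℤ]
  [∀ n : ℤ, (shiftFunctor T n).Additive] [RLinear 𝒜 T]

/-- `T_p`: the full subcategory of `p`-local objects. -/
def localObjects (p : HSpec 𝒜) : ObjectProperty T :=
  fun X => ∀ C : T, IsCompactObject C → IsLocalModule p (homMod 𝒜 C X)

/-- The full subcategory of `p`-torsion objects. -/
def torsionObjects (p : HSpec 𝒜) : ObjectProperty T :=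
  fun X => ∀ C : T, IsCompactObject C → IsTorsionModule p (homMod 𝒜 C X)

/-- `Γ_p T`: the full subcategory of `p`-local and `p`-torsion objects. -/
def gammaObjects (p : HSpec 𝒜) : ObjectProperty T := localObjects T p ⊓ torsionObjects T p

lemma gammaObjects_le (p : HSpec 𝒜) : gammaObjects T p ≤ localObjects T p := inf_le_left

variable [HasZeroObject T]

open scoped Classical ZeroObject in
/-- The localisation functor `X ↦ X_p`, viewed as a functor `T ⥤ T`: the left adjoint of the
inclusion of `T_p`, followed by the inclusion.  The alternative branch is a placeholder; it does
not occur when `T` is compactly generated. -/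
noncomputable def localisation (p : HSpec 𝒜) : T ⥤ T :=
  if h : (localObjects T p).ι.IsRightAdjoint then
    @Functor.leftAdjoint _ _ _ _ (localObjects T p).ι h ⋙ (localObjects T p).ι
  else (Functor.const T).obj 0

open scoped Classical ZeroObject in
/-- The local cohomology functor `Γ_p`, viewed as a functor `T ⥤ T`: the left adjoint of the
inclusion `T_p → T`, followed by the right adjoint of the inclusion `Γ_p T → T_p` and by the
inclusion of `Γ_p T`.  The alternative branch is a placeholder; it does not occur when `R` is
noetherian and `T` is compactly generated. -/
noncomputable def localCohomology (p : HSpec 𝒜) : T ⥤ T :=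
  if h : (localObjects T p).ι.IsRightAdjoint ∧
      (ObjectProperty.ιOfLE (gammaObjects_le T p)).IsLeftAdjoint then
    @Functor.leftAdjoint _ _ _ _ (localObjects T p).ι h.1 ⋙
      @Functor.rightAdjoint _ _ _ _ (ObjectProperty.ιOfLE (gammaObjects_le T p)) h.2 ⋙ (gammaObjects T p).ι
  else (Functor.const T).obj 0

variable (𝒜) in
/-- The support of `T`: the homogeneous primes `p` with `Γ_p ≠ 0`. -/
def support : Set (HSpec 𝒜) :=
  {p | ∃ X : T, ¬ IsZero ((localCohomology T p).obj X)}

variable {T}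

/-- `Fp` is the functor induced by `F` on the compact objects of `T_p`, i.e. the localisation
functor intertwines `F` and `Fp`; this determines `Fp` up to isomorphism.  Here `hL` says that
localisation preserves compactness. -/
def IsInducedFunctor (p : HSpec 𝒜)
    (hL : ∀ C, compacts T C → compactIn (localObjects T p) ((localisation T p).obj C))
    (F : (compacts T).FullSubcategory ⥤ (compacts T).FullSubcategory)
    (Fp : (compactIn (localObjects T p)).FullSubcategory ⥤
      (compactIn (localObjects T p)).FullSubcategory) : Prop :=
  Nonempty
    ((compactIn (localObjects T p)).lift ((compacts T).ι ⋙ localisation T p)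
        (fun C => hL C.obj C.property) ⋙ Fp ≅
      F ⋙ (compactIn (localObjects T p)).lift ((compacts T).ι ⋙ localisation T p)
        (fun C => hL C.obj C.property))

variable [Pretriangulated T]

/-- `T` is Gorenstein with global Serre functor `F : T^c → T^c` and shifts `d`: `F` is an
`R`-linear triangle equivalence, and for `p` in the support of `T` there is a natural isomorphism
`Γ_p ∘ F ≅ Σ^{d(p)} ∘ T_p`, where `T_p : T^c → T` is the functor determined by the natural
isomorphism `Hom_R(Hom^*(C, Y), I(p)) ≅ Hom(Y, T_p(C))`. -/
def IsGlobalSerreFunctor (I : HSpec 𝒜 → GrMod 𝒜)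
    (F : (compacts T).FullSubcategory ⥤ (compacts T).FullSubcategory) (d : HSpec 𝒜 → ℤ) : Prop :=
  IsRLinearTriangleEquivalence 𝒜 F ∧
    ∀ p ∈ support 𝒜 T, ∃ Tp : (compacts T).FullSubcategory ⥤ T,
      Nonempty (DualityIso 𝒜 (compacts T).ι (𝟭 T) Tp (I p)) ∧
      Nonempty (F ⋙ (compacts T).ι ⋙ localCohomology T p ≅ Tp ⋙ shiftFunctor T (d p))

end Localisation

/-! ### Local Serre duality -/

section SerreDuality

variable {R : Type v} [Ring R] {𝒜 : ℤ → AddSubgroup R} [GradedRing 𝒜]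

variable (C : Type w) [Category.{v} C] [Preadditive C] [HasShift C ℤ]
  [∀ n : ℤ, (shiftFunctor C n).Additive] [RLinear 𝒜 C]

/-- The objects `X` such that `End^*(X)` is `p`-torsion. -/
def endTorsion (p : HSpec 𝒜) : ObjectProperty C := fun X => IsTorsionModule p (homMod 𝒜 X X)

variable {C} in
lemma endTorsion_iff (p : HSpec 𝒜) (X : C) : endTorsion C p X ↔
    ∀ q : HSpec 𝒜, ¬ p.ideal ≤ q.ideal →
      ∃ (a : ℤ) (s : 𝒜 a), (s : R) ∉ q.ideal ∧ RLinear.act X a s = 0 := by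
  refine ⟨fun h q hq => ?_, fun h q hq i m => ?_⟩
  · obtain ⟨a, s, hs, h0⟩ := h q hq 0 (ShiftedHom.mk₀ 0 rfl (𝟙 X))
    refine ⟨a, s, hs, ?_⟩
    change (ShiftedHom.mk₀ 0 rfl (𝟙 X)).comp (RLinear.act X a s) _ = 0 at h0
    have key : ∀ (b : ℤ) (hb : a + 0 = b), b = a →
        (ShiftedHom.mk₀ 0 rfl (𝟙 X)).comp (RLinear.act X a s) hb = 0 →
        RLinear.act X a s = 0 := by
      rintro b hb rfl h
      simpa using h
    exact key _ rfl (add_zero a) h0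
  · obtain ⟨a, s, hs, h0⟩ := h q hq
    refine ⟨a, s, hs, ?_⟩
    change ShiftedHom.comp m (RLinear.act X a s) _ = 0
    rw [h0]
    exact ShiftedHom.comp_zero (Z := X) (show ShiftedHom X X i from m) rfl

instance (p : HSpec 𝒜) : (endTorsion C p).IsClosedUnderIsomorphisms where
  of_iso {X Y} e h := by
    rw [endTorsion_iff] at h ⊢
    intro q hq
    obtain ⟨a, s, hs, h0⟩ := h q hq
    refine ⟨a, s, hs, ?_⟩
    have hc := RLinear.act_comm (𝒜 := 𝒜) (add_zero a) (zero_add a) s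
      (ShiftedHom.mk₀ 0 rfl e.inv)
    rw [h0, ShiftedHom.comp_zero, mul_zero, Int.negOnePow_zero, one_smul,
      ShiftedHom.comp_mk₀] at hc
    exact (cancel_mono _).1 (hc.symm.trans zero_comp.symm)

variable [HasZeroObject C] [Pretriangulated C]

open scoped ZeroObject in
instance (p : HSpec 𝒜) : (endTorsion C p).IsTriangulated where
  exists_zero := ⟨0, isZero_zero C, (endTorsion_iff p _).2 fun q hq =>
    ⟨0, ⟨1, SetLike.GradedOne.one_mem⟩, fun h => q.ne_top ((Ideal.eq_top_iff_one _).2 h),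
      (isZero_zero C).eq_of_src _ _⟩⟩
  isStableUnderShiftBy n := ⟨fun X hX => by
    refine (endTorsion_iff p _).2 fun q hq => ?_
    obtain ⟨a, s, hs, h0⟩ := (endTorsion_iff p _).1 hX q hq
    refine ⟨a, s, hs, ?_⟩
    have hc := RLinear.act_comm (𝒜 := 𝒜) (k := a + n) rfl (add_comm n a) s
      (show ShiftedHom (X⟦n⟧) X n from 𝟙 (X⟦n⟧))
    rw [h0, ShiftedHom.comp_zero] at hc
    have hc' : (RLinear.act (X⟦n⟧) a s).comp (show ShiftedHom (X⟦n⟧) X n from 𝟙 (X⟦n⟧))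
        (add_comm n a) = 0 := by
      rw [eq_comm, smul_eq_iff_eq_inv_smul, smul_zero] at hc
      exact hc
    simp only [ShiftedHom.comp, CategoryTheory.Functor.map_id, Category.id_comp] at hc'
    exact (cancel_mono _).1 (hc'.trans zero_comp.symm)⟩
  toIsTriangulatedClosed₂ := .mk' (by
    intro Δ hΔ h₁ h₃
    refine (endTorsion_iff p _).2 fun q hq => ?_
    obtain ⟨a, s, hs, h0⟩ := (endTorsion_iff p _).1 h₁ q hq
    obtain ⟨b, t, ht, h0'⟩ := (endTorsion_iff p _).1 h₃ q hq
    have hc := RLinear.act_comm (𝒜 := 𝒜) (add_zero b) (zero_add b) t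
      (ShiftedHom.mk₀ 0 rfl Δ.mor₂)
    rw [h0', ShiftedHom.comp_zero, mul_zero, Int.negOnePow_zero, one_smul,
      ShiftedHom.comp_mk₀] at hc
    obtain ⟨β, hβ⟩ : ∃ β : Δ.obj₂ ⟶ Δ.obj₁⟦b⟧, RLinear.act Δ.obj₂ b t = β ≫ Δ.mor₁⟦b⟧' := by
      obtain ⟨β, hβ⟩ := Triangle.coyoneda_exact₂ _ (Triangle.shift_distinguished _ hΔ b)
        (RLinear.act Δ.obj₂ b t)
        (by
          change RLinear.act Δ.obj₂ b t ≫ (b.negOnePow • Δ.mor₂⟦b⟧') = 0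
          rw [Linear.comp_units_smul, ← hc, smul_zero])
      change Δ.obj₂ ⟶ Δ.obj₁⟦b⟧ at β
      refine ⟨b.negOnePow • β, ?_⟩
      refine hβ.trans ?_
      change β ≫ (b.negOnePow • Δ.mor₁⟦b⟧') = _
      rw [Linear.comp_units_smul, Linear.units_smul_comp]
    have hc2 := RLinear.act_comm (𝒜 := 𝒜) (add_zero a) (zero_add a) s
      (ShiftedHom.mk₀ 0 rfl Δ.mor₁)
    rw [h0, ShiftedHom.zero_comp, smul_zero] at hc2
    refine ⟨a + b, ⟨(s : R) * (t : R), SetLike.mul_mem_graded s.2 t.2⟩, fun h => ?_, ?_⟩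
    · exact (q.mem_or_mem _ _ _ _ s.2 t.2 h).elim hs ht
    · rw [RLinear.act_mul _ rfl s t, hβ, ← ShiftedHom.comp_mk₀ (X := Δ.obj₂) β 0 rfl Δ.mor₁,
        ShiftedHom.comp_assoc (a₁₂ := b) (a₂₃ := a) _ _ _ (zero_add b) (add_zero a) (by lia), hc2,
        ShiftedHom.comp_zero])

variable {C} in
/-- A Serre functor relative to `I` (the injective hull of the residue field): an `R`-linear
triangle equivalence `F` with a natural isomorphism `Hom_R(Hom^*(X, Y), I) ≅ Hom(Y, F X)`. -/
def IsSerreFunctor (I : GrMod 𝒜) (F : C ⥤ C) : Prop :=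
  IsRLinearTriangleEquivalence 𝒜 F ∧ Nonempty (DualityIso 𝒜 (𝟭 C) (𝟭 C) F I)

/-- The `R`-linear triangulated category `C_p`: it comes with an `R`-linear exact functor
`Q : C → C_p` that is surjective on objects up to isomorphism and exhibits
`Hom^*_{C_p}(QX, QY)` as the localisation `Hom^*_C(X, Y)_p`.  These data are determined up to
`R`-linear triangle equivalence. -/
structure LocalisedCategory (p : HSpec 𝒜) where
  Obj : Type w
  [category : Category.{v} Obj]
  [preadditive : Preadditive Obj]
  [hasShift : HasShift Obj ℤ]
  [additive : ∀ n : ℤ, (shiftFunctor Obj n).Additive]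
  [hasZeroObject : HasZeroObject Obj]
  [pretriangulated : Pretriangulated Obj]
  [triangulated : IsTriangulated Obj]
  [rLinear : RLinear 𝒜 Obj]
  Q : C ⥤ Obj
  [commShift : Q.CommShift ℤ]
  [exact : Q.IsTriangulated]
  linear : IsRLinearFunctor 𝒜 Q
  essSurj : Q.EssSurj
  isLocalisation : ∀ X Y : C, IsLocalisationMap p (homMap 𝒜 Q linear X Y)

attribute [instance] LocalisedCategory.category LocalisedCategory.preadditive
  LocalisedCategory.hasShift LocalisedCategory.additive LocalisedCategory.hasZeroObject
  LocalisedCategory.pretriangulated LocalisedCategory.triangulated LocalisedCategory.rLinear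

/-- Local Serre duality for `C`: there is an `R`-linear triangle equivalence `F : C → C` such that
for every homogeneous prime `p` and some integer `d(p)` the functor `Σ^{-d(p)} F_p` is a Serre
functor on `γ_p C`, the subcategory of objects of `C_p` with `p`-torsion endomorphism ring.
Here `F_p : C_p → C_p` is induced by `F` and restricts to `Fγ : γ_p C → γ_p C`. -/
def SatisfiesLocalSerreDuality (I : HSpec 𝒜 → GrMod 𝒜) : Prop :=
  ∃ F : C ⥤ C, IsRLinearTriangleEquivalence 𝒜 F ∧
    ∀ p : HSpec 𝒜, ∃ (d : ℤ) (L : LocalisedCategory C p) (Fp : L.Obj ⥤ L.Obj)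
      (Fγ : (endTorsion L.Obj p).FullSubcategory ⥤ (endTorsion L.Obj p).FullSubcategory),
      Nonempty (L.Q ⋙ Fp ≅ F ⋙ L.Q) ∧
      Nonempty (Fγ ⋙ (endTorsion L.Obj p).ι ≅ (endTorsion L.Obj p).ι ⋙ Fp) ∧
      IsSerreFunctor (I p) (Fγ ⋙ shiftFunctor (endTorsion L.Obj p).FullSubcategory (-d))

end SerreDuality

end LocalSerre

set_option linter.unusedSectionVars false

/-! For a compact `p`-torsion object `C` and a `p`-local object `Y` there is a chain of natural
isomorphisms Hom_R(Hom^*(C_p, Y), I(p)) ≅ Hom_R(Hom^*(C, Y), I(p)) ≅ Hom(Y, T_p C) ≅ Hom(Y, Σ^{-d}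
Γ_p F C) ≅ Hom(Y, Σ^{-d} (F C)_p) ≅ Hom(Y, Σ^{-d} F_p(C_p)). The first is the universal property of
localisation, the second defines T_p, the third is the Gorenstein hypothesis and the last defines
F_p. The fourth holds because torsion of a compact object is a condition on the action of `R` on it,
which the `R`-linear functor F preserves: (F C)_p is already `p`-torsion, and Γ_p changes nothing.

The chain is natural only in morphisms C → C', and it reaches only objects of the form C_p. A
morphism C_p → C'_p is a fraction whose denominator is a homogeneous element outside `p`
(`IsLocalisationAt.exists_comp_map_act_eq`), so naturality extends to it
(`DualityIso.naturality_of_fraction`). Every compact object of Γ_p T is a retract of C_p for some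
compact `p`-torsion C (`IsLocalisationAt.exists_torsion_retract`), and dualities extend to retracts
(`DualityIso.nonempty_of_retracts`). All this is assembled in
`IsLocalisationAt.nonempty_dualityIso`.

The rest is localisation theory. The `p`-local objects are those right orthogonal to the cones of
elements outside `p` on compact generators, so Bousfield localisation at compact objects produces
X_p. The `p`-torsion objects are generated by Koszul objects on finitely many generators of `p`;
here `R` has to be noetherian and graded commutative. Compact objects of T_p are retracts of
localised compact objects by Neeman's factorisation argument (`Approximable.ext`,
`IsLocalisationAt.exists_retract`).

For (2), the category C_p is realised in T as the essential image of the compact objects under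
localisation, and the duality is restricted to γ_p C. For `p` outside the support γ_p C is zero. -/

namespace LocalSerre

/-! ### The action of homogeneous elements on objects, and its signs -/

section Action

variable {R : Type v} [Ring R] {𝒜 : ℤ → AddSubgroup R} [GradedRing 𝒜]
variable {C : Type w} [Category.{v} C] [Preadditive C] [HasShift C ℤ]
  [∀ n : ℤ, (shiftFunctor C n).Additive] [RLinear 𝒜 C]

/-- The action of a homogeneous element, as a morphism `X ⟶ X⟦a⟧`. -/
noncomputable def act {a : ℤ} (s : 𝒜 a) (X : C) : X ⟶ X⟦a⟧ := RLinear.act X a s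

lemma act_naturality {a : ℤ} (s : 𝒜 a) {X Y : C} (f : X ⟶ Y) :
    act s X ≫ f⟦a⟧' = f ≫ act s Y := by
  have hc := RLinear.act_comm (𝒜 := 𝒜) (add_zero a) (zero_add a) s (ShiftedHom.mk₀ 0 rfl f)
  rw [mul_zero, Int.negOnePow_zero, one_smul, ShiftedHom.comp_mk₀, ShiftedHom.mk₀_comp] at hc
  exact hc.symm

lemma act_naturality_assoc {a : ℤ} (s : 𝒜 a) {X Y Z : C} (f : X ⟶ Y) (g : Y⟦a⟧ ⟶ Z) :
    act s X ≫ f⟦a⟧' ≫ g = f ≫ act s Y ≫ g := by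
  rw [← Category.assoc, act_naturality, Category.assoc]

/-- Graded commutativity of the action, applied to the identity of `X⟦n⟧` read as a morphism from
`X⟦n⟧` to `X` of degree `n`. -/
lemma shift_map_act {a : ℤ} (s : 𝒜 a) (X : C) (n : ℤ) :
    (act s X)⟦n⟧' =
      (a * n).negOnePow • act s (X⟦n⟧) ≫ (shiftFunctorComm C n a).hom.app X := by
  have hc := RLinear.act_comm (𝒜 := 𝒜) (k := a + n) rfl (add_comm n a) s
    (show ShiftedHom (X⟦n⟧) X n from 𝟙 (X⟦n⟧))
  simp only [ShiftedHom.comp, CategoryTheory.Functor.map_id, Category.id_comp] at hc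
  rw [← cancel_mono ((shiftFunctorAdd' C a n (a + n) rfl).inv.app X)]
  refine hc.trans ?_
  rw [Linear.units_smul_comp, Category.assoc, shiftFunctorComm_eq C n a (a + n) (add_comm n a)]
  simp [act]

lemma act_shift {a : ℤ} (s : 𝒜 a) (X : C) (n : ℤ) :
    act s (X⟦n⟧) =
      (a * n).negOnePow • (act s X)⟦n⟧' ≫ (shiftFunctorComm C n a).inv.app X := by
  rw [shift_map_act, Linear.units_smul_comp, Category.assoc, Iso.hom_inv_id_app,
    smul_smul, Int.units_mul_self, one_smul]
  simp

lemma homMod_smul {X Y : C} {a i j : ℤ} (h : a + i = j) (s : 𝒜 a) (α : X ⟶ Y⟦i⟧) :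
    (homMod 𝒜 X Y).smul h s α =
      (α ≫ (act s Y)⟦i⟧' ≫ (shiftFunctorAdd' C a i j h).inv.app Y : X ⟶ Y⟦j⟧) := rfl

lemma isLocalModule_homMod {p : HSpec 𝒜} {X Y : C}
    (h : ∀ (a : ℤ) (s : 𝒜 a), (s : R) ∉ p.ideal → IsIso (act s Y)) :
    IsLocalModule p (homMod 𝒜 X Y) := by
  intro a i j hij s hs
  have := h a s hs
  let e : Y⟦i⟧ ≅ Y⟦j⟧ := asIso ((act s Y)⟦i⟧' ≫ (shiftFunctorAdd' C a i j hij).inv.app Y)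
  refine ⟨fun f g hfg => ?_, fun g => ⟨g ≫ e.inv, ?_⟩⟩
  · exact (cancel_mono e.hom).1 hfg
  · exact (Category.assoc _ _ _).trans ((congrArg (g ≫ ·) e.inv_hom_id).trans (Category.comp_id _))

/-- The module action of `s` and composition with `act s (Y⟦i⟧)` differ by a sign and an
isomorphism, so annihilation can be tested by plain composition. -/
lemma homMod_smul_eq_zero_iff {X Y : C} {a i j : ℤ} (h : a + i = j) (s : 𝒜 a) (α : X ⟶ Y⟦i⟧) :
    (homMod 𝒜 X Y).smul h s α = 0 ↔ α ≫ act s (Y⟦i⟧) = 0 := by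
  rw [homMod_smul, act_shift, Linear.comp_units_smul, ← Category.assoc, ← Category.assoc,
    smul_eq_zero_iff_eq]
  exact ((Preadditive.IsIso.comp_right_eq_zero _ _)).trans
    (Preadditive.IsIso.comp_right_eq_zero _ _).symm

end Action

/-! ### Exactness properties of distinguished triangles -/

section Triangles

variable {T : Type w} [Category.{v} T] [Preadditive T] [HasShift T ℤ]
  [∀ n : ℤ, (shiftFunctor T n).Additive] [HasZeroObject T] [Pretriangulated T]
  {X Y Z : T} {f : X ⟶ Y} {g : Y ⟶ Z} {h : Z ⟶ X⟦(1 : ℤ)⟧}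

namespace Dist

lemma zero₁₂ (H : Triangle.mk f g h ∈ distTriang T) : f ≫ g = 0 := comp_distTriang_mor_zero₁₂ _ H

lemma zero₂₃ (H : Triangle.mk f g h ∈ distTriang T) : g ≫ h = 0 := comp_distTriang_mor_zero₂₃ _ H

lemma zero₃₁ (H : Triangle.mk f g h ∈ distTriang T) : h ≫ f⟦(1 : ℤ)⟧' = 0 :=
  comp_distTriang_mor_zero₃₁ _ H

lemma desc₂ (H : Triangle.mk f g h ∈ distTriang T) {W : T} (k : Y ⟶ W) (hk : f ≫ k = 0) :
    ∃ l : Z ⟶ W, k = g ≫ l := Triangle.yoneda_exact₂ _ H k hk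

lemma desc₃ (H : Triangle.mk f g h ∈ distTriang T) {W : T} (k : Z ⟶ W) (hk : g ≫ k = 0) :
    ∃ l : X⟦(1 : ℤ)⟧ ⟶ W, k = h ≫ l := Triangle.yoneda_exact₃ _ H k hk

lemma lift₂ (H : Triangle.mk f g h ∈ distTriang T) {W : T} (k : W ⟶ Y) (hk : k ≫ g = 0) :
    ∃ l : W ⟶ X, k = l ≫ f := Triangle.coyoneda_exact₂ _ H k hk

lemma lift₃ (H : Triangle.mk f g h ∈ distTriang T) {W : T} (k : W ⟶ Z) (hk : k ≫ h = 0) :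
    ∃ l : W ⟶ Y, k = l ≫ g := Triangle.coyoneda_exact₃ _ H k hk

lemma isIso₁ (H : Triangle.mk f g h ∈ distTriang T) (hZ : IsZero Z) : IsIso f :=
  (Triangle.isZero₃_iff_isIso₁ _ H).1 hZ

end Dist

end Triangles

/-! ### Localizing subcategories and orthogonality -/

section Localizing

open scoped ZeroObject

variable {T : Type w} [Category.{v} T] [Preadditive T] [HasShift T ℤ]
  [∀ n : ℤ, (shiftFunctor T n).Additive]

lemma eq_zero_of_shift_map_eq_zero {X Y : T} {f : X ⟶ Y} (n : ℤ) (h : f⟦n⟧' = 0) : f = 0 :=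
  (Functor.map_eq_zero_iff (shiftFunctor T n)).1 h

/-- A morphism into a shift comes from a morphism out of the inverse shift. -/
lemma exists_eq_shift_map {K Y : T} {n : ℤ} (g : K ⟶ Y⟦n⟧) :
    ∃ g' : K⟦-n⟧ ⟶ Y, g = (shiftNegShift K n).inv ≫ g'⟦n⟧' := by
  refine ⟨(shiftFunctor T n).preimage ((shiftNegShift K n).hom ≫ g), ?_⟩
  rw [Functor.map_preimage, Iso.inv_hom_id_assoc]

/-- The shift of a colimit cofan is a colimit cofan. -/
noncomputable def isColimitShiftCofan {J : Type*} {Y : J → T} {c : Cofan Y} (hc : IsColimit c)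
    (n : ℤ) : IsColimit (Cofan.mk (f := fun j => (Y j)⟦n⟧) (c.pt⟦n⟧) (fun j => (c.inj j)⟦n⟧')) :=
  have : PreservesColimit (Discrete.functor Y) (shiftFunctor T n) := inferInstance
  isColimitMapCoconeCofanMkEquiv (shiftFunctor T n) Y (fun j => c.inj j)
    (isColimitOfPreserves _ (hc.ofIsoColimit (Cocone.ext (Iso.refl _))))

/-- Closure of a property of objects under set-indexed coproducts. -/
def ClosedUnderCoproducts (P : ObjectProperty T) : Prop :=
  ∀ ⦃J : Type v⦄ (Y : J → T) (c : Cofan Y), IsColimit c → (∀ j, P (Y j)) → P c.pt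

variable [HasZeroObject T] [Pretriangulated T]

/-- Localizing subcategories: triangulated subcategories closed under coproducts. -/
structure IsLocalizing (P : ObjectProperty T) : Prop where
  isTriangulated : P.IsTriangulated
  of_iso : P.IsClosedUnderIsomorphisms
  coproducts : ClosedUnderCoproducts P

/-- The localizing subcategory generated by a family of objects. -/
def loc {J : Type v} (S : J → T) : ObjectProperty T := fun X =>
  ∀ P : ObjectProperty T, IsLocalizing P → (∀ j, P (S j)) → P X

/-- The objects receiving no nonzero morphism from the members of a family. -/
def perp {J : Type v} (S : J → T) : ObjectProperty T := fun X => ∀ (j : J) (f : S j ⟶ X), f = 0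

/-- A family of objects closed under shifts. -/
def ShiftStable {J : Type v} (S : J → T) : Prop :=
  ∀ (j : J) (n : ℤ), ∃ j', Nonempty ((S j)⟦n⟧ ≅ S j')

lemma IsLocalizing.cone {P : ObjectProperty T} (h : IsLocalizing P) (Δ : Triangle T)
    (hΔ : Δ ∈ distTriang T) (h₁ : P Δ.obj₁) (h₂ : P Δ.obj₂) : P Δ.obj₃ :=
  have := h.isTriangulated
  have := h.of_iso
  P.ext_of_isTriangulatedClosed₃ _ hΔ h₁ h₂

lemma isLocalizing_loc {J : Type v} (S : J → T) : IsLocalizing (loc S) where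
  of_iso := ⟨fun e h P hP hS => have := hP.of_iso; P.prop_of_iso e (h P hP hS)⟩
  isTriangulated :=
    { exists_zero := ⟨0, isZero_zero T, fun P hP _ => by
        have := hP.isTriangulated
        have := hP.of_iso
        exact P.prop_of_isZero (isZero_zero T)⟩
      isStableUnderShiftBy := fun n => ⟨fun X hX P hP hS => by
        have := hP.isTriangulated
        exact P.le_shift n _ (hX P hP hS)⟩
      ext₂' := fun Δ hΔ h₁ h₃ => ObjectProperty.le_isoClosure _ _ fun P hP hS => by
        have := hP.isTriangulated
        have := hP.of_iso
        exact P.ext_of_isTriangulatedClosed₂ _ hΔ (h₁ P hP hS) (h₃ P hP hS) }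
  coproducts := fun _ Y c hc h P hP hS => hP.coproducts Y c hc fun j => h j P hP hS

lemma mem_loc {J : Type v} (S : J → T) (j : J) : loc S (S j) := fun _ _ h => h j

lemma perp_shift {J : Type v} {S : J → T} (hS : ShiftStable S) {X : T} (hX : perp S X) (n : ℤ) :
    perp S (X⟦n⟧) := by
  intro j f
  obtain ⟨g, rfl⟩ := exists_eq_shift_map f
  obtain ⟨j', ⟨e⟩⟩ := hS j (-n)
  have : g = 0 := by rw [← cancel_epi e.inv, hX j' (e.inv ≫ g), comp_zero]
  rw [this, Functor.map_zero, comp_zero]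

/-- There are no nonzero morphisms from the localizing subcategory generated by a family to
an object right orthogonal to that family. -/
lemma loc_perp {J : Type v} {S : J → T} (hS : ShiftStable S) {A B : T} (hA : loc S A)
    (hB : perp S B) (f : A ⟶ B) : f = 0 := by
  have : (perp S).IsStableUnderShift ℤ :=
    { isStableUnderShiftBy := fun n => ⟨fun X hX => perp_shift hS hX n⟩ }
  -- The left orthogonal of `perp S` is localizing and contains `S`, hence contains `loc S`.
  refine hA (perp S).leftOrthogonal ⟨inferInstance, inferInstance, ?_⟩ ?_ f hB
  · intro J Y c hc h Z g hZ
    exact Cofan.IsColimit.hom_ext hc _ _ fun j => (h j _ hZ).trans comp_zero.symm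
  · intro j Z g hZ
    exact hZ j g

/-! ### Homotopy colimits of sequences -/

section Hocolim

variable [HasCoproducts.{v} T] (A : ℕ → T) (i : ∀ n, A n ⟶ A (n + 1))

/-- The homotopy colimit of a sequence. -/
lemma exists_hocolim : ∃ (H : T) (ι : ∀ n, A n ⟶ H), (∀ n, i n ≫ ι (n + 1) = ι n) ∧
    (∀ P : ObjectProperty T, IsLocalizing P → (∀ n, P (A n)) → P H) ∧
    (∀ (X : T) (a : ∀ n, A n ⟶ X), (∀ n, i n ≫ a (n + 1) = a n) → ∃ f : H ⟶ X,
      ∀ n, ι n ≫ f = a n) ∧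
    (∀ (K : T), IsCompactObject K → ∀ f : K ⟶ H, ∃ (n : ℕ) (g : K ⟶ A n), f = g ≫ ι n) := by
  classical
  let Y : ULift.{v} ℕ → T := fun n => A n.down
  let inj : ∀ n, A n ⟶ ∐ Y := fun n => Sigma.ι Y ⟨n⟩
  -- Identity minus shift along the sequence; the homotopy colimit is its cone.
  let u : ∐ Y ⟶ ∐ Y := Limits.Sigma.desc fun n => inj n.down - i n.down ≫ inj (n.down + 1)
  have hu : ∀ n, inj n ≫ u = inj n - i n ≫ inj (n + 1) := fun n => by simp [inj, u]
  obtain ⟨H, π, δ, hΔ⟩ := distinguished_cocone_triangle u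
  have huπ : u ≫ π = 0 := Dist.zero₁₂ hΔ
  have hcomp : ∀ n, i n ≫ inj (n + 1) ≫ π = inj n ≫ π := fun n => by
    have := congrArg (inj n ≫ ·) huπ
    simp only [comp_zero] at this
    rw [← Category.assoc, hu, Preadditive.sub_comp, sub_eq_zero, Category.assoc] at this
    exact this.symm
  refine ⟨H, fun n => inj n ≫ π, hcomp, ?_, ?_, ?_⟩
  · intro P hP h
    have h' : P (∐ Y) := hP.coproducts Y _ (coproductIsCoproduct Y) fun n => h n.down
    exact hP.cone _ hΔ h' h'
  · intro X a ha
    obtain ⟨f, hf⟩ := Dist.desc₂ hΔ (Limits.Sigma.desc fun n : ULift.{v} ℕ => a n.down) (by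
      refine Sigma.hom_ext _ _ fun n => ?_
      change inj n.down ≫ u ≫ _ = inj n.down ≫ 0
      rw [← Category.assoc, hu]
      simp [inj, ha])
    refine ⟨f, fun n => ?_⟩
    rw [Category.assoc, ← hf]
    simp [inj]
  · intro K hK f
    -- Compactness of `K` makes `f ≫ δ` a finite sum, so it suffices that its components under the
    -- projections `p n` vanish. They do by induction on `n`, since `f ≫ δ` is killed by `u⟦1⟧'`
    -- while `p 0` equals `u ≫ p 0` and `p (n + 1)` equals `u ≫ p (n + 1) + p n ≫ i n`.
    have hδ : f ≫ δ = 0 := by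
      let p : ∀ n, ∐ Y ⟶ A n := fun n => Limits.Sigma.desc fun m =>
        if h : m.down = n then eqToHom (show A m.down = A n by rw [h]) else 0
      have hp : ∀ n, inj n ≫ p n = 𝟙 _ := fun n => by
        simp only [inj, p, colimit.ι_desc, Cofan.mk_ι_app, dite_true, eqToHom_refl]
        rfl
      have hp' : ∀ m n, m ≠ n → inj m ≫ p n = 0 := fun m n h => by simp [inj, p, h]
      have hu0 : u ≫ p 0 = p 0 := by
        refine Sigma.hom_ext _ _ fun m => ?_
        change inj m.down ≫ u ≫ _ = inj m.down ≫ _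
        rw [← Category.assoc, hu, Preadditive.sub_comp, Category.assoc, hp' _ 0 (Nat.succ_ne_zero _)]
        simp
      have hu1 : ∀ n, u ≫ p (n + 1) = p (n + 1) - p n ≫ i n := fun n => by
        refine Sigma.hom_ext _ _ fun m => ?_
        change inj m.down ≫ u ≫ _ = inj m.down ≫ _
        rw [← Category.assoc, hu, Preadditive.sub_comp, Category.assoc, Preadditive.comp_sub]
        congr 1
        by_cases h : m.down = n
        · subst h
          rw [hp, Category.comp_id, ← Category.assoc, hp, Category.id_comp]
        · rw [hp' _ _ (by simpa using h), comp_zero, ← Category.assoc, hp' _ _ h, zero_comp]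
      have hδu : f ≫ δ ≫ u⟦(1 : ℤ)⟧' = 0 := by
        have : δ ≫ u⟦(1 : ℤ)⟧' = 0 := Dist.zero₃₁ hΔ
        rw [this, comp_zero]
      have hz : ∀ n, (f ≫ δ) ≫ (p n)⟦(1 : ℤ)⟧' = 0 := by
        intro n
        induction n with
        | zero =>
          rw [← hu0, Functor.map_comp, Category.assoc, reassoc_of% hδu, zero_comp]
        | succ n ih =>
          have h1 := hu1 n
          rw [eq_sub_iff_add_eq] at h1
          rw [← h1, Functor.map_add, Preadditive.comp_add, Functor.map_comp, Functor.map_comp,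
            Category.assoc, reassoc_of% hδu, zero_comp, zero_add]
          simpa using congrArg (· ≫ (i n)⟦(1 : ℤ)⟧') ih
      obtain ⟨s, g, hg⟩ := hK _ _ _ (isColimitShiftCofan (coproductIsCoproduct Y) 1) (f ≫ δ)
      have hg' : f ≫ δ = ∑ j ∈ s, g j ≫ (inj j.down)⟦(1 : ℤ)⟧' := hg
      have h2 : ∀ j ∈ s, g j = 0 := by
        intro j hj
        have h3 := hz j.down
        rw [hg', Preadditive.sum_comp, Finset.sum_eq_single_of_mem j hj, Category.assoc,
          ← Functor.map_comp, hp, CategoryTheory.Functor.map_id] at h3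
        · exact (Category.comp_id _).symm.trans h3
        · intro m _ hm
          rw [Category.assoc, ← Functor.map_comp, hp' _ _ (fun h => hm (ULift.ext _ _ h)),
            Functor.map_zero, comp_zero]
      rw [hg']
      exact Finset.sum_eq_zero fun j hj => by rw [h2 j hj, zero_comp]
    obtain ⟨g, rfl⟩ := Dist.lift₃ hΔ f hδ
    change K ⟶ ∐ Y at g
    obtain ⟨s, g', rfl⟩ := hK _ _ _ (coproductIsCoproduct Y) g
    -- The finitely many components of `g` are moved to a common stage along the transition maps.
    have tr : ∀ n k, ∃ t : A n ⟶ A (n + k), t ≫ inj (n + k) ≫ π = inj n ≫ π := by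
      intro n k
      induction k with
      | zero => exact ⟨𝟙 _, Category.id_comp _⟩
      | succ k ih =>
        obtain ⟨t, ht⟩ := ih
        exact ⟨t ≫ i _, by rw [Category.assoc, ← ht]; exact congrArg (t ≫ ·) (hcomp _)⟩
    have tr' : ∀ n m, n ≤ m → ∃ t : A n ⟶ A m, t ≫ inj m ≫ π = inj n ≫ π := by
      intro n m h
      obtain ⟨k, rfl⟩ := Nat.exists_eq_add_of_le h
      exact tr n k
    clear hδ
    change ∃ n g, (∑ j ∈ s, g' j ≫ inj j.down) ≫ π = g ≫ inj n ≫ π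
    induction s using Finset.induction_on with
    | empty => exact ⟨0, 0, by simp⟩
    | insert j s hj ih =>
      obtain ⟨n, g, hg⟩ := ih
      obtain ⟨t₁, h₁⟩ := tr' n (max n j.down) (le_max_left _ _)
      obtain ⟨t₂, h₂⟩ := tr' j.down (max n j.down) (le_max_right _ _)
      refine ⟨max n j.down, g ≫ t₁ + g' j ≫ t₂, ?_⟩
      rw [Finset.sum_insert hj, Preadditive.add_comp, hg, Preadditive.add_comp, Category.assoc,
        Category.assoc, Category.assoc, h₁, h₂, add_comm]

end Hocolim

/-! ### Bousfield localisation at compact objects -/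

section Bousfield

variable [HasCoproducts.{v} T] {J : Type v} {S : J → T}

/-- Attaching cells to kill the kernel of `Hom(S j, A) → Hom(S j, X)`. -/
lemma exists_attach_cells (S : J → T) {X A : T} (a : A ⟶ X) :
    ∃ (A' : T) (i : A ⟶ A') (a' : A' ⟶ X), i ≫ a' = a ∧
      (∀ j (g : S j ⟶ A), g ≫ a = 0 → g ≫ i = 0) ∧ (loc S A → loc S A') := by
  let K := Σ j, {g : S j ⟶ A // g ≫ a = 0}
  let Y : K → T := fun k => S k.1
  let u : ∐ Y ⟶ A := Limits.Sigma.desc fun k => k.2.1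
  obtain ⟨A', i, δ, hΔ⟩ := distinguished_cocone_triangle u
  obtain ⟨a', ha'⟩ := Dist.desc₂ hΔ a (by
    refine Sigma.hom_ext _ _ fun k => ?_
    rw [comp_zero, ← Category.assoc]
    simp [u, k.2.2])
  refine ⟨A', i, a', ha'.symm, fun j g hg => ?_, fun hA => ?_⟩
  · have h : u ≫ i = 0 := Dist.zero₁₂ hΔ
    have : g = Sigma.ι Y ⟨j, g, hg⟩ ≫ u := by simp [u]
    rw [this, Category.assoc, h, comp_zero]
  · exact (isLocalizing_loc S).cone _ hΔ
      ((isLocalizing_loc S).coproducts Y _ (coproductIsCoproduct Y) fun k => mem_loc S k.1) hA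

omit [HasCoproducts.{v} T] in
lemma eq_zero_of_comp_shift_map {A X : T} (a : A ⟶ X) (hS : ShiftStable S)
    (h : ∀ j (g : S j ⟶ A), g ≫ a = 0 → g = 0) (n : ℤ) (j : J) (g : S j ⟶ A⟦n⟧)
    (hg : g ≫ a⟦n⟧' = 0) : g = 0 := by
  obtain ⟨g', rfl⟩ := exists_eq_shift_map g
  obtain ⟨j', ⟨e⟩⟩ := hS j (-n)
  have h1 : g' ≫ a = 0 := by
    apply eq_zero_of_shift_map_eq_zero n
    rwa [Category.assoc, ← Functor.map_comp, Preadditive.IsIso.comp_left_eq_zero] at hg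
  have : g' = 0 := by
    rw [← cancel_epi e.inv, h j' (e.inv ≫ g') (by rw [Category.assoc, h1, comp_zero]), comp_zero]
  rw [this, Functor.map_zero, comp_zero]

/-- Bousfield localization at a set of compact objects. -/
theorem exists_bousfield_triangle (hS : ShiftStable S) (hc : ∀ j, IsCompactObject (S j)) (X : T) :
    ∃ (A B : T) (a : A ⟶ X) (b : X ⟶ B) (δ : B ⟶ A⟦(1 : ℤ)⟧),
      Triangle.mk a b δ ∈ distTriang T ∧ loc S A ∧ perp S B := by
  let K := Σ j, (S j ⟶ X)
  let Y : K → T := fun k => S k.1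
  -- The sequence runs through objects of `loc S` over `X`. Its first stage already hits every
  -- morphism from `S` to `X`, and each further stage kills the kernel of the previous one. In the
  -- homotopy colimit, injectivity follows as the `S j` are compact, so the cone of `a` is
  -- orthogonal to `S`.
  let O := Σ A : {A : T // loc S A}, (A.1 ⟶ X)
  let o₀ : O := ⟨⟨∐ Y, (isLocalizing_loc S).coproducts Y _ (coproductIsCoproduct Y)
    fun k => mem_loc S k.1⟩, Limits.Sigma.desc fun k => k.2⟩
  choose A' i a' h₁ h₂ h₃ using fun (o : O) => exists_attach_cells S o.2
  let seq : ℕ → O := fun n => Nat.rec o₀ (fun _ o => ⟨⟨A' o, h₃ o o.1.2⟩, a' o⟩) n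
  obtain ⟨H, ι, hι, hP, hX, hK⟩ := exists_hocolim (fun n => (seq n).1.1) (fun n => i (seq n))
  obtain ⟨a, ha⟩ := hX X (fun n => (seq n).2) (fun n => h₁ (seq n))
  have hH : loc S H := hP _ (isLocalizing_loc S) fun n => (seq n).1.2
  have hinj : ∀ j (g : S j ⟶ H), g ≫ a = 0 → g = 0 := by
    intro j g hg
    obtain ⟨n, g', rfl⟩ := hK _ (hc j) g
    rw [Category.assoc, ha] at hg
    rw [← hι, ← Category.assoc, h₂ _ _ g' hg, zero_comp]
  have hsurj : ∀ j (g : S j ⟶ X), ∃ g' : S j ⟶ H, g = g' ≫ a := by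
    intro j g
    refine ⟨Sigma.ι Y ⟨j, g⟩ ≫ ι 0, ?_⟩
    rw [Category.assoc, ha]
    change _ = Sigma.ι Y ⟨j, g⟩ ≫ Limits.Sigma.desc _
    simp
  obtain ⟨B, b, δ, hΔ⟩ := distinguished_cocone_triangle a
  refine ⟨H, B, a, b, δ, hΔ, hH, fun j f => ?_⟩
  have hf : f ≫ δ = 0 := by
    refine eq_zero_of_comp_shift_map a hS hinj 1 j _ ?_
    have : δ ≫ a⟦(1 : ℤ)⟧' = 0 := Dist.zero₃₁ hΔ
    rw [Category.assoc, this, comp_zero]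
  obtain ⟨g, rfl⟩ := Dist.lift₃ hΔ f hf
  change S j ⟶ X at g
  obtain ⟨g', rfl⟩ := hsurj j g
  have : a ≫ b = 0 := Dist.zero₁₂ hΔ
  change (g' ≫ a) ≫ b = 0
  rw [Category.assoc, this, comp_zero]

end Bousfield

/-! ### Compact generators -/

section Generators

/-- A set of compact generators closed under shifts. -/
structure IsGenerating {J : Type v} (G : J → T) : Prop where
  compact : ∀ j, IsCompactObject (G j)
  shift : ShiftStable G
  isZero : ∀ X, perp G X → IsZero X

lemma IsCompactlyGenerated.exists_isGenerating (h : IsCompactlyGenerated T) :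
    ∃ (J : Type v) (G : J → T), IsGenerating G := by
  obtain ⟨J, G, hG, hz⟩ := h
  refine ⟨J × ℤ, fun k => (G k.1)⟦k.2⟧, fun k => (hG k.1).shift k.2, fun k n =>
    ⟨⟨k.1, k.2 + n⟩, ⟨(shiftFunctorAdd T k.2 n).symm.app (G k.1)⟩⟩, fun X hX => hz X ?_⟩
  intro j n f
  obtain ⟨g, rfl⟩ := exists_eq_shift_map f
  rw [hX (j, -n) g, Functor.map_zero, comp_zero]

variable {J : Type v} {G : J → T}

/-- The cone of `f` receives no nonzero morphism from a generator: injectivity, carried over to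
shifts, shows that such a morphism comes from `Y`, and surjectivity then makes it zero. -/
lemma IsGenerating.isIso (hG : IsGenerating G) {X Y : T} (f : X ⟶ Y)
    (hinj : ∀ j (g : G j ⟶ X), g ≫ f = 0 → g = 0)
    (hsurj : ∀ j (g : G j ⟶ Y), ∃ g' : G j ⟶ X, g = g' ≫ f) : IsIso f := by
  obtain ⟨K, k, δ, hΔ⟩ := distinguished_cocone_triangle f
  refine Dist.isIso₁ hΔ (hG.isZero _ fun j h => ?_)
  have hf : h ≫ δ = 0 := by
    refine eq_zero_of_comp_shift_map f hG.shift hinj 1 j _ ?_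
    have : δ ≫ f⟦(1 : ℤ)⟧' = 0 := Dist.zero₃₁ hΔ
    exact (Category.assoc _ _ _).trans ((congrArg (h ≫ ·) this).trans comp_zero)
  obtain ⟨g, rfl⟩ := Dist.lift₃ hΔ h hf
  change G j ⟶ Y at g
  obtain ⟨g', rfl⟩ := hsurj j g
  have : f ≫ k = 0 := Dist.zero₁₂ hΔ
  change (g' ≫ f) ≫ k = 0
  rw [Category.assoc, this, comp_zero]

/-- In the Bousfield triangle for `G` the third term is zero, so every object lies in `loc G`. -/
lemma IsGenerating.mem_of_isLocalizing [HasCoproducts.{v} T] (hG : IsGenerating G)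
    {P : ObjectProperty T} (hP : IsLocalizing P) (h : ∀ j, P (G j)) (X : T) : P X := by
  obtain ⟨A, B, a, b, δ, hΔ, hA, hB⟩ := exists_bousfield_triangle hG.shift hG.compact X
  have : IsIso a := Dist.isIso₁ hΔ (hG.isZero _ hB)
  have := hP.of_iso
  exact P.prop_of_iso (asIso a) (hA P hP h)

end Generators

/-! ### Splitting of idempotents -/

section Idempotents

/-- Idempotents split in a triangulated category with countable coproducts. -/
lemma exists_idempotent_splitting [HasCoproducts.{v} T] {X : T} (e : X ⟶ X) (he : e ≫ e = e) :
    ∃ (Y : T) (i : Y ⟶ X) (r : X ⟶ Y), i ≫ r = 𝟙 Y ∧ r ≫ i = e := by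
  let Z : ULift.{v} ℕ → T := fun _ => X
  let inj : ℕ → (X ⟶ ∐ Z) := fun n => Sigma.ι Z ⟨n⟩
  let u : ∐ Z ⟶ ∐ Z := Limits.Sigma.desc fun n => inj n.down - e ≫ inj (n.down + 1)
  -- The splitting is the homotopy colimit of `X` along `e`, the cone of `u`. Where `e` acts as
  -- zero, `u` is the identity; where `e` acts as the identity, `u` is one minus the shift, undone
  -- by minus the sum of the earlier inclusions. `ρ` combines the two, so `u` is a split
  -- monomorphism and what is left over is `e` in the summand 0.
  let ρ : ∐ Z ⟶ ∐ Z := Limits.Sigma.desc fun n => inj n.down - e ≫ inj n.down -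
    ∑ k ∈ Finset.range n.down, e ≫ inj k
  let σ : ∐ Z ⟶ X := Limits.Sigma.desc fun _ => 𝟙 X
  have hu : ∀ n, inj n ≫ u = inj n - e ≫ inj (n + 1) := fun n => by simp [inj, u]
  have hρ : ∀ n, inj n ≫ ρ = inj n - e ≫ inj n - ∑ k ∈ Finset.range n, e ≫ inj k :=
    fun n => by simp [inj, ρ]
  have hσ : ∀ n, inj n ≫ σ = 𝟙 X := fun n => by simp [inj, σ]
  have ext : ∀ {W : T} (f g : ∐ Z ⟶ W), (∀ n, inj n ≫ f = inj n ≫ g) → f = g :=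
    fun f g h => Sigma.hom_ext _ _ fun n => h n.down
  have he' : ∀ {W : T} (f : X ⟶ W), e ≫ e ≫ f = e ≫ f := fun f => by
    rw [← Category.assoc, he]
  have huρ : u ≫ ρ = 𝟙 _ := ext _ _ fun n => by
    rw [← Category.assoc, hu, Preadditive.sub_comp, hρ, Category.assoc, hρ,
      Preadditive.comp_sub, Preadditive.comp_sub, he', sub_self, zero_sub, Preadditive.comp_sum,
      Finset.sum_congr rfl (fun k _ => he' (inj k)), Finset.sum_range_succ, Category.comp_id]
    abel
  have hρu : 𝟙 _ - ρ ≫ u = σ ≫ e ≫ inj 0 := ext _ _ fun n => by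
    rw [Preadditive.comp_sub, ← Category.assoc, hρ, ← Category.assoc, hσ, Category.id_comp,
      Category.comp_id, Preadditive.sub_comp, Preadditive.sub_comp, Category.assoc, hu,
      Preadditive.comp_sub, he', Preadditive.sum_comp]
    have : ∑ k ∈ Finset.range n, (e ≫ inj k) ≫ u = e ≫ inj 0 - e ≫ inj n := by
      rw [← Finset.sum_range_sub' (fun k => e ≫ inj k)]
      refine Finset.sum_congr rfl fun k _ => ?_
      rw [Category.assoc, hu, Preadditive.comp_sub, he']
    rw [this]
    abel
  obtain ⟨Y, g, δ, hΔ⟩ := distinguished_cocone_triangle u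
  have hg : u ≫ g = 0 := Dist.zero₁₂ hΔ
  obtain ⟨t, ht⟩ := Dist.desc₂ hΔ (𝟙 _ - ρ ≫ u) (by
    change u ≫ (𝟙 _ - ρ ≫ u) = 0
    rw [Preadditive.comp_sub, reassoc_of% huρ, Category.comp_id, sub_self])
  change 𝟙 _ - ρ ≫ u = g ≫ t at ht
  have : Mono u := ⟨fun a b h => by simpa [huρ] using congrArg (· ≫ ρ) h⟩
  have hδ : δ = 0 := (Triangle.mor₃_eq_zero_iff_mono₁ _ hΔ).2 this
  have : Epi g := (Triangle.mor₃_eq_zero_iff_epi₂ _ hΔ).1 hδ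
  have hgt : g ≫ t ≫ g = g := by
    rw [← Category.assoc, ← ht, Preadditive.sub_comp, Category.assoc, hg, comp_zero, sub_zero,
      Category.id_comp]
  rw [hρu] at ht
  refine ⟨Y, t ≫ σ, inj 0 ≫ g, ?_, ?_⟩
  · rw [← cancel_epi g, Category.comp_id, Category.assoc, ← Category.assoc g, ← ht]
    have h1 : (σ ≫ e ≫ inj 0) ≫ σ ≫ inj 0 ≫ g = (σ ≫ e ≫ inj 0) ≫ g := by
      simp only [Category.assoc, reassoc_of% (hσ 0)]
    rw [h1, ht, Category.assoc, hgt]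
  · rw [Category.assoc, ← Category.assoc g, ← ht]
    simp only [Category.assoc, reassoc_of% (hσ 0), hσ, Category.comp_id]

end Idempotents

end Localizing

/-! ### Products of homogeneous elements and annihilation of morphisms -/

section HomogeneousProducts

variable {R : Type v} [Ring R] {𝒜 : ℤ → AddSubgroup R} [GradedRing 𝒜]

/-- The product of homogeneous elements, in a given total degree. -/
def hmul {m n k : ℤ} (h : m + n = k) (r : 𝒜 m) (s : 𝒜 n) : 𝒜 k :=
  ⟨(r : R) * (s : R), h ▸ SetLike.mul_mem_graded r.2 s.2⟩

lemma hmul_notMem (q : HSpec 𝒜) {m n k : ℤ} (h : m + n = k) {r : 𝒜 m} {s : 𝒜 n}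
    (hr : (r : R) ∉ q.ideal) (hs : (s : R) ∉ q.ideal) : (hmul h r s : R) ∉ q.ideal :=
  fun h' => (q.mem_or_mem _ _ _ _ r.2 s.2 h').elim hr hs

/-- The unit, as a homogeneous element. -/
def hone : 𝒜 0 := ⟨1, SetLike.GradedOne.one_mem⟩

lemma hone_notMem (q : HSpec 𝒜) : ((hone : 𝒜 0) : R) ∉ q.ideal :=
  fun h => q.ne_top ((Ideal.eq_top_iff_one _).2 h)

end HomogeneousProducts

section Action

variable {R : Type v} [Ring R] {𝒜 : ℤ → AddSubgroup R} [GradedRing 𝒜]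
variable {C : Type w} [Category.{v} C] [Preadditive C] [HasShift C ℤ]
  [∀ n : ℤ, (shiftFunctor C n).Additive] [RLinear 𝒜 C]

lemma act_hmul {m n k : ℤ} (h : m + n = k) (r : 𝒜 m) (s : 𝒜 n) (X : C) :
    act (hmul h r s) X = act s X ≫ (act r X)⟦n⟧' ≫ (shiftFunctorAdd' C m n k h).inv.app X :=
  RLinear.act_mul X h r s

lemma act_add {n : ℤ} (r s : 𝒜 n) (X : C) : act (r + s) X = act r X + act s X :=
  map_add (RLinear.act X n) r s

lemma act_zero {n : ℤ} (X : C) : act (0 : 𝒜 n) X = 0 := map_zero (RLinear.act X n)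

instance isIso_act_hone (X : C) : IsIso (act (hone : 𝒜 0) X) := by
  have : act (hone : 𝒜 0) X = (shiftFunctorZero C ℤ).inv.app X :=
    (RLinear.act_one (𝒜 := 𝒜) X).trans (by simp [ShiftedHom.mk₀, shiftFunctorZero'])
  rw [this]
  infer_instance

lemma comp_act_hmul_right {m n k : ℤ} (h : m + n = k) (r : 𝒜 m) {s : 𝒜 n} {Z X : C} {f : Z ⟶ X}
    (hf : f ≫ act s X = 0) : f ≫ act (hmul h r s) X = 0 := by
  rw [act_hmul, reassoc_of% hf, zero_comp]

/-- In the composite `s` acts first; naturality moves it in front of `f`, so that `r` meets `f`. -/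
lemma comp_act_hmul_left {m n k : ℤ} (h : m + n = k) {r : 𝒜 m} (s : 𝒜 n) {Z X : C} {f : Z ⟶ X}
    (hf : f ≫ act r X = 0) : f ≫ act (hmul h r s) X = 0 := by
  rw [act_hmul, ← act_naturality_assoc, ← Functor.map_comp_assoc, hf, Functor.map_zero, zero_comp,
    comp_zero]

lemma comp_act_shift_eq_zero_iff {a : ℤ} (s : 𝒜 a) {Z X : C} (n : ℤ) (f : Z ⟶ X⟦n⟧) :
    f ≫ act s (X⟦n⟧) = 0 ↔ f ≫ (act s X)⟦n⟧' = 0 := by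
  rw [act_shift, Linear.comp_units_smul, ← Category.assoc, smul_eq_zero_iff_eq]
  exact Preadditive.IsIso.comp_right_eq_zero _ _

lemma isIso_units_smul_iff (u : ℤˣ) {X Y : C} (f : X ⟶ Y) : IsIso (u • f) ↔ IsIso f := by
  have key : ∀ (u : ℤˣ) (f : X ⟶ Y), IsIso f → IsIso (u • f) := fun u f _ =>
    ⟨u⁻¹ • inv f, by rw [Linear.units_smul_comp, Linear.comp_units_smul, IsIso.hom_inv_id,
        smul_inv_smul],
      by rw [Linear.units_smul_comp, Linear.comp_units_smul, IsIso.inv_hom_id, inv_smul_smul]⟩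
  refine ⟨fun h => ?_, key u f⟩
  rw [← inv_smul_smul u f]
  exact key u⁻¹ _ h

lemma isIso_act_shift_iff {a : ℤ} (s : 𝒜 a) (X : C) (n : ℤ) :
    IsIso (act s (X⟦n⟧)) ↔ IsIso (act s X) := by
  have h : IsIso (act s (X⟦n⟧)) ↔ IsIso ((act s X)⟦n⟧') := by
    rw [act_shift, isIso_units_smul_iff, isIso_comp_right_iff]
  rw [h]
  exact isIso_iff_of_reflects_iso (act s X) (shiftFunctor C n)

end Action

/-! ### Objects whose localisation at a prime vanishes -/

section NullObjects

variable {R : Type v} [Ring R] {𝒜 : ℤ → AddSubgroup R} [GradedRing 𝒜]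
  {T : Type w} [Category.{v} T] [Preadditive T] [HasShift T ℤ]
  [∀ n : ℤ, (shiftFunctor T n).Additive] [RLinear 𝒜 T]

variable (T) in
/-- The objects whose localisation at `q` vanishes. -/
def nullObjects (q : HSpec 𝒜) : ObjectProperty T := fun X =>
  ∀ C : T, IsCompactObject C → ∀ f : C ⟶ X,
    ∃ (a : ℤ) (s : 𝒜 a), (s : R) ∉ q.ideal ∧ f ≫ act s X = 0

lemma nullObjects_of_iso {q : HSpec 𝒜} {X Y : T} (e : X ≅ Y) (h : nullObjects T q X) :
    nullObjects T q Y := by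
  intro C hC f
  obtain ⟨a, s, hs, h0⟩ := h C hC (f ≫ e.inv)
  refine ⟨a, s, hs, ?_⟩
  rw [Category.assoc, ← act_naturality, ← Category.assoc,
    Preadditive.IsIso.comp_right_eq_zero] at h0
  exact h0

lemma nullObjects_shift {q : HSpec 𝒜} {X : T} (h : nullObjects T q X) (n : ℤ) :
    nullObjects T q (X⟦n⟧) := by
  intro C hC f
  obtain ⟨g, rfl⟩ := exists_eq_shift_map f
  obtain ⟨a, s, hs, h0⟩ := h _ (hC.shift (-n)) g
  refine ⟨a, s, hs, ?_⟩
  rw [comp_act_shift_eq_zero_iff, Category.assoc, ← Functor.map_comp, h0, Functor.map_zero,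
    comp_zero]

variable [HasZeroObject T] [Pretriangulated T]

lemma Dist.lift_shift {X Y Z : T} {f : X ⟶ Y} {g : Y ⟶ Z} {h : Z ⟶ X⟦(1 : ℤ)⟧}
    (H : Triangle.mk f g h ∈ distTriang T) (n : ℤ) {W : T} (k : W ⟶ Y⟦n⟧) (hk : k ≫ g⟦n⟧' = 0) :
    ∃ l : W ⟶ X⟦n⟧, k = l ≫ f⟦n⟧' := by
  obtain ⟨k, rfl⟩ := exists_eq_shift_map k
  rw [Category.assoc, ← Functor.map_comp, Preadditive.IsIso.comp_left_eq_zero] at hk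
  obtain ⟨l, rfl⟩ := Dist.lift₂ H k (eq_zero_of_shift_map_eq_zero n hk)
  exact ⟨(shiftNegShift W n).inv ≫ l⟦n⟧', by rw [Functor.map_comp, Category.assoc]⟩

open scoped ZeroObject in
-- For the middle term of a triangle: if `s` kills the image of `f` in the third term, then `f`
-- followed by `s` lifts to the first term, and an element `t` killing the lift makes `ts` kill `f`.
-- For coproducts, compactness of the source leaves finitely many components, and the product of
-- their denominators kills all of them.
lemma isLocalizing_nullObjects (q : HSpec 𝒜) : IsLocalizing (nullObjects T q) := by
  have iso : (nullObjects T q).IsClosedUnderIsomorphisms := ⟨fun e h => nullObjects_of_iso e h⟩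
  refine ⟨?_, iso, ?_⟩
  · exact
    { exists_zero := ⟨0, isZero_zero T, fun C _ f =>
        ⟨0, hone, hone_notMem q, (isZero_zero T).eq_of_tgt f 0 ▸ zero_comp⟩⟩
      isStableUnderShiftBy := fun n => ⟨fun X hX => nullObjects_shift hX n⟩
      toIsTriangulatedClosed₂ := .mk' (by
        intro Δ hΔ h₁ h₃ C hC f
        obtain ⟨a, s, hs, h0⟩ := h₃ C hC (f ≫ Δ.mor₂)
        obtain ⟨l, hl⟩ := Dist.lift_shift hΔ a (f ≫ act s Δ.obj₂) (by
          rw [Category.assoc, act_naturality, ← Category.assoc, h0])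
        obtain ⟨b, t, ht, h1⟩ := nullObjects_shift h₁ a C hC l
        refine ⟨b + a, hmul rfl t s, hmul_notMem q _ ht hs, ?_⟩
        rw [comp_act_shift_eq_zero_iff] at h1
        rw [act_hmul, reassoc_of% hl, ← Functor.map_comp_assoc, ← act_naturality,
          Functor.map_comp_assoc, reassoc_of% h1, zero_comp]) }
  · intro J Y c hc h C hC f
    obtain ⟨S, g, rfl⟩ := hC J Y c hc f
    have key : ∃ (a : ℤ) (s : 𝒜 a), (s : R) ∉ q.ideal ∧ ∀ j ∈ S, g j ≫ act s (Y j) = 0 := by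
      classical
      induction S using Finset.induction_on with
      | empty => exact ⟨0, hone, hone_notMem q, by simp⟩
      | insert j S _ ih =>
        obtain ⟨a, s, hs, h0⟩ := ih
        obtain ⟨b, t, ht, h1⟩ := h j C hC (g j)
        refine ⟨a + b, hmul rfl s t, hmul_notMem q _ hs ht, fun k hk => ?_⟩
        rcases Finset.mem_insert.1 hk with rfl | hk
        · exact comp_act_hmul_right _ _ h1
        · exact comp_act_hmul_left _ _ (h0 k hk)
    obtain ⟨a, s, hs, h0⟩ := key
    refine ⟨a, s, hs, ?_⟩
    rw [Preadditive.sum_comp]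
    refine Finset.sum_eq_zero fun j hj => ?_
    rw [Category.assoc, ← act_naturality, reassoc_of% (h0 j hj), zero_comp]

/-- A cone of the action of a homogeneous element. -/
noncomputable def coneAct {a : ℤ} (s : 𝒜 a) (X : T) : T :=
  (distinguished_cocone_triangle (act s X)).choose

lemma coneAct_spec {a : ℤ} (s : 𝒜 a) (X : T) :
    ∃ (g : X⟦a⟧ ⟶ coneAct s X) (h : coneAct s X ⟶ X⟦(1 : ℤ)⟧),
      Triangle.mk (act s X) g h ∈ distTriang T :=
  (distinguished_cocone_triangle (act s X)).choose_spec

lemma isCompactObject_coneAct {a : ℤ} (s : 𝒜 a) {X : T} (hX : IsCompactObject X) :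
    IsCompactObject (coneAct s X) := by
  obtain ⟨g, h, H⟩ := coneAct_spec s X
  exact (compacts T).ext_of_isTriangulatedClosed₃ _ H hX (hX.shift a)

/-- The square of `s` acts trivially on the cone of `s`. -/
lemma act_hmul_self_coneAct {a : ℤ} (s : 𝒜 a) (X : T) :
    act (hmul rfl s s) (coneAct s X) = 0 := by
  obtain ⟨g, h, H⟩ := coneAct_spec s X
  -- One factor `s` pushes the cone into the image of `g`; the second factor kills that image.
  have h1 : act s (coneAct s X) ≫ h⟦a⟧' = 0 := by
    rw [act_naturality, comp_act_shift_eq_zero_iff]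
    exact Dist.zero₃₁ H
  have hg : act s (X⟦a⟧) ≫ g⟦a⟧' = 0 := by
    rw [act_shift, shiftFunctorComm_eq_refl, Linear.units_smul_comp]
    have := congrArg (fun k => k⟦a⟧') (Dist.zero₁₂ H)
    simp only [Functor.map_comp, Functor.map_zero] at this
    rw [show ((act s X)⟦a⟧' ≫ (Iso.refl (shiftFunctor T a ⋙ shiftFunctor T a)).inv.app X) ≫ g⟦a⟧' =
      (act s X)⟦a⟧' ≫ g⟦a⟧' by simp, this, smul_zero]
  obtain ⟨l, hl⟩ := Dist.lift_shift (rot_of_distTriang _ H) a (act s (coneAct s X)) h1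
  change coneAct s X ⟶ (X⟦a⟧)⟦a⟧ at l
  change act s (coneAct s X) = l ≫ g⟦a⟧' at hl
  rw [act_hmul]
  nth_rw 1 [hl]
  rw [Category.assoc, ← Functor.map_comp_assoc, ← act_naturality, hg, Functor.map_zero, zero_comp,
    comp_zero]

lemma nullObjects_coneAct (q : HSpec 𝒜) {a : ℤ} {s : 𝒜 a} (hs : (s : R) ∉ q.ideal) (X : T) :
    nullObjects T q (coneAct s X) := fun C _ f =>
  ⟨a + a, hmul rfl s s, hmul_notMem q _ hs hs, by rw [act_hmul_self_coneAct, comp_zero]⟩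

/-- If `s` kills `f`, then `f⟦a⟧'` factors through the cone of `s` on `C`. Morphisms out of the cone
thus obstruct injectivity of `s`, and in `exists_comp_act` morphisms out of its desuspension
obstruct surjectivity. -/
lemma eq_zero_of_comp_act {a : ℤ} (s : 𝒜 a) {X C : T}
    (hX : ∀ f : coneAct s C ⟶ X⟦a⟧, f = 0) (f : C ⟶ X) (hf : f ≫ act s X = 0) : f = 0 := by
  obtain ⟨g, h, H⟩ := coneAct_spec s C
  obtain ⟨l, hl⟩ := Dist.desc₂ H (f⟦a⟧') (by rw [act_naturality, hf])
  rw [hX l, comp_zero] at hl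
  exact eq_zero_of_shift_map_eq_zero a hl

lemma exists_comp_act {a : ℤ} (s : 𝒜 a) {X C : T}
    (hX : ∀ f : (coneAct s C)⟦(-1 : ℤ)⟧ ⟶ X⟦a⟧, f = 0) (f : C ⟶ X⟦a⟧) :
    ∃ g : C ⟶ X, f = g ≫ act s X := by
  obtain ⟨g, h, H⟩ := coneAct_spec s C
  obtain ⟨l, hl⟩ := Triangle.yoneda_exact₂ _ (inv_rot_of_distTriang _ H) f (hX _)
  obtain ⟨k, rfl⟩ := (shiftFunctor T a).map_surjective l
  refine ⟨k, hl.trans ?_⟩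
  exact act_naturality s k

end NullObjects

/-! ### Local objects as an orthogonal of compact cones -/

section LocalObjects

variable {R : Type v} [Ring R] {𝒜 : ℤ → AddSubgroup R} [GradedRing 𝒜]
  {T : Type w} [Category.{v} T] [Preadditive T] [HasShift T ℤ]
  [∀ n : ℤ, (shiftFunctor T n).Additive] [RLinear 𝒜 T] [HasZeroObject T] [Pretriangulated T]
  {J : Type v} {G : J → T}

/-- Compact objects detect isomorphisms, so bijectivity of `s` on all graded Hom modules into `X`
amounts to invertibility of one morphism. -/
lemma localObjects_iff (hG : IsGenerating G) (p : HSpec 𝒜) (X : T) :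
    localObjects T p X ↔ ∀ (a : ℤ) (s : 𝒜 a), (s : R) ∉ p.ideal → IsIso (act s X) := by
  constructor
  · intro h a s hs
    have key : ∀ C : T, IsCompactObject C →
        Function.Bijective (fun f : C ⟶ X⟦(0 : ℤ)⟧ => f ≫ (act s X)⟦(0 : ℤ)⟧') := by
      intro C hC
      have h1 : Function.Bijective (fun f : C ⟶ X⟦(0 : ℤ)⟧ =>
          f ≫ (act s X)⟦(0 : ℤ)⟧' ≫ (shiftFunctorAdd' T a 0 a (add_zero a)).inv.app X) :=
        h C hC (add_zero a) s hs
      refine ⟨fun f g hfg => h1.1 ?_, fun g => ?_⟩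
      · simpa only [← Category.assoc] using
          congrArg (· ≫ (shiftFunctorAdd' T a 0 a (add_zero a)).inv.app X) hfg
      · obtain ⟨f, hf⟩ := h1.2 (g ≫ (shiftFunctorAdd' T a 0 a (add_zero a)).inv.app X)
        refine ⟨f, ?_⟩
        simpa only [← Category.assoc, cancel_mono] using hf
    have : IsIso ((act s X)⟦(0 : ℤ)⟧') := hG.isIso _
      (fun j g hg => (key _ (hG.compact j)).1 (hg.trans zero_comp.symm))
      (fun j g => by
        obtain ⟨g', hg'⟩ := (key _ (hG.compact j)).2 g
        exact ⟨g', hg'.symm⟩)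
    exact isIso_of_reflects_iso (act s X) (shiftFunctor T (0 : ℤ))
  · intro h C _
    exact isLocalModule_homMod h

/-- The cones whose right orthogonal consists of the `p`-local objects. -/
noncomputable def localFamily (G : J → T) (p : HSpec 𝒜) :
    (J × (Σ a : ℤ, {s : 𝒜 a // (s : R) ∉ p.ideal}) × ℤ) → T :=
  fun k => (coneAct k.2.1.2.1 (G k.1))⟦k.2.2⟧

lemma shiftStable_localFamily (G : J → T) (p : HSpec 𝒜) : ShiftStable (localFamily G p) :=
  fun k n => ⟨⟨k.1, k.2.1, k.2.2 + n⟩, ⟨(shiftFunctorAdd T k.2.2 n).symm.app _⟩⟩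

lemma isCompactObject_localFamily (hG : IsGenerating G) (p : HSpec 𝒜) (k) :
    IsCompactObject (localFamily G p k) :=
  (isCompactObject_coneAct _ (hG.compact _)).shift _

lemma isIso_act_of_perp (hG : IsGenerating G) {p : HSpec 𝒜} {X : T}
    (hX : perp (localFamily G p) X) {a : ℤ} (s : 𝒜 a) (hs : (s : R) ∉ p.ideal) :
    IsIso (act s X) := by
  have h : ∀ j (n : ℤ) (f : (coneAct s (G j))⟦n⟧ ⟶ X⟦a⟧), f = 0 := fun j n f =>
    perp_shift (shiftStable_localFamily G p) hX a ⟨j, ⟨a, s, hs⟩, n⟩ f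
  refine hG.isIso _ (fun j f hf => eq_zero_of_comp_act s (fun g => ?_) f hf)
    (fun j f => exists_comp_act s (h j (-1)) f)
  rw [← cancel_epi ((shiftFunctorZero T ℤ).hom.app (coneAct s (G j))), comp_zero]
  exact h j 0 _

/-- Orthogonality to the cones makes each `s` outside `p` act bijectively on morphisms from the
generators. Conversely, the square of `s` is zero on the cone and invertible on a local object, so
morphisms between them vanish. This is what makes Bousfield localisation applicable. -/
lemma localObjects_iff_perp (hG : IsGenerating G) (p : HSpec 𝒜) (X : T) :
    localObjects T p X ↔ perp (localFamily G p) X := by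
  rw [localObjects_iff hG]
  refine ⟨fun h => ?_, fun h a s hs => isIso_act_of_perp hG h s hs⟩
  rintro ⟨j, ⟨a, s, hs⟩, n⟩ f
  change (coneAct s (G j))⟦n⟧ ⟶ X at f
  obtain ⟨f', rfl⟩ : ∃ f' : coneAct s (G j) ⟶ X⟦-n⟧,
      f = f'⟦n⟧' ≫ (shiftNegShift X n).hom :=
    ⟨(shiftFunctor T n).preimage (f ≫ (shiftNegShift X n).inv), by
      rw [Functor.map_preimage, Category.assoc, Iso.inv_hom_id, Category.comp_id]⟩
  have := h _ _ (hmul_notMem p rfl hs hs)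
  have : IsIso (act (hmul rfl s s) (X⟦-n⟧)) := (isIso_act_shift_iff _ _ _).2 this
  have : f' = 0 := by
    rw [← cancel_mono (act (hmul rfl s s) (X⟦-n⟧)), ← act_naturality, act_hmul_self_coneAct,
      zero_comp, zero_comp]
  rw [this, Functor.map_zero]
  exact zero_comp

/-- Compactness of the family is what gives closure under coproducts. -/
lemma isLocalizing_perp {K : Type v} {S : K → T} (hS : ShiftStable S)
    (hc : ∀ k, IsCompactObject (S k)) : IsLocalizing (perp S) where
  isTriangulated :=
    { exists_zero := ⟨_, isZero_zero T, fun _ _ => (isZero_zero T).eq_of_tgt _ _⟩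
      isStableUnderShiftBy := fun n => ⟨fun X hX => perp_shift hS hX n⟩
      ext₂' := fun Δ hΔ h₁ h₃ => ObjectProperty.le_isoClosure _ _ fun k f => by
        obtain ⟨g, rfl⟩ := Triangle.coyoneda_exact₂ _ hΔ f (h₃ k _)
        rw [show g = 0 from h₁ k g]
        exact zero_comp }
  of_iso := ⟨fun e h k f => by
    rw [← cancel_mono e.inv, h k (f ≫ e.inv), zero_comp]⟩
  coproducts := fun _ Y c hc' h k f => by
    obtain ⟨s, g, rfl⟩ := hc k _ _ _ hc' f
    exact Finset.sum_eq_zero fun j _ => by rw [h j k (g j), zero_comp]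

lemma isLocalizing_localObjects (hG : IsGenerating G) (p : HSpec 𝒜) :
    IsLocalizing (localObjects T p) := by
  have : localObjects T p = perp (localFamily G p) :=
    funext fun X => propext (localObjects_iff_perp hG p X)
  rw [this]
  exact isLocalizing_perp (shiftStable_localFamily G p) (isCompactObject_localFamily hG p)

lemma IsGenerating.isZero_of_null_of_local (hG : IsGenerating G) {p : HSpec 𝒜} {X : T}
    (h : nullObjects T p X) (h' : localObjects T p X) : IsZero X := by
  refine hG.isZero _ fun j f => ?_
  obtain ⟨a, s, hs, h0⟩ := h _ (hG.compact j) f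
  have := (localObjects_iff hG p X).1 h' a s hs
  rwa [Preadditive.IsIso.comp_right_eq_zero] at h0

variable [HasCoproducts.{v} T]

/-- The localisation triangle `A → X → X_p`. -/
theorem exists_local_triangle (hG : IsGenerating G) (p : HSpec 𝒜) (X : T) :
    ∃ (A B : T) (a : A ⟶ X) (b : X ⟶ B) (δ : B ⟶ A⟦(1 : ℤ)⟧),
      Triangle.mk a b δ ∈ distTriang T ∧ nullObjects T p A ∧ localObjects T p B ∧
      loc (localFamily G p) A := by
  obtain ⟨A, B, a, b, δ, hΔ, hA, hB⟩ := exists_bousfield_triangle (shiftStable_localFamily G p)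
    (isCompactObject_localFamily hG p) X
  refine ⟨A, B, a, b, δ, hΔ, hA _ (isLocalizing_nullObjects p) fun k => ?_,
    (localObjects_iff_perp hG p B).2 hB, hA⟩
  exact nullObjects_shift (nullObjects_coneAct p k.2.1.2.2 _) _

/-- In the localisation triangle of a null `X` the third term is null and local, hence zero; so `X`
is built from cones to which `Y` is orthogonal. -/
lemma eq_zero_of_null_of_local (hG : IsGenerating G) {p : HSpec 𝒜} {X Y : T}
    (hX : nullObjects T p X) (hY : localObjects T p Y) (f : X ⟶ Y) : f = 0 := by
  obtain ⟨A, B, a, b, δ, hΔ, hA, hB, hA'⟩ := exists_local_triangle hG p X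
  have hB' : IsZero B :=
    hG.isZero_of_null_of_local ((isLocalizing_nullObjects p).cone _ hΔ hA hX) hB
  have := Dist.isIso₁ hΔ hB'
  rw [← cancel_epi a, comp_zero]
  exact loc_perp (shiftStable_localFamily G p) hA' ((localObjects_iff_perp hG p Y).1 hY) _

end LocalObjects

/-! ### Homogeneous ideals, radicals and annihilators -/

section GradedIdeals

variable {R : Type v} [Ring R] {𝒜 : ℤ → AddSubgroup R} [GradedRing 𝒜]

/-- Homogeneous left ideals of a graded commutative ring are two-sided. -/
lemma mul_mem_right_of_isHomogeneous (hcomm : IsGradedCommutative 𝒜) {J : Ideal R}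
    (hJ : J.IsHomogeneous 𝒜) {x : R} (hx : x ∈ J) (t : R) : x * t ∈ J := by
  classical
  rw [← DirectSum.sum_support_decompose 𝒜 x, ← DirectSum.sum_support_decompose 𝒜 t,
    Finset.sum_mul_sum]
  refine sum_mem fun i _ => sum_mem fun j _ => ?_
  rw [hcomm i j _ _ (SetLike.coe_mem _) (SetLike.coe_mem _)]
  have h := J.mul_mem_left (DirectSum.decompose 𝒜 t j : R) (hJ i hx)
  rcases Int.units_eq_one_or (i * j).negOnePow with h' | h' <;> rw [h']
  · rwa [one_smul]
  · rw [Units.neg_smul, one_smul]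
    exact neg_mem h

/-- An element contained in all homogeneous primes over `J` is nilpotent modulo `J`. -/
theorem exists_pow_mem_of_forall_prime (hcomm : IsGradedCommutative 𝒜) {J : Ideal R}
    (hJ : J.IsHomogeneous 𝒜) (s : R) (hs : ∀ q : HSpec 𝒜, J ≤ q.ideal → s ∈ q.ideal) :
    ∃ N : ℕ, s ^ N ∈ J := by
  by_contra! hN
  -- A homogeneous ideal over `J`, maximal among those containing no power of `s`, turns out to be
  -- prime.
  obtain ⟨M, hJM, ⟨hM, hsM⟩, hmax⟩ := zorn_le_nonempty₀
    {K : Ideal R | K.IsHomogeneous 𝒜 ∧ ∀ N : ℕ, s ^ N ∉ K} (by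
      intro c hc hchain K hK
      refine ⟨sSup c, ⟨Ideal.IsHomogeneous.sSup fun K hK => (hc hK).1, fun N h => ?_⟩,
        fun K hK => le_sSup hK⟩
      obtain ⟨K', hK', h'⟩ := (Submodule.mem_sSup_of_directed ⟨K, hK⟩ hchain.directedOn).1 h
      exact (hc hK').2 N h') J ⟨hJ, hN⟩
  have key : ∀ (i : ℤ) (x : R), x ∈ 𝒜 i → x ∉ M → ∃ (N : ℕ) (m r : R), m ∈ M ∧
      s ^ N = m + r * x := by
    intro i x hx hxM
    have hspan : (Ideal.span {x}).IsHomogeneous 𝒜 :=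
      Ideal.homogeneous_span 𝒜 _ (by rintro _ rfl; exact ⟨i, hx⟩)
    by_contra! h
    refine hxM (hmax (y := M ⊔ Ideal.span {x}) ⟨hM.sup hspan, fun N hN' => ?_⟩ le_sup_left
      (Ideal.mem_sup_right (Ideal.mem_span_singleton_self x)))
    obtain ⟨m, hm, y, hy, he⟩ := Submodule.mem_sup.1 hN'
    obtain ⟨r, rfl⟩ := Submodule.mem_span_singleton.1 hy
    exact h N m r hm he.symm
  let q : HSpec 𝒜 :=
    { ideal := M
      homogeneous := hM
      ne_top := fun h => hsM 0 (h ▸ Submodule.mem_top)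
      mem_or_mem := by
        intro i j x y hx hy hxy
        by_contra! h
        obtain ⟨N₁, m₁, r, hm₁, h₁⟩ := key i x hx h.1
        obtain ⟨N₂, m₂, t, hm₂, h₂⟩ := key j y hy h.2
        have hspan : (Ideal.span {x}).IsHomogeneous 𝒜 :=
          Ideal.homogeneous_span 𝒜 _ (by rintro _ rfl; exact ⟨i, hx⟩)
        -- Graded commutativity moves `t` past the homogeneous element `x`, at the price of
        -- replacing it by `u`; so `r * x * (t * y)` is a left multiple of `x * y`.
        obtain ⟨u, hu⟩ := Submodule.mem_span_singleton.1
          (mul_mem_right_of_isHomogeneous hcomm hspan (Ideal.mem_span_singleton_self x) t)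
        refine hsM (N₁ + N₂) ?_
        rw [pow_add, h₂, mul_add, h₁, add_mul m₁ (r * x) (t * y)]
        refine add_mem (M.mul_mem_left _ hm₂)
          (add_mem (mul_mem_right_of_isHomogeneous hcomm hM hm₁ _) ?_)
        rw [show r * x * (t * y) = (r * u) * (x * y) by
          rw [mul_assoc, ← mul_assoc x, ← hu, smul_eq_mul]; simp only [mul_assoc]]
        exact M.mul_mem_left _ hxy }
  exact hsM 1 (by rw [pow_one]; exact hs q hJM)

/-- Powers of a homogeneous element. -/
def hpow {a : ℤ} (s : 𝒜 a) (N : ℕ) : 𝒜 (N • a) := ⟨(s : R) ^ N, SetLike.pow_mem_graded N s.2⟩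

/-- A homogeneous prime of a noetherian ring is generated by finitely many homogeneous
elements. -/
lemma exists_homogeneous_generators (hnoeth : IsGradedNoetherian 𝒜) (p : HSpec 𝒜) :
    ∃ l : List (Σ a : ℤ, 𝒜 a), ∀ q : HSpec 𝒜,
      (∀ e ∈ l, (e.2 : R) ∈ q.ideal) ↔ p.ideal ≤ q.ideal := by
  classical
  obtain ⟨S, hS⟩ := hnoeth _ p.homogeneous
  refine ⟨(S.sigma fun x => (DirectSum.decompose 𝒜 x).support).toList.map
    fun k => ⟨k.2, DirectSum.decompose 𝒜 k.1 k.2⟩, fun q => ⟨fun h => ?_, fun h e he => ?_⟩⟩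
  · rw [← hS, Ideal.span_le]
    intro x hx
    rw [SetLike.mem_coe, ← DirectSum.sum_support_decompose 𝒜 x]
    refine sum_mem fun i hi => h ⟨i, DirectSum.decompose 𝒜 x i⟩ ?_
    exact List.mem_map.2 ⟨⟨x, i⟩, Finset.mem_toList.2 (Finset.mem_sigma.2 ⟨hx, hi⟩), rfl⟩
  · obtain ⟨⟨x, i⟩, hk, rfl⟩ := List.mem_map.1 he
    have hx : x ∈ p.ideal := hS ▸ Ideal.subset_span (Finset.mem_sigma.1 (Finset.mem_toList.1 hk)).1
    exact h (p.homogeneous i hx)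

end GradedIdeals

section Annihilator

variable {R : Type v} [Ring R] {𝒜 : ℤ → AddSubgroup R} [GradedRing 𝒜]
variable {C : Type w} [Category.{v} C] [Preadditive C] [HasShift C ℤ]
  [∀ n : ℤ, (shiftFunctor C n).Additive] [RLinear 𝒜 C]

/-- The homogeneous elements annihilating a morphism are those of a homogeneous ideal. -/
lemma exists_annihilator {Z X : C} (f : Z ⟶ X) : ∃ J : Ideal R, J.IsHomogeneous 𝒜 ∧
    ∀ (a : ℤ) (s : 𝒜 a), (s : R) ∈ J ↔ f ≫ act s X = 0 := by
  classical
  let S : Set R := {x | ∃ (a : ℤ) (s : 𝒜 a), (s : R) = x ∧ f ≫ act s X = 0}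
  -- A homogeneous element of the span need not be written with homogeneous coefficients, so the
  -- claim is proved for all components of all elements.
  have key : ∀ x ∈ Ideal.span S, ∀ i, f ≫ act (DirectSum.decompose 𝒜 x i) X = 0 := by
    intro x hx
    induction hx using Submodule.span_induction with
    | mem x h =>
      obtain ⟨a, s, rfl, h⟩ := h
      intro i
      by_cases hi : a = i
      · subst hi
        rw [show DirectSum.decompose 𝒜 (s : R) a = s from
          Subtype.ext (DirectSum.decompose_of_mem_same 𝒜 s.2)]
        exact h
      · rw [show DirectSum.decompose 𝒜 (s : R) i = 0 from
          Subtype.ext (DirectSum.decompose_of_mem_ne 𝒜 s.2 hi), act_zero, comp_zero]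
    | zero =>
      intro i
      rw [DirectSum.decompose_zero, DirectSum.zero_apply, act_zero, comp_zero]
    | add x y _ _ hx hy =>
      intro i
      rw [DirectSum.decompose_add, DirectSum.add_apply, act_add, Preadditive.comp_add, hx, hy,
        add_zero]
    | smul r x _ hx =>
      induction r using DirectSum.Decomposition.inductionOn 𝒜 with
      | zero =>
        intro i
        rw [zero_smul, DirectSum.decompose_zero, DirectSum.zero_apply, act_zero, comp_zero]
      | @homogeneous j r =>
        intro i
        obtain ⟨k, rfl⟩ : ∃ k, i = j + k := ⟨i - j, by ring⟩
        rw [show DirectSum.decompose 𝒜 ((r : R) • x) (j + k) =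
          hmul rfl r (DirectSum.decompose 𝒜 x k) from
          Subtype.ext (DirectSum.coe_decompose_mul_add_of_left_mem 𝒜 r.2)]
        exact comp_act_hmul_right _ _ (hx k)
      | add r r' h h' =>
        intro i
        rw [add_smul, DirectSum.decompose_add, DirectSum.add_apply, act_add,
          Preadditive.comp_add, h, h', add_zero]
  refine ⟨Ideal.span S, Ideal.homogeneous_span 𝒜 _ ?_, fun a s => ⟨fun h => ?_, fun h =>
    Ideal.subset_span ⟨a, s, rfl, h⟩⟩⟩
  · rintro _ ⟨a, s, rfl, -⟩
    exact ⟨a, s.2⟩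
  · have := key _ h a
    rwa [show DirectSum.decompose 𝒜 (s : R) a = s from
      Subtype.ext (DirectSum.decompose_of_mem_same 𝒜 s.2)] at this

/-- By hypothesis every prime over the annihilator of `f` contains `p`, hence contains `s`; so `s`
is nilpotent modulo the annihilator. -/
lemma exists_comp_act_hpow_eq_zero (hcomm : IsGradedCommutative 𝒜) {p : HSpec 𝒜} {Z X : C}
    {f : Z ⟶ X} (hf : ∀ q : HSpec 𝒜, ¬ p.ideal ≤ q.ideal →
      ∃ (a : ℤ) (s : 𝒜 a), (s : R) ∉ q.ideal ∧ f ≫ act s X = 0)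
    {a : ℤ} (s : 𝒜 a) (hs : (s : R) ∈ p.ideal) : ∃ N : ℕ, f ≫ act (hpow s N) X = 0 := by
  obtain ⟨J, hJ, h⟩ := exists_annihilator (𝒜 := 𝒜) f
  obtain ⟨N, hN⟩ := exists_pow_mem_of_forall_prime hcomm hJ (s : R) (fun q hq => by
    by_contra hsq
    obtain ⟨b, t, ht, h0⟩ := hf q (fun hle => hsq (hle hs))
    exact ht (hq ((h b t).2 h0)))
  exact ⟨N, (h _ (hpow s N)).1 hN⟩

end Annihilator

/-! ### Adjoints from universal arrows -/

section Adjoints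

variable {C D : Type*} [Category C] [Category D]

lemma isLeftAdjoint_of_forall {F : C ⥤ D} (h : ∀ Y : D, ∃ (Z : C) (ε : F.obj Z ⟶ Y),
    ∀ (X : C) (f : F.obj X ⟶ Y), ∃! g : X ⟶ Z, F.map g ≫ ε = f) : F.IsLeftAdjoint := by
  choose Z ε hε using h
  let e : ∀ X Y, (F.obj X ⟶ Y) ≃ (X ⟶ Z Y) := fun X Y =>
    (Equiv.ofBijective (fun g : X ⟶ Z Y => F.map g ≫ ε Y)
      ((Function.bijective_iff_existsUnique _).2 (hε Y X))).symm
  exact (Adjunction.adjunctionOfEquivRight e (fun X' X Y f g => by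
    rw [Equiv.symm_apply_eq]
    have h1 : F.map (e X Y g) ≫ ε Y = g := (e X Y).symm_apply_apply g
    change _ = F.map (f ≫ e X Y g) ≫ ε Y
    rw [F.map_comp, Category.assoc, h1])).isLeftAdjoint

lemma isRightAdjoint_of_forall {F : C ⥤ D} (h : ∀ Y : D, ∃ (Z : C) (η : Y ⟶ F.obj Z),
    ∀ (X : C) (f : Y ⟶ F.obj X), ∃! g : Z ⟶ X, η ≫ F.map g = f) : F.IsRightAdjoint := by
  choose Z η hη using h
  let e : ∀ Y X, (Z Y ⟶ X) ≃ (Y ⟶ F.obj X) := fun Y X =>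
    Equiv.ofBijective (fun g : Z Y ⟶ X => η Y ≫ F.map g)
      ((Function.bijective_iff_existsUnique _).2 (hη Y X))
  exact (Adjunction.adjunctionOfEquivLeft e (fun Y X X' g f => by
    change η Y ≫ F.map (f ≫ g) = (η Y ≫ F.map f) ≫ F.map g
    rw [F.map_comp, Category.assoc])).isRightAdjoint

end Adjoints

/-! ### Torsion objects and Koszul generators -/

section Torsion

variable {R : Type v} [Ring R] {𝒜 : ℤ → AddSubgroup R} [GradedRing 𝒜]
  {T : Type w} [Category.{v} T] [Preadditive T] [HasShift T ℤ]
  [∀ n : ℤ, (shiftFunctor T n).Additive] [RLinear 𝒜 T]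

/-- Degree zero suffices because null objects are stable under shifts. Torsion objects thereby form
an intersection of localizing subcategories. -/
lemma torsionObjects_iff (p : HSpec 𝒜) (X : T) :
    torsionObjects T p X ↔ ∀ q : {q : HSpec 𝒜 // ¬ p.ideal ≤ q.ideal}, nullObjects T q.1 X := by
  constructor
  · rintro h ⟨q, hq⟩ C hC f
    obtain ⟨a, s, hs, h0⟩ := h C hC q hq 0 (f ≫ (shiftFunctorZero T ℤ).inv.app X)
    refine ⟨a, s, hs, ?_⟩
    have h1 := (homMod_smul_eq_zero_iff _ s (f ≫ (shiftFunctorZero T ℤ).inv.app X)).1 h0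
    rw [Category.assoc, ← act_naturality, ← Category.assoc,
      Preadditive.IsIso.comp_right_eq_zero] at h1
    exact h1
  · intro h C hC q hq i f
    obtain ⟨a, s, hs, h0⟩ := nullObjects_shift (h ⟨q, hq⟩) i C hC f
    exact ⟨a, s, hs, (homMod_smul_eq_zero_iff _ s f).2 h0⟩

variable [HasZeroObject T] [Pretriangulated T]

open scoped ZeroObject in
lemma IsLocalizing.forall {ι : Type*} {P : ι → ObjectProperty T} (h : ∀ i, IsLocalizing (P i)) :
    IsLocalizing (fun X => ∀ i, P i X) where
  isTriangulated :=
    { exists_zero := ⟨0, isZero_zero T, fun i => by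
        have := (h i).isTriangulated
        have := (h i).of_iso
        exact (P i).prop_of_isZero (isZero_zero T)⟩
      isStableUnderShiftBy := fun n => ⟨fun X hX i => by
        have := (h i).isTriangulated
        exact (P i).le_shift n _ (hX i)⟩
      ext₂' := fun Δ hΔ h₁ h₃ => ObjectProperty.le_isoClosure _ _ fun i => by
        have := (h i).isTriangulated
        have := (h i).of_iso
        exact (P i).ext_of_isTriangulatedClosed₂ _ hΔ (h₁ i) (h₃ i) }
  of_iso := ⟨fun e hX i => by
    have := (h i).of_iso
    exact (P i).prop_of_iso e (hX i)⟩
  coproducts := fun _ Y c hc hY i => (h i).coproducts Y c hc fun j => hY j i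

lemma IsLocalizing.inf {P Q : ObjectProperty T} (hP : IsLocalizing P) (hQ : IsLocalizing Q) :
    IsLocalizing (P ⊓ Q) := by
  have : P ⊓ Q = fun X => ∀ b : Bool, cond b P Q X := by
    ext X
    simp [and_comm]
  rw [this]
  exact IsLocalizing.forall fun b => by cases b <;> assumption

lemma isLocalizing_torsionObjects (p : HSpec 𝒜) : IsLocalizing (torsionObjects T p) := by
  have : torsionObjects T p = fun X => ∀ q : {q : HSpec 𝒜 // ¬ p.ideal ≤ q.ideal},
      nullObjects T q.1 X := funext fun X => propext (torsionObjects_iff p X)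
  rw [this]
  exact IsLocalizing.forall fun q => isLocalizing_nullObjects q.1

/-- The Koszul object on a list of homogeneous elements. -/
noncomputable def koszul (l : List (Σ a : ℤ, 𝒜 a)) (X : T) : T :=
  l.foldr (fun e Y => coneAct e.2 Y) X

lemma isCompactObject_koszul (l : List (Σ a : ℤ, 𝒜 a)) {X : T} (hX : IsCompactObject X) :
    IsCompactObject (koszul l X) := by
  induction l with
  | nil => exact hX
  | cons e l ih => exact isCompactObject_coneAct e.2 ih

/-- A cone on an element outside `q` is null at `q`, and further cones preserve this. If the list
generates `p`, each prime `q` not containing `p` misses one of its members, so the Koszul object is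
`p`-torsion. -/
lemma nullObjects_koszul {q : HSpec 𝒜} {l : List (Σ a : ℤ, 𝒜 a)}
    (h : ∃ e ∈ l, (e.2 : R) ∉ q.ideal) (X : T) : nullObjects T q (koszul l X) := by
  induction l with
  | nil => simp at h
  | cons e l ih =>
    by_cases he : (e.2 : R) ∈ q.ideal
    · obtain ⟨g, k, H⟩ := coneAct_spec e.2 (koszul l X)
      have h1 : nullObjects T q (koszul l X) := ih (by
        obtain ⟨e', he', h'⟩ := h
        rcases List.mem_cons.1 he' with rfl | he'
        · exact (h' he).elim
        · exact ⟨e', he', h'⟩)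
      exact (isLocalizing_nullObjects q).cone _ H h1 (nullObjects_shift h1 _)
    · exact nullObjects_coneAct q he _

/-- All morphisms from `C` to shifts of `X` vanish. -/
def NoMaps (C X : T) : Prop := ∀ (n : ℤ) (f : C ⟶ X⟦n⟧), f = 0

omit [HasZeroObject T] [Pretriangulated T] in
lemma NoMaps.shift {C X : T} (h : NoMaps C X) (m : ℤ) : NoMaps C (X⟦m⟧) := fun n f => by
  rw [← cancel_mono ((shiftFunctorAdd T m n).inv.app X), zero_comp]
  exact h _ _

omit [HasZeroObject T] [Pretriangulated T] in
lemma NoMaps.eq_zero {C X : T} (h : NoMaps C X) (f : C ⟶ X) : f = 0 := by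
  rw [← cancel_mono ((shiftFunctorZero T ℤ).inv.app X), zero_comp]
  exact h _ _

omit [RLinear 𝒜 T] in
omit [HasZeroObject T] [Pretriangulated T] in
lemma noMaps_iff {C X : T} : NoMaps C X ↔ ∀ (n : ℤ) (f : C⟦n⟧ ⟶ X), f = 0 := by
  refine ⟨fun h n f => ?_, fun h n f => ?_⟩
  · obtain ⟨f', hf'⟩ : ∃ f' : C ⟶ X⟦-n⟧, f = f'⟦n⟧' ≫ (shiftNegShift X n).hom :=
      ⟨(shiftFunctor T n).preimage (f ≫ (shiftNegShift X n).inv), by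
        rw [Functor.map_preimage, Category.assoc, Iso.inv_hom_id, Category.comp_id]⟩
    rw [hf', h _ f', Functor.map_zero, zero_comp]
  · obtain ⟨f, rfl⟩ := exists_eq_shift_map f
    rw [h _ f, Functor.map_zero, comp_zero]

/-- A morphism from the compact `C` to a shift of `B` is killed by a power of `s`, whereas the
absence of morphisms from the cone makes `s` act injectively; the exponent is lowered step by step.
-/
lemma noMaps_of_coneAct (hcomm : IsGradedCommutative 𝒜) {p : HSpec 𝒜} {B C : T}
    (hB : torsionObjects T p B) (hC : IsCompactObject C) {a : ℤ} (s : 𝒜 a)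
    (hs : (s : R) ∈ p.ideal) (h : NoMaps (coneAct s C) B) : NoMaps C B := by
  have key : ∀ (N : ℕ) (X : T), NoMaps (coneAct s C) X → ∀ f : C ⟶ X,
      f ≫ act (hpow s N) X = 0 → f = 0 := by
    intro N
    induction N with
    | zero =>
      intro X _ f hf
      have : IsIso (act (hpow s 0) X) := by
        have e : ∀ {b : ℤ} (hb : b = 0) (t : 𝒜 b), (t : R) = 1 → IsIso (act t X) := by
          rintro b rfl t ht
          rw [show t = hone from Subtype.ext ht]
          infer_instance
        exact e (zero_smul ℕ a) _ (pow_zero _)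
      rwa [Preadditive.IsIso.comp_right_eq_zero] at hf
    | succ N ih =>
      intro X hX f hf
      refine eq_zero_of_comp_act s (hX a) f (ih _ (hX.shift a) _ ?_)
      rw [show hpow s (N + 1) = hmul (succ_nsmul a N).symm (hpow s N) s from
        Subtype.ext (pow_succ _ _), act_hmul] at hf
      rw [comp_act_shift_eq_zero_iff]
      simpa only [← Category.assoc, Preadditive.IsIso.comp_right_eq_zero] using hf
  intro n f
  have hBn : ∀ q : HSpec 𝒜, ¬ p.ideal ≤ q.ideal → nullObjects T q (B⟦n⟧) :=
    fun q hq => nullObjects_shift ((torsionObjects_iff p B).1 hB ⟨q, hq⟩) n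
  obtain ⟨N, hN⟩ := exists_comp_act_hpow_eq_zero hcomm (fun q hq => hBn q hq C hC f) s hs
  exact key N _ (h.shift n) f hN

lemma noMaps_of_koszul (hcomm : IsGradedCommutative 𝒜) {p : HSpec 𝒜} {B C : T}
    (hB : torsionObjects T p B) (hC : IsCompactObject C) (l : List (Σ a : ℤ, 𝒜 a))
    (hl : ∀ e ∈ l, (e.2 : R) ∈ p.ideal) (h : NoMaps (koszul l C) B) : NoMaps C B := by
  induction l with
  | nil => exact h
  | cons e l ih =>
    exact ih (fun e' he' => hl e' (List.mem_cons_of_mem _ he'))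
      (noMaps_of_coneAct hcomm hB (isCompactObject_koszul l hC) e.2 (hl e List.mem_cons_self) h)

/-- Generators of the `p`-torsion objects. -/
noncomputable def torsionFamily {J : Type v} (G : J → T) (l : List (Σ a : ℤ, 𝒜 a)) : J × ℤ → T :=
  fun k => (koszul l (G k.1))⟦k.2⟧

lemma shiftStable_torsionFamily {J : Type v} (G : J → T) (l : List (Σ a : ℤ, 𝒜 a)) :
    ShiftStable (torsionFamily G l) :=
  fun k n => ⟨⟨k.1, k.2 + n⟩, ⟨(shiftFunctorAdd T k.2 n).symm.app _⟩⟩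

variable {J : Type v} {G : J → T} [HasCoproducts.{v} T]

/-- The `p`-torsion objects form a localizing subcategory generated by compact objects. -/
theorem exists_torsion_generators (hcomm : IsGradedCommutative 𝒜) (hnoeth : IsGradedNoetherian 𝒜)
    (hG : IsGenerating G) (p : HSpec 𝒜) :
    ∃ (K : Type v) (S : K → T), ShiftStable S ∧ (∀ k, IsCompactObject (S k)) ∧
      (∀ k, torsionObjects T p (S k)) ∧ ∀ Y, torsionObjects T p Y → loc S Y := by
  obtain ⟨l, hl⟩ := exists_homogeneous_generators hnoeth p
  have hS := shiftStable_torsionFamily G l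
  have hc : ∀ k, IsCompactObject (torsionFamily G l k) := fun k =>
    (isCompactObject_koszul l (hG.compact _)).shift _
  have htors : ∀ k, torsionObjects T p (torsionFamily G l k) := fun k =>
    (torsionObjects_iff p _).2 fun q => nullObjects_shift (nullObjects_koszul (by
      by_contra! h
      exact q.2 ((hl q.1).1 h)) _) _
  refine ⟨_, _, hS, hc, htors, fun Y hY => ?_⟩
  obtain ⟨A, B, a, b, δ, hΔ, hA, hB⟩ := exists_bousfield_triangle hS hc Y
  have hB' : torsionObjects T p B := (isLocalizing_torsionObjects p).cone _ hΔ
    (hA _ (isLocalizing_torsionObjects p) htors) hY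
  -- `B` is torsion and receives nothing from the Koszul objects, hence nothing from the generators.
  have : IsZero B := hG.isZero _ fun j => (noMaps_of_koszul hcomm hB' (hG.compact j) l
    ((hl p).2 le_rfl) (noMaps_iff.2 fun n f => hB ⟨j, n⟩ f)).eq_zero
  have := Dist.isIso₁ hΔ this
  have := (isLocalizing_loc (torsionFamily G l)).of_iso
  exact (loc (torsionFamily G l)).prop_of_iso (asIso a) hA

/-- The triangle `Γ X → X → L X` for the subcategory of `p`-torsion objects. -/
theorem exists_torsion_triangle (hcomm : IsGradedCommutative 𝒜) (hnoeth : IsGradedNoetherian 𝒜)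
    (hG : IsGenerating G) (p : HSpec 𝒜) (X : T) :
    ∃ (A B : T) (a : A ⟶ X) (b : X ⟶ B) (δ : B ⟶ A⟦(1 : ℤ)⟧),
      Triangle.mk a b δ ∈ distTriang T ∧ torsionObjects T p A ∧
      ∀ Y : T, torsionObjects T p Y → NoMaps Y B := by
  obtain ⟨K, S, hS, hc, htors, hge⟩ := exists_torsion_generators hcomm hnoeth hG p
  obtain ⟨A, B, a, b, δ, hΔ, hA, hB⟩ := exists_bousfield_triangle hS hc X
  exact ⟨A, B, a, b, δ, hΔ, hA _ (isLocalizing_torsionObjects p) htors,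
    fun Y hY n f => loc_perp hS (hge Y hY) (perp_shift hS hB n) f⟩

/-- The coreflection of a `p`-local object in the `p`-local and `p`-torsion objects. -/
theorem exists_gamma_coreflection (hcomm : IsGradedCommutative 𝒜) (hnoeth : IsGradedNoetherian 𝒜)
    (hG : IsGenerating G) (p : HSpec 𝒜) (X : T) (hX : localObjects T p X) :
    ∃ (A : T) (ε : A ⟶ X), gammaObjects T p A ∧ ∀ Y : T, torsionObjects T p Y → ∀ f : Y ⟶ X,
      ∃! g : Y ⟶ A, g ≫ ε = f := by
  obtain ⟨A, B, ε, b, δ, hΔ, hA, hB⟩ := exists_torsion_triangle hcomm hnoeth hG p X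
  have lift : ∀ Y : T, torsionObjects T p Y → ∀ f : Y ⟶ X, ∃ g : Y ⟶ A, g ≫ ε = f := by
    intro Y hY f
    obtain ⟨g, hg⟩ := Dist.lift₂ hΔ f ((hB Y hY).eq_zero _)
    exact ⟨g, hg.symm⟩
  have zero : ∀ Y : T, torsionObjects T p Y → ∀ g : Y ⟶ A, g ≫ ε = 0 → g = 0 := by
    intro Y hY g hg
    obtain ⟨k, hk⟩ := Triangle.coyoneda_exact₂ _ (inv_rot_of_distTriang _ hΔ) g hg
    have : k = 0 := hB Y hY (-1) k
    rw [hk, this]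
    exact zero_comp
  have uniq : ∀ Y : T, torsionObjects T p Y → ∀ g g' : Y ⟶ A, g ≫ ε = g' ≫ ε → g = g' :=
    fun Y hY g g' h => sub_eq_zero.1 (zero Y hY _ (by rw [Preadditive.sub_comp, h, sub_self]))
  have uniq' : ∀ Y : T, torsionObjects T p Y → ∀ (n : ℤ) (g g' : Y ⟶ A⟦n⟧),
      g ≫ ε⟦n⟧' = g' ≫ ε⟦n⟧' → g = g' := by
    intro Y hY n g g' h
    obtain ⟨k, rfl⟩ := exists_eq_shift_map g
    obtain ⟨k', rfl⟩ := exists_eq_shift_map g'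
    rw [Category.assoc, Category.assoc, cancel_epi, ← Functor.map_comp, ← Functor.map_comp] at h
    have := (isLocalizing_torsionObjects (T := T) p).isTriangulated
    rw [uniq _ ((torsionObjects T p).le_shift (-n) _ hY) _ _ ((shiftFunctor T n).map_injective h)]
  refine ⟨A, ε, ⟨(localObjects_iff hG p A).2 fun n s hs => ?_, hA⟩, fun Y hY f => ?_⟩
  -- Locality passes from `X` to `A`: since `A⟦n⟧` is torsion, `ε⟦n⟧' ≫ inv (act s X)` lifts through
  -- `ε`, and the lift is inverse to `s` on `A`.
  · have := (localObjects_iff hG p X).1 hX n s hs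
    have := (isLocalizing_torsionObjects (T := T) p).isTriangulated
    have hAn := (torsionObjects T p).le_shift n _ hA
    obtain ⟨l, hl⟩ := lift _ hAn (ε⟦n⟧' ≫ inv (act s X))
    refine ⟨l, uniq _ hA _ _ ?_, uniq' _ hAn n _ _ ?_⟩
    · rw [Category.assoc, hl, act_naturality_assoc, IsIso.hom_inv_id, Category.comp_id,
        Category.id_comp]
    · rw [Category.assoc, act_naturality, ← Category.assoc, hl, Category.assoc, IsIso.inv_hom_id,
        Category.comp_id, Category.id_comp]
  · obtain ⟨g, hg⟩ := lift Y hY f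
    exact ⟨g, hg, fun g' hg' => uniq Y hY _ _ (hg'.trans hg.symm)⟩

/-- Together with `isRightAdjoint_local`, this selects the first branch in the definition of
`localCohomology`. -/
theorem isLeftAdjoint_gamma (hcomm : IsGradedCommutative 𝒜) (hnoeth : IsGradedNoetherian 𝒜)
    (hG : IsGenerating G) (p : HSpec 𝒜) :
    (ObjectProperty.ιOfLE (gammaObjects_le T p)).IsLeftAdjoint := by
  refine isLeftAdjoint_of_forall fun X => ?_
  obtain ⟨A, ε, hA, h⟩ := exists_gamma_coreflection hcomm hnoeth hG p X.obj X.property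
  refine ⟨⟨A, hA⟩, ObjectProperty.homMk ε, fun Y f => ?_⟩
  obtain ⟨g, hg, hu⟩ := h Y.obj Y.property.2 f.hom
  refine ⟨ObjectProperty.homMk g, ?_, fun g' hg' => ?_⟩
  · ext
    exact hg
  · ext
    exact hu _ (congrArg (fun k => k.hom) hg')

/-- The localisation triangle supplies the universal arrow: neither its null term nor the shift of
that term maps nontrivially to a local object. -/
theorem isRightAdjoint_local (hG : IsGenerating G) (p : HSpec 𝒜) :
    (localObjects T p).ι.IsRightAdjoint := by
  refine isRightAdjoint_of_forall fun X => ?_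
  obtain ⟨A, B, a, b, δ, hΔ, hA, hB, -⟩ := exists_local_triangle hG p X
  refine ⟨⟨B, hB⟩, b, fun Y f => ?_⟩
  obtain ⟨g, hg⟩ := Dist.desc₂ hΔ f (eq_zero_of_null_of_local hG hA Y.property _)
  change B ⟶ Y.obj at g
  refine ⟨ObjectProperty.homMk g, hg.symm, fun g' hg' => ?_⟩
  ext
  refine sub_eq_zero.1 ?_
  obtain ⟨k, hk⟩ := Dist.desc₃ hΔ (g'.hom - g) (by
    rw [Preadditive.comp_sub, sub_eq_zero]
    exact hg'.trans hg)
  have : k = 0 := eq_zero_of_null_of_local hG (nullObjects_shift hA 1) Y.property k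
  exact hk.trans (by rw [this, comp_zero])

end Torsion

/-! ### The localisation functor -/

section LocalisationFunctor

variable {R : Type v} [Ring R] {𝒜 : ℤ → AddSubgroup R} [GradedRing 𝒜]
  {T : Type w} [Category.{v} T] [Preadditive T] [HasShift T ℤ]
  [∀ n : ℤ, (shiftFunctor T n).Additive] [RLinear 𝒜 T] [HasZeroObject T] [Pretriangulated T]

/-- `η : 𝟭 ⟶ Λ` exhibits the exact functor `Λ` as the localisation at `p`. -/
structure IsLocalisationAt (p : HSpec 𝒜) (Λ : T ⥤ T) [Λ.CommShift ℤ] (η : 𝟭 T ⟶ Λ) : Prop where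
  commShift : NatTrans.CommShift η ℤ
  isTriangulated : Λ.IsTriangulated
  isLocal : ∀ X, localObjects T p (Λ.obj X)
  exists_fiber : ∀ X, ∃ (A : T) (a : A ⟶ X) (δ : Λ.obj X ⟶ A⟦(1 : ℤ)⟧),
    Triangle.mk a (η.app X) δ ∈ distTriang T ∧ nullObjects T p A
  isLocalization [IsTriangulated T] :
    ((localObjects T p).lift Λ isLocal).IsLocalization (nullObjects T p).trW

omit [RLinear 𝒜 T] in
lemma Dist.of_iso {X Y Z X' Y' Z' : T} {f : X ⟶ Y} {g : Y ⟶ Z} {h : Z ⟶ X⟦(1 : ℤ)⟧}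
    {f' : X' ⟶ Y'} {g' : Y' ⟶ Z'} {h' : Z' ⟶ X'⟦(1 : ℤ)⟧}
    (H : Triangle.mk f g h ∈ distTriang T) (e₁ : X ≅ X') (e₂ : Y ≅ Y') (e₃ : Z ≅ Z')
    (hf : f ≫ e₂.hom = e₁.hom ≫ f') (hg : g ≫ e₃.hom = e₂.hom ≫ g')
    (hh : h ≫ e₁.hom⟦(1 : ℤ)⟧' = e₃.hom ≫ h') : Triangle.mk f' g' h' ∈ distTriang T :=
  isomorphic_distinguished _ H _ (Triangle.isoMk (Triangle.mk f g h) (Triangle.mk f' g' h')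
    e₁ e₂ e₃ hf hg hh).symm

variable {J : Type v} {G : J → T} [HasCoproducts.{v} T]

/-- A universal arrow to local objects is isomorphic to the one in the localisation triangle, and
inherits its fibre. -/
lemma exists_fiber_of_universal (hG : IsGenerating G) (p : HSpec 𝒜) {X L : T} (η : X ⟶ L)
    (hL : localObjects T p L)
    (h : ∀ (Y : T), localObjects T p Y → ∀ f : X ⟶ Y, ∃! g : L ⟶ Y, η ≫ g = f) :
    ∃ (A : T) (a : A ⟶ X) (δ : L ⟶ A⟦(1 : ℤ)⟧), Triangle.mk a η δ ∈ distTriang T ∧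
      nullObjects T p A := by
  obtain ⟨A, B, a, b, δ, hΔ, hA, hB, -⟩ := exists_local_triangle hG p X
  obtain ⟨u, hu, -⟩ := h B hB b
  obtain ⟨u', hu'⟩ := Dist.desc₂ hΔ η (eq_zero_of_null_of_local hG hA hL _)
  have h1 : u ≫ u' = 𝟙 L := (h L hL η).unique
    (by rw [← Category.assoc, hu, hu']) (Category.comp_id _)
  have h2 : u' ≫ u = 𝟙 B := by
    refine sub_eq_zero.1 ?_
    obtain ⟨k, hk⟩ := Dist.desc₃ hΔ (u' ≫ u - 𝟙 B) (by
      rw [Preadditive.comp_sub, ← Category.assoc, ← hu', hu, Category.comp_id, sub_self])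
    have : k = 0 := eq_zero_of_null_of_local hG (nullObjects_shift hA 1) hB k
    exact hk.trans (by rw [this, comp_zero])
  refine ⟨A, a, u ≫ δ, Dist.of_iso hΔ (Iso.refl _) (Iso.refl _) ⟨u', u, h2, h1⟩ (by simp)
    (by simp [hu']) ?_, hA⟩
  simp [reassoc_of% h2]

/-- The left adjoint of the exact inclusion of local objects is exact. It kills null objects and its
unit has null fibres, so it is the Verdier quotient by the null objects. -/
theorem exists_isLocalisationAt (hG : IsGenerating G) (p : HSpec 𝒜) :
    ∃ (_ : (localisation T p).CommShift ℤ) (η : 𝟭 T ⟶ localisation T p),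
      IsLocalisationAt p (localisation T p) η := by
  have hadj := isRightAdjoint_local hG p
  have := (isLocalizing_localObjects hG p).isTriangulated
  have e : localisation T p = (localObjects T p).ι.leftAdjoint ⋙ (localObjects T p).ι :=
    dif_pos hadj
  rw [e]
  let adj := Adjunction.ofIsRightAdjoint (localObjects T p).ι
  let := adj.leftAdjointCommShift ℤ
  have : adj.CommShift ℤ := adj.commShift_of_rightAdjoint ℤ
  have : (localObjects T p).ι.leftAdjoint.IsTriangulated := adj.isTriangulated_leftAdjoint
  have hfib : ∀ X, ∃ (A : T) (a : A ⟶ X) (δ : _ ⟶ A⟦(1 : ℤ)⟧),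
      Triangle.mk a (adj.unit.app X) δ ∈ distTriang T ∧ nullObjects T p A := by
    intro X
    refine exists_fiber_of_universal hG p _ (ObjectProperty.FullSubcategory.property _) ?_
    intro Y hY f
    obtain ⟨g, hg⟩ := (adj.homEquiv X ⟨Y, hY⟩).surjective f
    rw [Adjunction.homEquiv_unit] at hg
    refine ⟨g.hom, hg, fun g' hg' => ?_⟩
    have : ObjectProperty.homMk g' = g := by
      apply (adj.homEquiv X ⟨Y, hY⟩).injective
      rw [Adjunction.homEquiv_unit, Adjunction.homEquiv_unit]
      exact hg'.trans hg.symm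
    exact congrArg (fun k => k.hom) this
  refine ⟨inferInstance, adj.unit, inferInstance, inferInstance,
    fun X => ObjectProperty.FullSubcategory.property _, hfib, ?_⟩
  intro _
  have := (isLocalizing_nullObjects (T := T) p).isTriangulated
  have := (isLocalizing_nullObjects (T := T) p).of_iso
  have hloc : (localObjects T p).ι.leftAdjoint.IsLocalization (nullObjects T p).trW := by
    refine adj.isLocalization_leftAdjoint _ ?_ ?_
    · intro X Y f hf
      obtain ⟨Z, g, h, H, hZ⟩ := (ObjectProperty.trW_iff _ _).1 hf
      refine (Triangle.isZero₃_iff_isIso₁ _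
        ((localObjects T p).ι.leftAdjoint.map_distinguished _ H)).1 ?_
      refine (Limits.IsZero.iff_id_eq_zero _).2 ((adj.homEquiv _ _).injective ?_)
      have h0 : ∀ k : Z ⟶ (localObjects T p).ι.obj ((localObjects T p).ι.leftAdjoint.obj Z),
        k = 0 := eq_zero_of_null_of_local hG hZ (ObjectProperty.FullSubcategory.property _)
      exact (h0 _).trans (h0 _).symm
    · intro X
      obtain ⟨A, a, δ, H, hA⟩ := hfib X
      exact (ObjectProperty.trW_iff' _ _).2 ⟨_, _, _, H, hA⟩
  exact Functor.IsLocalization.of_iso (L₁ := (localObjects T p).ι.leftAdjoint) _ (Iso.refl _)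

end LocalisationFunctor

/-! ### Fractions: morphisms into and between localised objects -/

section LocalisationProperties

variable {R : Type v} [Ring R] {𝒜 : ℤ → AddSubgroup R} [GradedRing 𝒜]
  {T : Type w} [Category.{v} T] [Preadditive T] [HasShift T ℤ]
  [∀ n : ℤ, (shiftFunctor T n).Additive] [RLinear 𝒜 T] [HasZeroObject T] [Pretriangulated T]
  [HasCoproducts.{v} T] {J : Type v} {G : J → T}
  {p : HSpec 𝒜} {Λ : T ⥤ T} [Λ.CommShift ℤ] {η : 𝟭 T ⟶ Λ}

namespace IsLocalisationAt

lemma hom_ext (h : IsLocalisationAt p Λ η) (hG : IsGenerating G) {X Y : T}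
    (hY : localObjects T p Y) {f g : Λ.obj X ⟶ Y} (hfg : η.app X ≫ f = η.app X ≫ g) : f = g := by
  obtain ⟨A, a, δ, H, hA⟩ := h.exists_fiber X
  refine sub_eq_zero.1 ?_
  obtain ⟨k, hk⟩ := Dist.desc₃ H (f - g) (by rw [Preadditive.comp_sub, hfg, sub_self])
  have : k = 0 := eq_zero_of_null_of_local hG (nullObjects_shift hA 1) hY k
  rw [hk, this, comp_zero]

lemma exists_desc (h : IsLocalisationAt p Λ η) (hG : IsGenerating G) {X Y : T}
    (hY : localObjects T p Y) (f : X ⟶ Y) : ∃ g : Λ.obj X ⟶ Y, f = η.app X ≫ g := by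
  obtain ⟨A, a, δ, H, hA⟩ := h.exists_fiber X
  exact Dist.desc₂ H f (eq_zero_of_null_of_local hG hA hY _)

lemma isIso_app (h : IsLocalisationAt p Λ η) (hG : IsGenerating G) {Y : T}
    (hY : localObjects T p Y) : IsIso (η.app Y) := by
  obtain ⟨g, hg⟩ := h.exists_desc hG hY (𝟙 Y)
  refine ⟨g, hg.symm, h.hom_ext hG (h.isLocal Y) ?_⟩
  have : η.app Y ≫ g ≫ η.app Y = η.app Y := by rw [← Category.assoc, ← hg]; exact Category.id_comp _
  exact this.trans (Category.comp_id _).symm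

lemma app_shift_comp (h : IsLocalisationAt p Λ η) (X : T) (n : ℤ) :
    η.app (X⟦n⟧) ≫ (Λ.commShiftIso n).hom.app X = (η.app X)⟦n⟧' := by
  have := h.commShift
  have h1 := NatTrans.shift_app_comm η n X
  simpa using h1.symm

/-- Both sides agree after composition with `η`, by naturality, and this determines a morphism into
a local object. -/
lemma map_act (h : IsLocalisationAt p Λ η) (hG : IsGenerating G) {a : ℤ} (s : 𝒜 a) (X : T) :
    Λ.map (act s X) ≫ (Λ.commShiftIso a).hom.app X = act s (Λ.obj X) := by
  have hloc := (isLocalizing_localObjects hG p).isTriangulated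
  refine h.hom_ext hG ((localObjects T p).le_shift a _ (h.isLocal X)) ?_
  rw [← act_naturality, ← h.app_shift_comp, ← Category.assoc, ← η.naturality, Category.assoc]
  rfl

/-- With `exists_comp_act_eq`, this describes morphisms from a compact object to `Λ.obj Y` as
fractions: the fibre of `η` is null, so what it obstructs is killed by an element outside `p`. -/
lemma exists_act_eq_zero (h : IsLocalisationAt p Λ η) {C Y : T} (hC : IsCompactObject C)
    (g : C ⟶ Y) (hg : g ≫ η.app Y = 0) :
    ∃ (a : ℤ) (s : 𝒜 a), (s : R) ∉ p.ideal ∧ g ≫ act s Y = 0 := by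
  obtain ⟨A, a, δ, H, hA⟩ := h.exists_fiber Y
  obtain ⟨k, rfl⟩ := Dist.lift₂ H g hg
  obtain ⟨n, s, hs, h0⟩ := hA C hC k
  exact ⟨n, s, hs, by rw [Category.assoc, ← act_naturality, reassoc_of% h0, zero_comp]⟩

lemma exists_comp_act_eq (h : IsLocalisationAt p Λ η) {C Y : T} (hC : IsCompactObject C)
    (f : C ⟶ Λ.obj Y) : ∃ (a : ℤ) (s : 𝒜 a) (g : C ⟶ Y⟦a⟧), (s : R) ∉ p.ideal ∧
      f ≫ act s (Λ.obj Y) = g ≫ (η.app Y)⟦a⟧' := by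
  obtain ⟨A, a, δ, H, hA⟩ := h.exists_fiber Y
  obtain ⟨n, s, hs, h0⟩ := nullObjects_shift hA 1 C hC (f ≫ δ)
  obtain ⟨g, hg⟩ := Dist.lift_shift (f := η.app Y) (g := δ) (rot_of_distTriang _ H) n
    (f ≫ act s (Λ.obj Y)) (by
    rw [Category.assoc, act_naturality, ← Category.assoc, h0])
  exact ⟨n, s, g, hs, hg⟩

/-- Morphisms between localised objects are fractions. -/
lemma exists_comp_map_act_eq (h : IsLocalisationAt p Λ η) (hG : IsGenerating G) {C Y : T}
    (hC : IsCompactObject C) (f : Λ.obj C ⟶ Λ.obj Y) :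
    ∃ (a : ℤ) (s : 𝒜 a) (g : C ⟶ Y⟦a⟧), (s : R) ∉ p.ideal ∧
      f ≫ Λ.map (act s Y) = Λ.map g := by
  obtain ⟨a, s, g, hs, hg⟩ := h.exists_comp_act_eq hC (η.app C ≫ f)
  refine ⟨a, s, g, hs, ?_⟩
  have hloc := (isLocalizing_localObjects hG p).isTriangulated
  rw [← cancel_mono ((Λ.commShiftIso a).hom.app Y), Category.assoc, h.map_act hG]
  refine h.hom_ext hG ((localObjects T p).le_shift a _ (h.isLocal Y)) ?_
  rw [← Category.assoc, hg, ← h.app_shift_comp, ← Category.assoc, ← Category.assoc, ← η.naturality]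
  rfl

lemma isIso_map_act (h : IsLocalisationAt p Λ η) (hG : IsGenerating G) {a : ℤ} {s : 𝒜 a}
    (hs : (s : R) ∉ p.ideal) (Y : T) : IsIso (Λ.map (act s Y)) := by
  have := (localObjects_iff hG p _).1 (h.isLocal Y) a s hs
  rw [← h.map_act hG] at this
  exact (isIso_comp_right_iff _ ((Λ.commShiftIso a).hom.app Y)).1 this

/-- Localisation preserves coproducts. -/
lemma exists_section_coproduct (h : IsLocalisationAt p Λ η) (hG : IsGenerating G) {K : Type v}
    (Y : K → T) {c : Cofan Y} (hc : IsColimit c) :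
    ∃ ψ : Λ.obj c.pt ⟶ ∐ fun k => Λ.obj (Y k),
      ψ ≫ Limits.Sigma.desc (fun k => Λ.map (c.inj k)) = 𝟙 _ := by
  have hZ : localObjects T p (∐ fun k => Λ.obj (Y k)) :=
    (isLocalizing_localObjects hG p).coproducts _ _ (coproductIsCoproduct _) fun k => h.isLocal _
  obtain ⟨ψ, hψ⟩ := h.exists_desc hG hZ
    (Cofan.IsColimit.desc hc fun k => η.app (Y k) ≫ Sigma.ι (fun k => Λ.obj (Y k)) k)
  refine ⟨ψ, h.hom_ext hG (h.isLocal _) (Cofan.IsColimit.hom_ext hc _ _ fun k => ?_)⟩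
  rw [← Category.assoc (η.app c.pt), ← hψ, Category.comp_id, ← Category.assoc,
    Cofan.IsColimit.fac, Category.assoc, Sigma.ι_desc]
  exact (η.naturality (c.inj k)).symm

end IsLocalisationAt

end LocalisationProperties

/-! ### Compactness relative to a localizing subcategory -/

section RelativeCompactness

variable {T : Type w} [Category.{v} T] [Preadditive T] [HasShift T ℤ]
  [∀ n : ℤ, (shiftFunctor T n).Additive] [HasZeroObject T] [Pretriangulated T]
  [HasCoproducts.{v} T] {P : ObjectProperty T}

/-- Coproducts in a localizing subcategory are computed in the ambient category. -/
noncomputable def isColimitFullSubcategory {K : Type*} {Y : K → P.FullSubcategory}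
    {c : Cofan (fun k => (Y k).obj)} (hc : IsColimit c) (h : P c.pt) :
    IsColimit (Cofan.mk (f := Y) ⟨c.pt, h⟩ fun k => ObjectProperty.homMk (c.inj k)) :=
  isColimitOfReflects P.ι ((isColimitMapCoconeCofanMkEquiv P.ι Y _).symm
    (hc.ofIsoColimit (Cocone.ext (Iso.refl _))))

lemma compactIn_iff (hP : IsLocalizing P) (X : T) :
    compactIn P X ↔ P X ∧ ∀ (K : Type v) (Y : K → T), (∀ k, P (Y k)) →
      ∀ (c : Cofan Y) (_ : IsColimit c) (f : X ⟶ c.pt),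
        ∃ (S : Finset K) (g : ∀ k, X ⟶ Y k), f = ∑ k ∈ S, g k ≫ c.inj k := by
  constructor
  · rintro ⟨hX, h⟩
    refine ⟨hX, fun K Y hY c hc f => ?_⟩
    obtain ⟨S, g, hg⟩ := h K (fun k => ⟨Y k, hY k⟩) _
      (isColimitFullSubcategory (Y := fun k => (⟨Y k, hY k⟩ : P.FullSubcategory)) hc
        (hP.coproducts Y c hc hY)) (ObjectProperty.homMk f)
    refine ⟨S, fun k => (g k).hom, ?_⟩
    refine (congrArg (fun k => P.ι.map k) hg).trans ?_
    rw [Functor.map_sum]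
    rfl
  · rintro ⟨hX, h⟩
    refine ⟨hX, fun K Y c hc f => ?_⟩
    let Y' : K → T := fun k => (Y k).obj
    have hZ : P (∐ Y') := hP.coproducts Y' _ (coproductIsCoproduct Y') fun k => (Y k).property
    let c' := Cofan.mk (f := Y) ⟨∐ Y', hZ⟩ fun k => ObjectProperty.homMk (Sigma.ι Y' k)
    have hc' : IsColimit c' := isColimitFullSubcategory (coproductIsCoproduct Y') hZ
    let e := hc.coconePointUniqueUpToIso hc'
    obtain ⟨S, g, hg⟩ := h K Y' (fun k => (Y k).property) _ (coproductIsCoproduct Y')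
      (f ≫ e.hom).hom
    refine ⟨S, fun k => ObjectProperty.homMk (g k), ?_⟩
    rw [← cancel_mono e.hom]
    apply P.ι.map_injective
    refine hg.trans ?_
    rw [Preadditive.sum_comp, Functor.map_sum]
    refine Finset.sum_congr rfl fun k _ => ?_
    have : c.inj k ≫ e.hom = c'.inj k := hc.comp_coconePointUniqueUpToIso_hom hc' ⟨k⟩
    rw [Category.assoc, this]
    rfl

end RelativeCompactness

/-! ### Localised compact objects as a Verdier quotient -/

section CompactLocalisation

variable {R : Type v} [Ring R] {𝒜 : ℤ → AddSubgroup R} [GradedRing 𝒜]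
  {T : Type w} [Category.{v} T] [Preadditive T] [HasShift T ℤ]
  [∀ n : ℤ, (shiftFunctor T n).Additive] [RLinear 𝒜 T] [HasZeroObject T] [Pretriangulated T]

/-- If `s` outside `p` kills `f`, then `f` factors through a shift of the cone of `s` on `C`, which
is compact and null. This is what embeds the quotient of the compact objects fully faithfully in the
quotient of `T`. -/
lemma isVerdierLeftLocalizing_compacts (p : HSpec 𝒜) :
    (compacts T).IsVerdierLeftLocalizing (nullObjects T p) where
  fac {C Y} f hC hY := by
    obtain ⟨a, s, hs, h0⟩ := hY C hC f
    obtain ⟨g, h, H⟩ := coneAct_spec s C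
    obtain ⟨l, hl⟩ := Dist.desc₂ H (f⟦a⟧') (by rw [act_naturality, h0])
    refine ⟨(coneAct s C)⟦-a⟧, (shiftFunctor T a).preimage (g ≫ (shiftNegShift _ a).inv),
      (shiftFunctor T a).preimage ((shiftNegShift _ a).hom ≫ l),
      (isCompactObject_coneAct s hC).shift _, nullObjects_shift (nullObjects_coneAct p hs C) _, ?_⟩
    apply (shiftFunctor T a).map_injective
    rw [Functor.map_comp, Functor.map_preimage, Functor.map_preimage, Category.assoc,
      Iso.inv_hom_id_assoc, hl]

/-- The morphisms between compact objects that become invertible after localisation. -/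
abbrev compactWeq (T : Type w) [Category.{v} T] [Preadditive T] [HasShift T ℤ]
    [∀ n : ℤ, (shiftFunctor T n).Additive] [RLinear 𝒜 T] [HasZeroObject T] [Pretriangulated T]
    (p : HSpec 𝒜) : MorphismProperty (compacts T).FullSubcategory :=
  ((nullObjects T p).inverseImage (compacts T).ι).trW

/-- The objects isomorphic to the localisation of a compact object. -/
abbrev imageObjects (Λ : T ⥤ T) : ObjectProperty T := ((compacts T).ι ⋙ Λ).essImage

/-- The localisation functor on compact objects. -/
noncomputable abbrev compactLocalisation (Λ : T ⥤ T) :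
    (compacts T).FullSubcategory ⥤ (imageObjects Λ).FullSubcategory :=
  (imageObjects Λ).lift ((compacts T).ι ⋙ Λ) fun X => Functor.obj_mem_essImage _ X

instance (Λ : T ⥤ T) : (compactLocalisation Λ).EssSurj where
  mem_essImage Y := by
    obtain ⟨C, ⟨e⟩⟩ := Y.property
    exact ⟨C, ⟨(imageObjects Λ).fullyFaithfulι.preimageIso e⟩⟩

variable [HasCoproducts.{v} T] {J : Type v} {G : J → T}
  {p : HSpec 𝒜} {Λ : T ⥤ T} [Λ.CommShift ℤ] {η : 𝟭 T ⟶ Λ} [IsTriangulated T]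

namespace IsLocalisationAt

/-- The quotient of the compact objects by the null ones embeds fully faithfully in `T_p`, hence
exactly in `T`, with essential image `imageObjects Λ`. Both assertions are read off from this
embedding. -/
theorem isTriangulated_and_isLocalization (h : IsLocalisationAt p Λ η) :
    (imageObjects Λ).IsTriangulated ∧
      (compactLocalisation Λ).IsLocalization (compactWeq T p) := by
  have := (isLocalizing_nullObjects (T := T) p).isTriangulated
  have := (isLocalizing_nullObjects (T := T) p).of_iso
  have := h.isTriangulated
  have := h.isLocalization
  have := isVerdierLeftLocalizing_compacts (T := T) p
  let L₂ := (localObjects T p).lift Λ h.isLocal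
  have hinv : (compactWeq T p).IsInvertedBy ((compacts T).ι ⋙ L₂) := fun X Y f hf =>
    Localization.inverts L₂ (nullObjects T p).trW _
      (((compacts T).triangulatedLocalizerMorphism (nullObjects T p)).map f hf)
  let Q₀ := (compactWeq T p).Q
  let F : (compactWeq T p).Localization ⥤ (localObjects T p).FullSubcategory :=
    Localization.lift ((compacts T).ι ⋙ L₂) hinv Q₀
  let e : Q₀ ⋙ F ≅ (compacts T).ι ⋙ L₂ := Localization.fac _ hinv Q₀
  have hF : F.FullyFaithful := ObjectProperty.IsVerdierLeftLocalizing.fullyFaithful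
    (compacts T) (nullObjects T p) e
  let Φ : (compactWeq T p).Localization ⥤ T := F ⋙ (localObjects T p).ι
  let e' : Q₀ ⋙ Φ ≅ (compacts T).ι ⋙ Λ :=
    (Functor.associator _ _ _).symm ≪≫ Functor.isoWhiskerRight e (localObjects T p).ι
  have hΦ : Φ.FullyFaithful := hF.comp (localObjects T p).fullyFaithfulι
  have := hΦ.full
  have := hΦ.faithful
  let : Localization.Lifting Q₀ (compactWeq T p) ((compacts T).ι ⋙ Λ) Φ := ⟨e'⟩
  let : Φ.CommShift ℤ := Functor.commShiftOfLocalization Q₀ (compactWeq T p) ℤ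
    ((compacts T).ι ⋙ Λ) Φ
  have : NatTrans.CommShift e'.hom ℤ :=
    NatTrans.commShift_iso_hom_of_localization Q₀ (compactWeq T p) ℤ ((compacts T).ι ⋙ Λ) Φ
  have : Q₀.mapArrow.EssSurj := Localization.essSurj_mapArrow Q₀ (compactWeq T p)
  have : Φ.IsTriangulated := Functor.isTriangulated_of_precomp_iso e'
  have hess : imageObjects Λ = Φ.essImage := by
    ext X
    constructor
    · rintro ⟨C, ⟨i⟩⟩
      exact ⟨Q₀.obj C, ⟨e'.app C ≪≫ i⟩⟩
    · rintro ⟨Z, ⟨i⟩⟩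
      have := Localization.essSurj Q₀ (compactWeq T p)
      exact ⟨Q₀.objPreimage Z, ⟨(e'.app _).symm ≪≫ Φ.mapIso (Q₀.objObjPreimageIso Z) ≪≫ i⟩⟩
  have htri : (imageObjects Λ).IsTriangulated := by
    rw [hess]
    exact ObjectProperty.instIsTriangulatedEssImageOfIsTriangulatedOfFull Φ
  refine ⟨htri, ?_⟩
  have hmem : ∀ Z, imageObjects Λ (Φ.obj Z) := fun Z => by
    rw [hess]
    exact Functor.obj_mem_essImage _ _
  let E : (compactWeq T p).Localization ⥤ (imageObjects Λ).FullSubcategory :=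
    (imageObjects Λ).lift Φ hmem
  have hE : E.FullyFaithful := Functor.FullyFaithful.ofCompFaithful (G := (imageObjects Λ).ι) hΦ
  have := hE.full
  have := hE.faithful
  have : E.EssSurj := ⟨fun Y => by
    obtain ⟨Z, ⟨i⟩⟩ : Φ.essImage Y.obj := hess ▸ Y.property
    exact ⟨Z, ⟨(imageObjects Λ).fullyFaithfulι.preimageIso i⟩⟩⟩
  have : E.IsEquivalence := { }
  exact Functor.IsLocalization.of_equivalence_target Q₀ (compactWeq T p) _ E.asEquivalence
    (((imageObjects Λ).fullyFaithfulι.whiskeringRight _).preimageIso e')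

end IsLocalisationAt

end CompactLocalisation

/-! ### Retracts of compact objects -/

section Retracts

variable {T : Type w} [Category.{v} T] [Preadditive T]

lemma IsCompactObject.of_retract {X Y : T} (hY : IsCompactObject Y) (i : X ⟶ Y) (r : Y ⟶ X)
    (h : i ≫ r = 𝟙 X) : IsCompactObject X := by
  intro K Z c hc f
  obtain ⟨S, g, hg⟩ := hY K Z c hc (r ≫ f)
  refine ⟨S, fun k => i ≫ g k, ?_⟩
  simp only [Category.assoc]
  rw [← Preadditive.comp_sum, ← hg, ← Category.assoc, h, Category.id_comp]

lemma compactIn_of_retract {P : ObjectProperty T} {X Y : T} (hX : P X) (hY : compactIn P Y)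
    (i : X ⟶ Y) (r : Y ⟶ X) (h : i ≫ r = 𝟙 X) : compactIn P X := by
  obtain ⟨hY, hc⟩ := hY
  exact ⟨hX, hc.of_retract (X := (⟨X, hX⟩ : P.FullSubcategory)) (ObjectProperty.homMk i)
    (ObjectProperty.homMk r) (by ext; exact h)⟩

end Retracts

/-! ### Factoring morphisms from compact objects, after Neeman -/

section Approximation

variable {T : Type w} [Category.{v} T] [Preadditive T] [HasShift T ℤ]
  [∀ n : ℤ, (shiftFunctor T n).Additive] [HasZeroObject T] [Pretriangulated T]
  {P : ObjectProperty T}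

lemma compactIn_eq_essImage [P.IsTriangulated] [P.IsClosedUnderIsomorphisms] :
    compactIn P = ((compacts P.FullSubcategory).ι ⋙ P.ι).essImage := by
  ext X
  constructor
  · rintro ⟨hX, h⟩
    exact ⟨⟨⟨X, hX⟩, h⟩, ⟨Iso.refl _⟩⟩
  · rintro ⟨Y, ⟨e⟩⟩
    refine compactIn_of_retract (P.prop_of_iso e Y.obj.property) ⟨Y.obj.property, Y.property⟩
      e.inv e.hom e.inv_hom_id

lemma isTriangulated_compactIn [P.IsTriangulated] [P.IsClosedUnderIsomorphisms] :
    (compactIn P).IsTriangulated := by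
  rw [compactIn_eq_essImage]
  infer_instance

lemma isClosedUnderIsomorphisms_compactIn [P.IsTriangulated] [P.IsClosedUnderIsomorphisms] :
    (compactIn P).IsClosedUnderIsomorphisms := by
  rw [compactIn_eq_essImage]
  infer_instance

/-- A morphism factoring through an object of `D`. -/
def FactorsThrough (D : ObjectProperty T) {X Y : T} (f : X ⟶ Y) : Prop :=
  ∃ (E : T) (u : X ⟶ E) (v : E ⟶ Y), D E ∧ f = u ≫ v

variable {D : ObjectProperty T}

omit [HasShift T ℤ] [∀ n : ℤ, (shiftFunctor T n).Additive] [HasZeroObject T] [Pretriangulated T] in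
lemma FactorsThrough.comp {X Y Z : T} {f : X ⟶ Y} (h : FactorsThrough D f) (g : Y ⟶ Z) :
    FactorsThrough D (f ≫ g) := by
  obtain ⟨E, u, v, hE, rfl⟩ := h
  exact ⟨E, u, v ≫ g, hE, Category.assoc _ _ _⟩

lemma FactorsThrough.add [D.IsTriangulated] [D.IsClosedUnderIsomorphisms] {X Y : T}
    {f g : X ⟶ Y} (hf : FactorsThrough D f) (hg : FactorsThrough D g) :
    FactorsThrough D (f + g) := by
  obtain ⟨E, u, v, hE, rfl⟩ := hf
  obtain ⟨E', u', v', hE', rfl⟩ := hg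
  refine ⟨E ⊞ E', biprod.lift u u', biprod.desc v v', ?_, by simp⟩
  exact D.ext_of_isTriangulatedClosed₂ _ (binaryBiproductTriangle_distinguished E E') hE hE'

lemma factorsThrough_zero [D.IsTriangulated] {X Y : T} : FactorsThrough D (0 : X ⟶ Y) := by
  obtain ⟨Z, -, hZ⟩ := ObjectProperty.exists_prop_of_containsZero D
  exact ⟨Z, 0, 0, hZ, by simp⟩

lemma FactorsThrough.sum [D.IsTriangulated] [D.IsClosedUnderIsomorphisms] {X Y : T} {K : Type*}
    (S : Finset K) (f : K → (X ⟶ Y)) (h : ∀ k ∈ S, FactorsThrough D (f k)) :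
    FactorsThrough D (∑ k ∈ S, f k) := by
  classical
  induction S using Finset.induction_on with
  | empty => exact factorsThrough_zero
  | insert k S hk ih =>
    rw [Finset.sum_insert hk]
    exact (h k (Finset.mem_insert_self _ _)).add
      (ih fun j hj => h j (Finset.mem_insert_of_mem hj))

/-- The objects of `P` to which all morphisms from compact objects of `P` factor through `D`. -/
def Approximable (P D : ObjectProperty T) : ObjectProperty T := fun Y =>
  P Y ∧ ∀ (X : T), compactIn P X → ∀ f : X ⟶ Y, FactorsThrough D f

variable [HasCoproducts.{v} T]

/-- First `f ≫ b` factors through some `E₃` in `D`. The obstruction `t ≫ c` to lifting `E₃ ⟶ Y₃` to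
`Y₂` factors through the cone `M` of `X ⟶ E₃`, which is compact; so it factors through some `E` in
`D`, by the hypothesis on `Y₁⟦1⟧`. On the fibre `E'` of `E₃ ⟶ E` the lift exists, and `X ⟶ E₃` comes
from `E'`. Subtracting the resulting morphism from `f` leaves one that comes from `Y₁`. -/
lemma Approximable.ext [D.IsTriangulated] [D.IsClosedUnderIsomorphisms] (hP : IsLocalizing P)
    (hD : D ≤ compactIn P) {Y₁ Y₂ Y₃ : T} {a : Y₁ ⟶ Y₂} {b : Y₂ ⟶ Y₃} {c : Y₃ ⟶ Y₁⟦(1 : ℤ)⟧}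
    (hΔ : Triangle.mk a b c ∈ distTriang T) (h₁ : Approximable P D Y₁)
    (h₁' : Approximable P D (Y₁⟦(1 : ℤ)⟧)) (h₃ : Approximable P D Y₃) : Approximable P D Y₂ := by
  have := hP.isTriangulated
  have := hP.of_iso
  have := isTriangulated_compactIn (P := P)
  have := isClosedUnderIsomorphisms_compactIn (P := P)
  refine ⟨P.ext_of_isTriangulatedClosed₂ _ hΔ h₁.1 h₃.1, fun X hX f => ?_⟩
  obtain ⟨E₃, u, t, hE₃, hut⟩ := h₃.2 X hX (f ≫ b)
  obtain ⟨M, m, δ, hM⟩ := distinguished_cocone_triangle u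
  have hM' : compactIn P M := (compactIn P).ext_of_isTriangulatedClosed₃ _ hM hX (hD _ hE₃)
  obtain ⟨k, hk⟩ := Dist.desc₂ hM (t ≫ c) (by
    rw [← Category.assoc, ← hut, Category.assoc, Dist.zero₂₃ hΔ, comp_zero])
  obtain ⟨E, x, y, hE, rfl⟩ := h₁'.2 M hM' k
  obtain ⟨E', e, g, hE'⟩ := distinguished_cocone_triangle₁ (m ≫ x)
  have hE'D : D E' := D.ext_of_isTriangulatedClosed₁ _ hE' hE₃ hE
  obtain ⟨q, hq⟩ := Dist.lift₃ hΔ (e ≫ t) (by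
    rw [Category.assoc, hk, ← Category.assoc m, ← Category.assoc, Dist.zero₁₂ hE', zero_comp])
  obtain ⟨z, hz⟩ := Dist.lift₂ hE' u (by rw [← Category.assoc, Dist.zero₁₂ hM, zero_comp])
  obtain ⟨w, hw⟩ := Dist.lift₂ hΔ (f - z ≫ q) (by
    rw [Preadditive.sub_comp, hut, Category.assoc, ← hq, ← Category.assoc, ← hz, sub_self])
  rw [sub_eq_iff_eq_add.1 hw]
  exact ((h₁.2 X hX w).comp a).add ⟨E', z, q, hE'D, rfl⟩

lemma isLocalizing_approximable [D.IsTriangulated] [D.IsClosedUnderIsomorphisms]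
    (hP : IsLocalizing P) (hD : D ≤ compactIn P) : IsLocalizing (Approximable P D) := by
  have := hP.isTriangulated
  have := hP.of_iso
  have := isTriangulated_compactIn (P := P)
  have := isClosedUnderIsomorphisms_compactIn (P := P)
  have hiso : (Approximable P D).IsClosedUnderIsomorphisms := ⟨fun {Y Y'} e h =>
    ⟨P.prop_of_iso e h.1, fun X hX f => by
      have := (h.2 X hX (f ≫ e.inv)).comp e.hom
      rwa [Category.assoc, e.inv_hom_id, Category.comp_id] at this⟩⟩
  have hshift : ∀ (n : ℤ) (Y : T), Approximable P D Y → Approximable P D (Y⟦n⟧) := by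
    refine fun n Y h => ⟨P.le_shift n _ h.1, fun X hX f => ?_⟩
    obtain ⟨f, rfl⟩ := exists_eq_shift_map f
    obtain ⟨E, u, v, hE, rfl⟩ := h.2 _ ((compactIn P).le_shift (-n) _ hX) f
    exact ⟨E⟦n⟧, (shiftNegShift X n).inv ≫ u⟦n⟧', v⟦n⟧', D.le_shift n _ hE, by
      rw [Functor.map_comp, Category.assoc]⟩
  refine ⟨?_, hiso, fun K Y c hc h => ⟨hP.coproducts Y c hc fun k => (h k).1, fun X hX f => ?_⟩⟩
  · exact
    { exists_zero := by
        obtain ⟨Z, hZ, hPZ⟩ := ObjectProperty.exists_prop_of_containsZero P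
        exact ⟨Z, hZ, hPZ, fun X _ f => by rw [hZ.eq_of_tgt f 0]; exact factorsThrough_zero⟩
      isStableUnderShiftBy := fun n => ⟨fun Y hY => hshift n Y hY⟩
      ext₂' := fun Δ hΔ h₁ h₃ => ObjectProperty.le_isoClosure _ _
        (Approximable.ext hP hD hΔ h₁ (hshift 1 _ h₁) h₃) }
  · obtain ⟨S, g, rfl⟩ := ((compactIn_iff hP X).1 hX).2 K Y (fun k => (h k).1) c hc f
    exact FactorsThrough.sum S _ fun k _ => ((h k).2 X hX (g k)).comp _

end Approximation

/-! ### Compact objects of the local subcategory -/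

section LocalCompactness

variable {R : Type v} [Ring R] {𝒜 : ℤ → AddSubgroup R} [GradedRing 𝒜]
  {T : Type w} [Category.{v} T] [Preadditive T] [HasShift T ℤ]
  [∀ n : ℤ, (shiftFunctor T n).Additive] [RLinear 𝒜 T] [HasZeroObject T] [Pretriangulated T]
  [HasCoproducts.{v} T] {J : Type v} {G : J → T}
  {p : HSpec 𝒜} {Λ : T ⥤ T} [Λ.CommShift ℤ] {η : 𝟭 T ⟶ Λ}

namespace IsLocalisationAt

/-- Morphisms from `Λ.obj C` to a local object are morphisms from `C`, and coproducts of local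
objects are local. -/
lemma compactIn_obj (h : IsLocalisationAt p Λ η) (hG : IsGenerating G) {C : T}
    (hC : IsCompactObject C) : compactIn (localObjects T p) (Λ.obj C) := by
  refine (compactIn_iff (isLocalizing_localObjects hG p) _).2
    ⟨h.isLocal C, fun K Y hY c hc f => ?_⟩
  obtain ⟨S, g, hg⟩ := hC K Y c hc (η.app C ≫ f)
  choose g' hg' using fun k => h.exists_desc hG (hY k) (g k)
  refine ⟨S, g', h.hom_ext hG ((isLocalizing_localObjects hG p).coproducts Y c hc hY) ?_⟩
  rw [hg, Preadditive.comp_sum]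
  exact Finset.sum_congr rfl fun k _ => by rw [hg', Category.assoc]

/-- Compact objects of `T_p` are retracts of localisations of compact objects. -/
theorem exists_retract [IsTriangulated T] (h : IsLocalisationAt p Λ η) (hG : IsGenerating G) {X : T}
    (hX : compactIn (localObjects T p) X) :
    ∃ (C : T) (_ : IsCompactObject C) (i : X ⟶ Λ.obj C) (r : Λ.obj C ⟶ X), i ≫ r = 𝟙 X := by
  have hP := isLocalizing_localObjects hG p
  have := h.isTriangulated
  have := h.isTriangulated_and_isLocalization.1
  have hD : imageObjects Λ ≤ compactIn (localObjects T p) := by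
    rintro Y ⟨C, ⟨e⟩⟩
    have := hP.isTriangulated
    have := hP.of_iso
    have := isClosedUnderIsomorphisms_compactIn (P := localObjects T p)
    exact (compactIn (localObjects T p)).prop_of_iso e (h.compactIn_obj hG C.property)
  have hA := isLocalizing_approximable hP hD
  have := hA.isTriangulated
  have := hA.of_iso
  -- The objects with approximable localisation form a localizing subcategory containing the
  -- generators, hence everything. For the given `X` the unit is invertible, so the identity of `X`
  -- factors through a localised compact object.
  have hloc : IsLocalizing ((Approximable (localObjects T p) (imageObjects Λ)).inverseImage Λ) := by
    refine ⟨inferInstance, inferInstance, fun K Y c hc hY => ⟨h.isLocal _, fun X hX f => ?_⟩⟩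
    obtain ⟨ψ, hψ⟩ := h.exists_section_coproduct hG Y hc
    have h1 := ((hA.coproducts _ _ (coproductIsCoproduct fun k => Λ.obj (Y k)) hY).2 X hX
      (f ≫ ψ)).comp (Limits.Sigma.desc (fun k => Λ.map (c.inj k)))
    rwa [Category.assoc, hψ, Category.comp_id] at h1
  have key := hG.mem_of_isLocalizing hloc (fun j => ⟨h.isLocal _, fun X _ f =>
    ⟨Λ.obj (G j), f, 𝟙 _, ⟨⟨G j, hG.compact j⟩, ⟨Iso.refl _⟩⟩, (Category.comp_id _).symm⟩⟩) X
  have := h.isIso_app hG hX.1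
  obtain ⟨E, u, t, ⟨C, ⟨e⟩⟩, hut⟩ := key.2 X hX (η.app X)
  refine ⟨C.obj, C.property, u ≫ e.inv, e.hom ≫ t ≫ inv (η.app X), ?_⟩
  rw [Category.assoc, Iso.inv_hom_id_assoc, ← Category.assoc, ← hut]
  exact IsIso.hom_inv_id _

end IsLocalisationAt

end LocalCompactness

/-! ### Local cohomology and compactness in its image -/

section LocalCohomology

variable {R : Type v} [Ring R] {𝒜 : ℤ → AddSubgroup R} [GradedRing 𝒜]
  {T : Type w} [Category.{v} T] [Preadditive T] [HasShift T ℤ]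
  [∀ n : ℤ, (shiftFunctor T n).Additive] [RLinear 𝒜 T] [HasZeroObject T] [Pretriangulated T]
  [HasCoproducts.{v} T] {J : Type v} {G : J → T}
  {p : HSpec 𝒜}

/-- `ε : Γ ⟶ Λ` exhibits `Γ` as the `p`-torsion part of `Λ`. -/
structure IsLocalCohomologyAt (p : HSpec 𝒜) {Γ Λ : T ⥤ T} (ε : Γ ⟶ Λ) : Prop where
  gamma : ∀ X, gammaObjects T p (Γ.obj X)
  existsUnique : ∀ (X Y : T), gammaObjects T p Y → ∀ f : Y ⟶ Λ.obj X,
    ∃! g : Y ⟶ Γ.obj X, g ≫ ε.app X = f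

lemma IsLocalCohomologyAt.isIso_app {Γ Λ : T ⥤ T} {ε : Γ ⟶ Λ} (h : IsLocalCohomologyAt p ε)
    {X : T} (hX : gammaObjects T p (Λ.obj X)) : IsIso (ε.app X) := by
  obtain ⟨g, hg, -⟩ := h.existsUnique X _ hX (𝟙 _)
  refine ⟨g, (h.existsUnique X _ (h.gamma X) (ε.app X)).unique ?_ (Category.id_comp _), hg⟩
  rw [Category.assoc, hg, Category.comp_id]

theorem exists_isLocalCohomologyAt (hcomm : IsGradedCommutative 𝒜) (hnoeth : IsGradedNoetherian 𝒜)
    (hG : IsGenerating G) (p : HSpec 𝒜) :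
    ∃ ε : localCohomology T p ⟶ localisation T p, IsLocalCohomologyAt p ε := by
  have h₁ := isRightAdjoint_local hG p
  have h₂ := isLeftAdjoint_gamma hcomm hnoeth hG p
  have e₁ : localisation T p = (localObjects T p).ι.leftAdjoint ⋙ (localObjects T p).ι :=
    dif_pos h₁
  have e₂ : localCohomology T p = (localObjects T p).ι.leftAdjoint ⋙
      (ObjectProperty.ιOfLE (gammaObjects_le T p)).rightAdjoint ⋙ (gammaObjects T p).ι :=
    dif_pos ⟨h₁, h₂⟩
  rw [e₁, e₂]
  let adj := Adjunction.ofIsLeftAdjoint (ObjectProperty.ιOfLE (gammaObjects_le T p))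
  refine ⟨{ app := fun X => (adj.counit.app ((localObjects T p).ι.leftAdjoint.obj X)).hom
            naturality := fun X Y f => congrArg (fun k => k.hom)
              (adj.counit.naturality ((localObjects T p).ι.leftAdjoint.map f)) },
    fun X => ObjectProperty.FullSubcategory.property _, fun X Y hY f => ?_⟩
  let X' := (localObjects T p).ι.leftAdjoint.obj X
  change Y ⟶ X'.obj at f
  let f' : (ObjectProperty.ιOfLE (gammaObjects_le T p)).obj ⟨Y, hY⟩ ⟶ X' := ObjectProperty.homMk f
  refine ⟨(adj.homEquiv ⟨Y, hY⟩ X' f').hom, ?_, fun g hg => ?_⟩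
  · have := (adj.homEquiv ⟨Y, hY⟩ X').symm_apply_apply f'
    rw [Adjunction.homEquiv_counit] at this
    exact congrArg (fun k => k.hom) this
  · have : ObjectProperty.homMk g = adj.homEquiv ⟨Y, hY⟩ X' f' := by
      rw [← Equiv.symm_apply_eq, Adjunction.homEquiv_counit]
      ext
      exact hg
    exact congrArg (fun k => k.hom) this

lemma isZero_localCohomology_of_notMem_support {p : HSpec 𝒜} (hp : p ∉ support 𝒜 T) (X : T) :
    IsZero ((localCohomology T p).obj X) := by
  by_contra h
  exact hp ⟨X, h⟩

/-- Compact objects of `Γ_p T` are compact in `T_p`. -/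
theorem compactIn_gamma_le (hcomm : IsGradedCommutative 𝒜) (hnoeth : IsGradedNoetherian 𝒜)
    (hG : IsGenerating G) (p : HSpec 𝒜) :
    compactIn (gammaObjects T p) ≤ compactIn (localObjects T p) := by
  have hloc := isLocalizing_localObjects hG p
  have hgam : IsLocalizing (gammaObjects T p) := hloc.inf (isLocalizing_torsionObjects p)
  intro X hX
  rw [compactIn_iff hgam] at hX
  refine (compactIn_iff hloc X).2 ⟨hX.1.1, fun K Y hY c hc f => ?_⟩
  choose A ε hA hε using fun k => exists_gamma_coreflection hcomm hnoeth hG p (Y k) (hY k)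
  obtain ⟨I, S, hS, hSc, hSt, hSgen⟩ := exists_torsion_generators (T := T) hcomm hnoeth hG p
  -- The torsion part of the coproduct is the coproduct of the torsion parts: the compact torsion
  -- generators see finitely many summands at a time, so the cone of `u` is orthogonal to them. As
  -- `X` is torsion, `f` then lifts along `u`.
  let u : ∐ A ⟶ c.pt := Limits.Sigma.desc fun k => ε k ≫ c.inj k
  have hu : ∀ k, Sigma.ι A k ≫ u = ε k ≫ c.inj k := fun k => by simp [u]
  obtain ⟨B, b, δ, hΔ⟩ := distinguished_cocone_triangle u
  have hB : perp S B := by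
    intro j g
    have hgδ : g ≫ δ = 0 := by
      refine eq_zero_of_comp_shift_map u hS (fun j g hg => ?_) 1 j _
        (by rw [Category.assoc, Dist.zero₃₁ hΔ, comp_zero])
      obtain ⟨s, g', rfl⟩ := hSc j _ _ _ (coproductIsCoproduct A) g
      change (∑ k ∈ s, g' k ≫ Sigma.ι A k) ≫ u = 0 at hg
      simp only [Preadditive.sum_comp, Category.assoc, hu] at hg
      simp only [← Category.assoc] at hg
      refine Finset.sum_eq_zero fun k hk => ?_
      have h0 := eq_zero_of_sum_inj_eq_zero c hc s _ hg k hk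
      rw [((hε k) _ (hSt j) 0).unique h0 zero_comp, zero_comp]
    obtain ⟨g, rfl⟩ := Dist.lift₃ hΔ g hgδ
    obtain ⟨s, g, rfl⟩ := hSc j _ _ _ hc g
    choose g' hg' _ using fun k => hε k _ (hSt j) (g k)
    rw [Preadditive.sum_comp]
    refine Finset.sum_eq_zero fun k _ => ?_
    rw [← hg', Category.assoc (g' k), ← hu, Category.assoc, Category.assoc, Dist.zero₁₂ hΔ,
      comp_zero, comp_zero]
  obtain ⟨f', rfl⟩ := Dist.lift₂ hΔ f (loc_perp hS (hSgen X hX.1.2) hB _)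
  obtain ⟨s, g, rfl⟩ := hX.2 K A hA _ (coproductIsCoproduct A) f'
  refine ⟨s, fun k => g k ≫ ε k, ?_⟩
  rw [Preadditive.sum_comp]
  exact Finset.sum_congr rfl fun k _ => by rw [Category.assoc, Category.assoc]; exact congrArg (g k ≫ ·) (hu k)

end LocalCohomology

/-! ### Compact torsion-local objects as retracts of localised torsion compacts -/

section Powers

variable {R : Type v} [Ring R] {𝒜 : ℤ → AddSubgroup R} [GradedRing 𝒜]

lemma mem_of_hpow_mem (q : HSpec 𝒜) {a : ℤ} (s : 𝒜 a) (N : ℕ)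
    (h : (hpow s N : R) ∈ q.ideal) : (s : R) ∈ q.ideal := by
  induction N with
  | zero => exact (q.ne_top ((Ideal.eq_top_iff_one _).2 (by simpa [hpow] using h))).elim
  | succ N ih =>
    rcases q.mem_or_mem (N • a) a ((s : R) ^ N) (s : R) (SetLike.pow_mem_graded N s.2) s.2
      (by rw [← pow_succ]; exact h) with h | h
    · exact ih h
    · exact h

end Powers

section TorsionRetract

variable {R : Type v} [Ring R] {𝒜 : ℤ → AddSubgroup R} [GradedRing 𝒜]
  {T : Type w} [Category.{v} T] [Preadditive T] [HasShift T ℤ]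
  [∀ n : ℤ, (shiftFunctor T n).Additive] [RLinear 𝒜 T] [HasZeroObject T] [Pretriangulated T]
  [HasCoproducts.{v} T] {J : Type v} {G : J → T}
  {p : HSpec 𝒜} {Λ : T ⥤ T} [Λ.CommShift ℤ] {η : 𝟭 T ⟶ Λ}

omit [HasZeroObject T] [Pretriangulated T] [HasCoproducts.{v} T] in
lemma torsionObjects_of_act {X : T} (h : ∀ q : HSpec 𝒜, ¬ p.ideal ≤ q.ideal →
    ∃ (a : ℤ) (s : 𝒜 a), (s : R) ∉ q.ideal ∧ act s X = 0) : torsionObjects T p X :=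
  (torsionObjects_iff p X).2 fun q C _ f => by
    obtain ⟨a, s, hs, h0⟩ := h q.1 q.2
    exact ⟨a, s, hs, by rw [h0, comp_zero]⟩

omit [HasZeroObject T] [Pretriangulated T] [HasCoproducts.{v} T] in
-- Torsion is applied to the identity of `C`. With `torsionObjects_of_act`, torsion of a compact
-- object becomes a condition on the action alone, which linear additive functors preserve.
lemma exists_act_of_torsionObjects {C : T} (hC : IsCompactObject C) (h : torsionObjects T p C)
    (q : HSpec 𝒜) (hq : ¬ p.ideal ≤ q.ideal) :
    ∃ (a : ℤ) (s : 𝒜 a), (s : R) ∉ q.ideal ∧ act s C = 0 := by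
  obtain ⟨a, s, hs, h0⟩ := (torsionObjects_iff p C).1 h ⟨q, hq⟩ C hC (𝟙 C)
  exact ⟨a, s, hs, by rwa [Category.id_comp] at h0⟩

namespace IsLocalisationAt

lemma act_eq_zero (h : IsLocalisationAt p Λ η) (hG : IsGenerating G) {a : ℤ} {s : 𝒜 a} {X : T}
    (hs : act s X = 0) : act s (Λ.obj X) = 0 := by
  have := h.isTriangulated
  rw [← h.map_act hG, hs, Functor.map_zero, zero_comp]

lemma gammaObjects_obj (h : IsLocalisationAt p Λ η) (hG : IsGenerating G) {C : T}
    (hC : IsCompactObject C) (ht : torsionObjects T p C) : gammaObjects T p (Λ.obj C) :=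
  ⟨h.isLocal C, torsionObjects_of_act fun q hq => by
    obtain ⟨a, s, hs, h0⟩ := exists_act_of_torsionObjects hC ht q hq
    exact ⟨a, s, hs, h.act_eq_zero hG h0⟩⟩

/-- If `s` vanishes on a retract `X` of `Λ C`, then `X` is a retract of the localisation of a
desuspension of the cone of `s` on `C`. -/
lemma exists_retract_coneAct (h : IsLocalisationAt p Λ η) (hG : IsGenerating G) {X C : T}
    (i : X ⟶ Λ.obj C) (r : Λ.obj C ⟶ X) (hir : i ≫ r = 𝟙 X) {a : ℤ} (s : 𝒜 a)
    (hs : act s X = 0) :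
    ∃ (i' : X ⟶ Λ.obj ((coneAct s C)⟦-a⟧)) (r' : Λ.obj ((coneAct s C)⟦-a⟧) ⟶ X),
      i' ≫ r' = 𝟙 X := by
  have := h.isTriangulated
  obtain ⟨g, δ, H⟩ := coneAct_spec s C
  -- As `s` is zero on `X`, the shifted retraction vanishes on the image of `s` and factors through
  -- the localised cone.
  have h0 : Λ.map (act s C) ≫ (Λ.commShiftIso a).hom.app C ≫ r⟦a⟧' = 0 := by
    rw [← Category.assoc, h.map_act hG, act_naturality, hs, comp_zero]
  obtain ⟨k, hk⟩ : ∃ k : Λ.obj (coneAct s C) ⟶ X⟦a⟧,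
      (Λ.commShiftIso a).hom.app C ≫ r⟦a⟧' = Λ.map g ≫ k :=
    Dist.desc₂ (Λ.map_distinguished _ H) _ h0
  have hret : (i⟦a⟧' ≫ (Λ.commShiftIso a).inv.app C ≫ Λ.map g) ≫ k = 𝟙 _ := by
    rw [Category.assoc, Category.assoc, ← hk, Iso.inv_hom_id_app_assoc, ← Functor.map_comp, hir,
      CategoryTheory.Functor.map_id]
  let e : X⟦a⟧⟦-a⟧ ≅ X := shiftShiftNeg X a
  let e' := (Λ.commShiftIso (-a)).app (coneAct s C)
  refine ⟨e.inv ≫ (i⟦a⟧' ≫ (Λ.commShiftIso a).inv.app C ≫ Λ.map g)⟦-a⟧' ≫ e'.inv,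
    e'.hom ≫ k⟦-a⟧' ≫ e.hom, ?_⟩
  simp only [Category.assoc]
  rw [e'.inv_hom_id_assoc, ← Functor.map_comp_assoc, hret, CategoryTheory.Functor.map_id,
    Category.id_comp, e.inv_hom_id]

/-- Compact objects of `Γ_p T` are retracts of localisations of `p`-torsion compact objects. -/
theorem exists_torsion_retract [IsTriangulated T] (hcomm : IsGradedCommutative 𝒜)
    (hnoeth : IsGradedNoetherian 𝒜) (h : IsLocalisationAt p Λ η) (hG : IsGenerating G) {X : T}
    (hX : compactIn (localObjects T p) X) (ht : torsionObjects T p X) :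
    ∃ (C : T) (_ : IsCompactObject C) (_ : torsionObjects T p C) (i : X ⟶ Λ.obj C)
      (r : Λ.obj C ⟶ X), i ≫ r = 𝟙 X := by
  obtain ⟨l, hl⟩ := exists_homogeneous_generators hnoeth p
  obtain ⟨C₀, hC₀, i₀, r₀, hir₀⟩ := h.exists_retract hG hX
  -- `X` is compact in `T_p` but possibly not in `T`; torsion is therefore tested on `η.app C₀ ≫
  -- r₀`, whose source is compact, and `η` is cancelled because `X` is local.
  have hX0 : ∀ q : HSpec 𝒜, ¬ p.ideal ≤ q.ideal →
      ∃ (a : ℤ) (s : 𝒜 a), (s : R) ∉ q.ideal ∧ 𝟙 X ≫ act s X = 0 := by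
    intro q hq
    obtain ⟨a, s, hs, h0⟩ := (torsionObjects_iff p X).1 ht ⟨q, hq⟩ C₀ hC₀ (η.app C₀ ≫ r₀)
    refine ⟨a, s, hs, ?_⟩
    have hloc := (isLocalizing_localObjects hG p).isTriangulated
    have h1 : r₀ ≫ act s X = 0 := h.hom_ext hG ((localObjects T p).le_shift a _ hX.1) (by
      rw [← Category.assoc, h0, comp_zero])
    rw [← hir₀, Category.assoc, h1, comp_zero]
  -- Each generator of `p` has a power that is zero on `X`. Coning off these powers on `C` keeps `X`
  -- a retract and finally makes `C` torsion.
  have key : ∀ l : List (Σ a : ℤ, 𝒜 a), (∀ e ∈ l, (e.2 : R) ∈ p.ideal) →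
      ∃ (C : T) (_ : IsCompactObject C) (i : X ⟶ Λ.obj C) (r : Λ.obj C ⟶ X), i ≫ r = 𝟙 X ∧
        ∀ q : HSpec 𝒜, (∃ e ∈ l, (e.2 : R) ∉ q.ideal) → nullObjects T q C := by
    intro l
    induction l with
    | nil => exact fun _ => ⟨C₀, hC₀, i₀, r₀, hir₀, by simp⟩
    | cons e l ih =>
      intro hle
      obtain ⟨C, hC, i, r, hir, hCq⟩ := ih fun e' he' => hle e' (List.mem_cons_of_mem _ he')
      obtain ⟨N, hN⟩ := exists_comp_act_hpow_eq_zero hcomm hX0 e.2 (hle e List.mem_cons_self)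
      rw [Category.id_comp] at hN
      obtain ⟨i', r', hir'⟩ := h.exists_retract_coneAct hG i r hir (hpow e.2 N) hN
      refine ⟨_, (isCompactObject_coneAct _ hC).shift _, i', r', hir', fun q hq =>
        nullObjects_shift ?_ _⟩
      by_cases heq : ((hpow e.2 N : 𝒜 _) : R) ∈ q.ideal
      · obtain ⟨g, k, H⟩ := coneAct_spec (hpow e.2 N) C
        have hCq' : nullObjects T q C := hCq q (by
          obtain ⟨e', he', h'⟩ := hq
          rcases List.mem_cons.1 he' with rfl | he'
          · exact (h' (mem_of_hpow_mem q _ _ heq)).elim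
          · exact ⟨e', he', h'⟩)
        exact (isLocalizing_nullObjects q).cone _ H hCq' (nullObjects_shift hCq' _)
      · exact nullObjects_coneAct q heq C
  obtain ⟨C, hC, i, r, hir, hCq⟩ := key l ((hl p).2 le_rfl)
  refine ⟨C, hC, (torsionObjects_iff p C).2 fun q => hCq q.1 ?_, i, r, hir⟩
  by_contra! h'
  exact q.2 ((hl q.1).1 h')

end IsLocalisationAt

end TorsionRetract

/-! ### Linear functors -/

section LinearFunctors

universe w₁ w₂ w₃

variable {R : Type v} [Ring R] {𝒜 : ℤ → AddSubgroup R} [GradedRing 𝒜]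
variable {C : Type w₁} [Category.{v} C] [Preadditive C] [HasShift C ℤ]
  [∀ n : ℤ, (shiftFunctor C n).Additive] [RLinear 𝒜 C]
variable {D : Type w₂} [Category.{v} D] [Preadditive D] [HasShift D ℤ]
  [∀ n : ℤ, (shiftFunctor D n).Additive] [RLinear 𝒜 D]
variable {E : Type w₃} [Category.{v} E] [Preadditive E] [HasShift E ℤ]
  [∀ n : ℤ, (shiftFunctor E n).Additive] [RLinear 𝒜 E]

/-- A functor is linear if and only if it is compatible with the action on objects. -/
lemma isRLinearFunctor_iff (F : C ⥤ D) [F.CommShift ℤ] : IsRLinearFunctor 𝒜 F ↔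
    ∀ (X : C) (a : ℤ) (s : 𝒜 a),
      F.map (act s X) ≫ (F.commShiftIso a).hom.app X = act s (F.obj X) := by
  constructor
  · intro h X a s
    have h1 := h X X (add_zero a) s (ShiftedHom.mk₀ 0 rfl (𝟙 X))
    rw [ShiftedHom.map_mk₀, CategoryTheory.Functor.map_id, ShiftedHom.mk₀_id_comp,
      ShiftedHom.mk₀_id_comp] at h1
    exact h1
  · intro h X Y a i j hij s α
    rw [ShiftedHom.map_comp]
    congr 1
    exact h Y a s

lemma IsRLinearFunctor.map_act {F : C ⥤ D} [F.CommShift ℤ] (h : IsRLinearFunctor 𝒜 F) (X : C)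
    {a : ℤ} (s : 𝒜 a) : F.map (act s X) ≫ (F.commShiftIso a).hom.app X = act s (F.obj X) :=
  (isRLinearFunctor_iff F).1 h X a s

lemma IsRLinearFunctor.act_eq_zero_iff {F : C ⥤ D} [F.CommShift ℤ] [F.Additive] [F.Faithful]
    (h : IsRLinearFunctor 𝒜 F) (X : C) {a : ℤ} (s : 𝒜 a) :
    act s (F.obj X) = 0 ↔ act s X = 0 := by
  rw [← h.map_act, Preadditive.IsIso.comp_right_eq_zero, Functor.map_eq_zero_iff]

lemma IsRLinearFunctor.comp {F : C ⥤ D} [F.CommShift ℤ] (hF : IsRLinearFunctor 𝒜 F)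
    {K : D ⥤ E} [K.CommShift ℤ] (hK : IsRLinearFunctor 𝒜 K) : IsRLinearFunctor 𝒜 (F ⋙ K) :=
  (isRLinearFunctor_iff _).2 fun X a s => by
    rw [Functor.commShiftIso_comp_hom_app, Functor.comp_map, ← Category.assoc, ← Functor.map_comp,
      hF.map_act, hK.map_act]
    rfl

lemma IsRLinearFunctor.of_iso {F F' : C ⥤ D} [F.CommShift ℤ] [F'.CommShift ℤ] (e : F ≅ F')
    [NatTrans.CommShift e.hom ℤ] (hF : IsRLinearFunctor 𝒜 F) : IsRLinearFunctor 𝒜 F' :=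
  (isRLinearFunctor_iff _).2 fun X a s => by
    rw [← cancel_epi (e.hom.app X), ← act_naturality, ← hF.map_act, Category.assoc,
      NatTrans.shift_app_comm, NatTrans.naturality_assoc]

lemma IsRLinearFunctor.of_comp_faithful {F : C ⥤ D} [F.CommShift ℤ] {K : D ⥤ E} [K.CommShift ℤ]
    [K.Faithful] (hK : IsRLinearFunctor 𝒜 K) (h : IsRLinearFunctor 𝒜 (F ⋙ K)) :
    IsRLinearFunctor 𝒜 F :=
  (isRLinearFunctor_iff _).2 fun X a s => by
    apply K.map_injective
    rw [← cancel_mono ((K.commShiftIso a).hom.app (F.obj X)), hK.map_act, Functor.map_comp,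
      Category.assoc]
    refine Eq.trans ?_ (h.map_act X s)
    rw [Functor.commShiftIso_comp_hom_app]
    rfl

lemma IsRLinearFunctor.of_precomp {F : C ⥤ D} [F.CommShift ℤ] (hF : IsRLinearFunctor 𝒜 F)
    [F.EssSurj] {K : D ⥤ E} [K.CommShift ℤ] (h : IsRLinearFunctor 𝒜 (F ⋙ K)) :
    IsRLinearFunctor 𝒜 K :=
  (isRLinearFunctor_iff _).2 fun Y a s => by
    have key : ∀ X, K.map (act s (F.obj X)) ≫ (K.commShiftIso a).hom.app (F.obj X) =
        act s (K.obj (F.obj X)) := fun X => by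
      rw [← hF.map_act, Functor.map_comp, Category.assoc]
      refine Eq.trans ?_ (h.map_act X s)
      rw [Functor.commShiftIso_comp_hom_app]
      rfl
    let e := F.objObjPreimageIso Y
    rw [← cancel_epi (K.map e.hom), ← Category.assoc, ← Functor.map_comp, ← act_naturality,
      Functor.map_comp, Category.assoc, Functor.commShiftIso_hom_naturality, ← Category.assoc, key,
      act_naturality]

lemma isRLinearFunctor_ι (P : ObjectProperty C) [P.IsStableUnderShift ℤ] :
    IsRLinearFunctor 𝒜 P.ι :=
  (isRLinearFunctor_iff _).2 fun X a s => by
    have : P.ι.map (act s X) = act s X.obj ≫ (P.ι.commShiftIso a).inv.app X := rfl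
    rw [this, Category.assoc, Iso.inv_hom_id_app]
    exact Category.comp_id _

lemma act_obj_eq_zero_iff {P : ObjectProperty C} [P.IsStableUnderShift ℤ] (X : P.FullSubcategory)
    {a : ℤ} (s : 𝒜 a) : act s X.obj = 0 ↔ act s X = 0 :=
  (isRLinearFunctor_ι P).act_eq_zero_iff X s

lemma isRLinearFunctor_lift (P : ObjectProperty C) [P.IsStableUnderShift ℤ] (F : D ⥤ C)
    [F.CommShift ℤ] (hF : ∀ X, P (F.obj X)) (h : IsRLinearFunctor 𝒜 F) :
    IsRLinearFunctor 𝒜 (P.lift F hF) :=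
  IsRLinearFunctor.of_comp_faithful (isRLinearFunctor_ι P)
    (h.of_iso (P.liftCompιIso F hF).symm)

end LinearFunctors

/-! ### The equivalence induced on localised compact objects -/

section InducedFunctor

variable {R : Type v} [Ring R] {𝒜 : ℤ → AddSubgroup R} [GradedRing 𝒜]
  {T : Type w} [Category.{v} T] [Preadditive T] [HasShift T ℤ]
  [∀ n : ℤ, (shiftFunctor T n).Additive] [RLinear 𝒜 T] [HasZeroObject T] [Pretriangulated T]
  [HasCoproducts.{v} T] {J : Type v} {G : J → T}
  {p : HSpec 𝒜} {Λ : T ⥤ T} [Λ.CommShift ℤ] {η : 𝟭 T ⟶ Λ} [IsTriangulated T]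

omit [HasCoproducts.{v} T] [IsTriangulated T] in
lemma nullObjects_iff_of_isCompactObject {C : T} (hC : IsCompactObject C) :
    nullObjects T p C ↔ ∃ (a : ℤ) (s : 𝒜 a), (s : R) ∉ p.ideal ∧ act s C = 0 := by
  refine ⟨fun h => ?_, fun ⟨a, s, hs, h0⟩ K _ f => ⟨a, s, hs, by rw [h0, comp_zero]⟩⟩
  obtain ⟨a, s, hs, h0⟩ := h C hC (𝟙 C)
  exact ⟨a, s, hs, by rwa [Category.id_comp] at h0⟩

omit [HasCoproducts.{v} T] in
-- A compact object is null exactly when some `s` outside `p` acts on it as zero, which a faithful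
-- linear functor preserves and reflects.
lemma compactWeq_map_iff {F : (compacts T).FullSubcategory ⥤ (compacts T).FullSubcategory}
    [F.CommShift ℤ] [F.IsTriangulated] [F.Faithful] (hF : IsRLinearFunctor 𝒜 F)
    (p : HSpec 𝒜) {X Y : (compacts T).FullSubcategory} (f : X ⟶ Y) :
    compactWeq T p f ↔ compactWeq T p (F.map f) := by
  have := (isLocalizing_nullObjects (T := T) p).isTriangulated
  have := (isLocalizing_nullObjects (T := T) p).of_iso
  have h : ((nullObjects T p).inverseImage (compacts T).ι).inverseImage F =
      (nullObjects T p).inverseImage (compacts T).ι := by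
    ext X
    change nullObjects T p (F.obj X).obj ↔ nullObjects T p X.obj
    rw [nullObjects_iff_of_isCompactObject (F.obj X).property,
      nullObjects_iff_of_isCompactObject X.property]
    simp only [act_obj_eq_zero_iff, hF.act_eq_zero_iff]
  change ((nullObjects T p).inverseImage (compacts T).ι).trW f ↔ _
  conv_lhs => rw [← h]
  exact ObjectProperty.inverseImage_trW_iff _ F f

lemma IsLocalisationAt.isRLinearFunctor (h : IsLocalisationAt p Λ η) (hG : IsGenerating G) :
    IsRLinearFunctor 𝒜 Λ :=
  (isRLinearFunctor_iff _).2 fun X _ s => h.map_act hG s X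

lemma IsLocalisationAt.isRLinearFunctor_compactLocalisation (h : IsLocalisationAt p Λ η)
    (hG : IsGenerating G) [(imageObjects Λ).IsTriangulated] :
    IsRLinearFunctor 𝒜 (compactLocalisation Λ) :=
  isRLinearFunctor_lift _ _ _ ((isRLinearFunctor_ι _).comp (h.isRLinearFunctor hG))

/-- An `R`-linear triangle equivalence of the compact objects induces one on their
localisations. -/
theorem IsLocalisationAt.exists_inducedFunctor (h : IsLocalisationAt p Λ η) (hG : IsGenerating G)
    [(imageObjects Λ).IsTriangulated]
    {F : (compacts T).FullSubcategory ⥤ (compacts T).FullSubcategory}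
    [F.CommShift ℤ] [F.IsTriangulated] [F.IsEquivalence] (hF : IsRLinearFunctor 𝒜 F) :
    ∃ (F' : (imageObjects Λ).FullSubcategory ⥤ (imageObjects Λ).FullSubcategory),
      IsRLinearTriangleEquivalence 𝒜 F' ∧
      Nonempty (compactLocalisation Λ ⋙ F' ≅ F ⋙ compactLocalisation Λ) := by
  have := (isLocalizing_nullObjects (T := T) p).isTriangulated
  have := (isLocalizing_nullObjects (T := T) p).of_iso
  have := h.isTriangulated
  have := h.isTriangulated_and_isLocalization.2
  let Q := compactLocalisation Λ
  let W := compactWeq T p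
  let Φ : LocalizerMorphism W W :=
    { functor := F
      map := fun X Y f hf => (compactWeq_map_iff hF p f).1 hf }
  have : Φ.functor.IsEquivalence := inferInstanceAs F.IsEquivalence
  have : Φ.IsInduced := ⟨by
    ext X Y f
    exact (compactWeq_map_iff hF p f).symm⟩
  have : Φ.IsLocalizedEquivalence := Φ.isLocalizedEquivalence_of_isInduced
  have hinv : W.IsInvertedBy (F ⋙ Q) := fun X Y f hf =>
    Localization.inverts Q W _ (Φ.map f hf)
  let F' := Localization.lift (F ⋙ Q) hinv Q
  let e : Q ⋙ F' ≅ F ⋙ Q := Localization.fac _ hinv Q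
  let : CatCommSq Φ.functor Q Q F' := ⟨e.symm⟩
  have : F'.IsEquivalence := Φ.isEquivalence Q Q F'
  let : Localization.Lifting Q W (F ⋙ Q) F' := ⟨e⟩
  let : F'.CommShift ℤ := Functor.commShiftOfLocalization Q W ℤ (F ⋙ Q) F'
  have : NatTrans.CommShift e.hom ℤ :=
    NatTrans.commShift_iso_hom_of_localization Q W ℤ (F ⋙ Q) F'
  have : Q.mapArrow.EssSurj := Localization.essSurj_mapArrow Q W
  have : F'.IsTriangulated := Functor.isTriangulated_of_precomp_iso e
  have hQ : IsRLinearFunctor 𝒜 Q := h.isRLinearFunctor_compactLocalisation hG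
  exact ⟨F', ⟨inferInstance, inferInstance, inferInstance,
    hQ.of_precomp ((hF.comp hQ).of_iso e.symm)⟩, ⟨e⟩⟩

end InducedFunctor

/-! ### Graded morphisms in the localised category -/

section ModuleStructure

variable {R : Type v} [Ring R] {𝒜 : ℤ → AddSubgroup R} [GradedRing 𝒜]
variable {C : Type w} [Category.{v} C] [Preadditive C] [HasShift C ℤ]
  [∀ n : ℤ, (shiftFunctor C n).Additive] [RLinear 𝒜 C]

lemma homMod_smul_eq_act {X Y : C} {a i j : ℤ} (h : a + i = j) (s : 𝒜 a) (α : X ⟶ Y⟦i⟧) :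
    (homMod 𝒜 X Y).smul h s α = ((a * i).negOnePow •
      α ≫ act s (Y⟦i⟧) ≫ (shiftFunctorAdd' C i a j (by lia)).inv.app Y : X ⟶ Y⟦j⟧) := by
  rw [homMod_smul, shift_map_act, shiftFunctorComm_eq C i a j (by lia),
    Linear.units_smul_comp, Linear.comp_units_smul]
  simp
  rfl

end ModuleStructure

section LocalisedCompacts

variable {R : Type v} [Ring R] {𝒜 : ℤ → AddSubgroup R} [GradedRing 𝒜]
  {T : Type w} [Category.{v} T] [Preadditive T] [HasShift T ℤ]
  [∀ n : ℤ, (shiftFunctor T n).Additive] [RLinear 𝒜 T] [HasZeroObject T] [Pretriangulated T]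
  [HasCoproducts.{v} T] {J : Type v} {G : J → T}
  {p : HSpec 𝒜} {Λ : T ⥤ T} [Λ.CommShift ℤ] {η : 𝟭 T ⟶ Λ} [IsTriangulated T]

namespace IsLocalisationAt

/-- Denominators are invertible on local objects; the other two conditions are the calculus of
fractions for degree-zero morphisms into `Y⟦i⟧`. -/
lemma isLocalisationMap (h : IsLocalisationAt p Λ η) (hG : IsGenerating G)
    [(imageObjects Λ).IsTriangulated] [(compactLocalisation Λ).Additive]
    (hQ : IsRLinearFunctor 𝒜 (compactLocalisation Λ)) (X Y : (compacts T).FullSubcategory) :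
    IsLocalisationMap p (homMap 𝒜 (compactLocalisation Λ) hQ X Y) where
  isLocal := isLocalModule_homMod fun a s hs => by
    have h1 : IsIso (act s (Λ.obj Y.obj)) := (localObjects_iff hG p _).1 (h.isLocal _) a s hs
    have h2 : IsIso ((imageObjects Λ).ι.map (act s ((compactLocalisation Λ).obj Y))) := by
      have := (isRLinearFunctor_ι (𝒜 := 𝒜) (imageObjects Λ)).map_act
        ((compactLocalisation Λ).obj Y) s
      rw [← isIso_comp_right_iff _ (((imageObjects Λ).ι.commShiftIso a).hom.app _), this]
      exact h1
    exact isIso_of_reflects_iso _ (imageObjects Λ).ι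
  exists_of_eq_zero i m hm := by
    change X ⟶ Y⟦i⟧ at m
    have h1 : (compactLocalisation Λ).map m = 0 :=
      (Preadditive.IsIso.comp_right_eq_zero _ (((compactLocalisation Λ).commShiftIso i).hom.app Y)).1
        hm
    have h2 : Λ.map m.hom = 0 := congrArg (imageObjects Λ).ι.map h1
    have h3 : m.hom ≫ η.app _ = 0 := by
      have := η.naturality m.hom
      rw [h2, comp_zero] at this
      exact this
    obtain ⟨a, s, hs, h0⟩ := h.exists_act_eq_zero X.property m.hom h3
    refine ⟨a, s, hs, (homMod_smul_eq_zero_iff _ s m).2 ?_⟩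
    apply (compacts T).ι.map_injective
    rw [← cancel_mono (((compacts T).ι.commShiftIso a).hom.app _), Functor.map_comp, Category.assoc,
      (isRLinearFunctor_ι (compacts T)).map_act, Functor.map_zero, zero_comp]
    exact h0
  surj i n := by
    let Q := compactLocalisation Λ
    change Q.obj X ⟶ (Q.obj Y)⟦i⟧ at n
    obtain ⟨β, hβ⟩ : ∃ β : Q.obj X ⟶ Q.obj (Y⟦i⟧), n = β ≫ (Q.commShiftIso i).hom.app Y :=
      ⟨n ≫ (Q.commShiftIso i).inv.app Y, by simp⟩
    obtain ⟨a, s, g, hs, hg⟩ := h.exists_comp_map_act_eq hG X.property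
      (Y := (Y⟦i⟧).obj) ((imageObjects Λ).ι.map β)
    obtain ⟨g', hg₀⟩ : ∃ g' : X ⟶ (Y⟦i⟧)⟦a⟧, (compacts T).ι.map g' =
      g ≫ ((compacts T).ι.commShiftIso a).inv.app (Y⟦i⟧) := ⟨_, Functor.map_preimage _ _⟩
    have hg' : β ≫ Q.map (act s (Y⟦i⟧)) = Q.map g' := by
      apply (imageObjects Λ).ι.map_injective
      have e1 : (compacts T).ι.map (act s (Y⟦i⟧)) =
        act s (Y⟦i⟧).obj ≫ ((compacts T).ι.commShiftIso a).inv.app (Y⟦i⟧) := rfl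
      change (imageObjects Λ).ι.map β ≫ Λ.map ((compacts T).ι.map (act s (Y⟦i⟧))) =
        Λ.map ((compacts T).ι.map g')
      rw [e1, hg₀, Functor.map_comp, ← Category.assoc, hg]
      exact (Functor.map_comp _ _ _).symm
    -- The sign is the one between the module action and composition with `act s (Y⟦i⟧)`.
    refine ⟨a, s, hs, (a * i).negOnePow •
      (g' ≫ (shiftFunctorAdd' _ i a (a + i) (add_comm i a)).inv.app Y), ?_⟩
    rw [homMod_smul_eq_act]
    change Q.map _ ≫ (Q.commShiftIso (a + i)).hom.app Y = _
    rw [Functor.map_units_smul, Linear.units_smul_comp]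
    congr 1
    rw [hβ, Functor.map_comp, ← hg', Q.commShiftIso_add' (add_comm i a),
      Functor.CommShift.isoAdd'_hom_app]
    simp only [Category.assoc]
    congr 1
    rw [← act_naturality_assoc, ← reassoc_of% hQ.map_act,
      ← Functor.map_comp_assoc Q ((shiftFunctorAdd' _ i a (a + i) _).inv.app Y),
      Iso.inv_hom_id_app]
    simp
    rfl

end IsLocalisationAt

end LocalisedCompacts

/-! ### Shifts as linear triangle equivalences -/

section ShiftFunctor

variable {R : Type v} [Ring R] {𝒜 : ℤ → AddSubgroup R} [GradedRing 𝒜]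
variable {C : Type w} [Category.{v} C] [Preadditive C] [HasShift C ℤ]
  [∀ n : ℤ, (shiftFunctor C n).Additive] [RLinear 𝒜 C]

/-- The commutation of the shift by `n` with shifts, with the sign that makes it a triangle
functor. -/
@[reducible]
noncomputable def commShiftShiftFunctor (n : ℤ) : (shiftFunctor C n).CommShift ℤ where
  commShiftIso a := (a * n).negOnePow • shiftFunctorComm C a n
  commShiftIso_zero := by
    ext X
    have h1 : ∀ u : ℤˣ, (u • shiftFunctorComm C 0 n).hom.app X =
      u • (shiftFunctorComm C 0 n).hom.app X := fun u => rfl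
    rw [Functor.CommShift.isoZero_hom_app, h1, zero_mul, Int.negOnePow_zero, one_smul,
      ← shiftFunctorComm_symm, Iso.symm_hom, ← cancel_epi ((shiftFunctorComm C n 0).hom.app X),
      Iso.hom_inv_id_app, ← Category.assoc, ← shiftFunctorZero_hom_app_shift]
    exact ((shiftFunctorZero C ℤ).hom_inv_id_app (X⟦n⟧)).symm
  commShiftIso_add a b := by
    ext X
    have h1 : ∀ (u : ℤˣ) (a : ℤ) (X : C), (u • shiftFunctorComm C a n).hom.app X =
      u • (shiftFunctorComm C a n).hom.app X := fun u a X => rfl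
    rw [Functor.CommShift.isoAdd_hom_app, h1, h1, h1, Functor.map_units_smul,
      Linear.units_smul_comp, Linear.units_smul_comp, Linear.comp_units_smul,
      Linear.comp_units_smul, Linear.comp_units_smul, smul_smul, ← Int.negOnePow_add,
      add_mul, add_comm (a * n)]
    congr 1
    rw [← cancel_epi ((shiftFunctorComm C n (a + b)).hom.app X),
      shiftFunctorComm_hom_app_comp_shift_shiftFunctorAdd_hom_app_assoc,
      ← shiftFunctorComm_symm C n (a + b), ← shiftFunctorComm_symm C n a,
      ← shiftFunctorComm_symm C n b]
    simp only [Iso.symm_hom, Iso.hom_inv_id_app, Iso.hom_inv_id_app_assoc]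
    rw [← Functor.map_comp_assoc, Iso.hom_inv_id_app]
    simp

variable [HasZeroObject C] [Pretriangulated C]

lemma isRLinearTriangleEquivalence_shiftFunctor (n : ℤ) :
    IsRLinearTriangleEquivalence 𝒜 (shiftFunctor C n) := by
  let := commShiftShiftFunctor (C := C) n
  refine ⟨inferInstance, inferInstance, ⟨fun Δ hΔ => ?_⟩, ?_⟩
  · refine isomorphic_distinguished _ (Triangle.shift_distinguished _ hΔ n) _ ?_
    have hu : n.negOnePow * n.negOnePow = 1 := Int.units_mul_self _
    -- The shifted triangle carries the sign on all three morphisms, the image under the functor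
    -- only on the third; a sign on the middle object corrects this.
    refine Triangle.isoMk _ _ (Iso.refl _) (n.negOnePow • Iso.refl _) (Iso.refl _) ?_ ?_ ?_
    · change Δ.mor₁⟦n⟧' ≫ (n.negOnePow • 𝟙 _) = 𝟙 _ ≫ (n.negOnePow • Δ.mor₁⟦n⟧')
      rw [Linear.comp_units_smul, Category.comp_id, Category.id_comp]
    · change Δ.mor₂⟦n⟧' ≫ 𝟙 _ = (n.negOnePow • 𝟙 _) ≫ (n.negOnePow • Δ.mor₂⟦n⟧')
      rw [Linear.comp_units_smul, Linear.units_smul_comp, Category.comp_id, Category.id_comp,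
        smul_smul, hu, one_smul]
    · change (Δ.mor₃⟦n⟧' ≫ ((1 * n).negOnePow • (shiftFunctorComm C 1 n).hom.app Δ.obj₁)) ≫
        (𝟙 (Δ.obj₁⟦n⟧))⟦(1 : ℤ)⟧' = 𝟙 _ ≫
          (n.negOnePow • Δ.mor₃⟦n⟧' ≫ (shiftFunctorComm C 1 n).hom.app Δ.obj₁)
      rw [one_mul, Linear.comp_units_smul, CategoryTheory.Functor.map_id, Category.id_comp]
      exact Category.comp_id _
  · refine (isRLinearFunctor_iff _).2 fun X a s => ?_
    change (act s X)⟦n⟧' ≫ ((a * n).negOnePow • (shiftFunctorComm C a n).hom.app X) = _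
    rw [shift_map_act, Linear.units_smul_comp, Linear.comp_units_smul, smul_smul,
      Int.units_mul_self, one_smul, Category.assoc, ← shiftFunctorComm_symm C n a]
    simp

lemma IsRLinearTriangleEquivalence.comp {F K : C ⥤ C} (hF : IsRLinearTriangleEquivalence 𝒜 F)
    (hK : IsRLinearTriangleEquivalence 𝒜 K) : IsRLinearTriangleEquivalence 𝒜 (F ⋙ K) := by
  obtain ⟨_, _, _, hF⟩ := hF
  obtain ⟨_, _, _, hK⟩ := hK
  exact ⟨inferInstance, inferInstance, inferInstance, hF.comp hK⟩

end ShiftFunctor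

/-! ### Homomorphisms between graded Hom modules -/

section GradedHoms

variable {R : Type v} [Ring R] {𝒜 : ℤ → AddSubgroup R} [GradedRing 𝒜]

lemma grHom_ext {M N : GrMod 𝒜} {f g : grHom M N} (h : ∀ i x, f.1 i x = g.1 i x) : f = g :=
  Subtype.ext (funext fun i => AddMonoidHom.ext (h i))

lemma grComp_assoc {M N P Q : GrMod 𝒜} (f : grHom M N) (g : grHom N P) (h : grHom P Q) :
    grComp (grComp f g) h = grComp f (grComp g h) := rfl

/-- Precomposition with a homomorphism of graded modules. -/
noncomputable def grPrecomp {M N : GrMod 𝒜} (f : grHom M N) (P : GrMod 𝒜) :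
    grHom N P →+ grHom M P where
  toFun g := grComp f g
  map_zero' := rfl
  map_add' _ _ := rfl

/-- Precomposition with a bijective homomorphism of graded modules. -/
noncomputable def grPrecompEquiv {M N : GrMod 𝒜} (f : grHom M N)
    (hf : ∀ i, Function.Bijective (f.1 i)) (P : GrMod 𝒜) : grHom N P ≃+ grHom M P :=
  AddEquiv.ofBijective (grPrecomp f P) (by
    refine ⟨fun g g' hg => grHom_ext fun i x => ?_, fun g => ?_⟩
    · obtain ⟨y, rfl⟩ := (hf i).2 x
      exact congrArg (fun u : grHom M P => u.1 i y) hg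
    · let e := fun i => AddEquiv.ofBijective (f.1 i) (hf i)
      refine ⟨⟨fun i => (g.1 i).comp (e i).symm.toAddMonoidHom, fun {a i j} h r x => ?_⟩, ?_⟩
      · obtain ⟨y, rfl⟩ := (e i).surjective x
        change g.1 j ((e j).symm (N.smul h r (f.1 i y))) = P.smul h r (g.1 i ((e i).symm (e i y)))
        rw [← f.2 h r y, AddEquiv.symm_apply_apply, ← g.2 h r y]
        exact congrArg _ ((e j).symm_apply_apply _)
      · refine grHom_ext fun i y => ?_
        exact congrArg (g.1 i) ((e i).symm_apply_apply y))

lemma grPrecompEquiv_apply {M N : GrMod 𝒜} (f : grHom M N)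
    (hf : ∀ i, Function.Bijective (f.1 i)) (P : GrMod 𝒜) (g : grHom N P) :
    grPrecompEquiv f hf P g = grComp f g := rfl

variable {C : Type w} [Category.{v} C] [Preadditive C] [HasShift C ℤ]
  [∀ n : ℤ, (shiftFunctor C n).Additive] [RLinear 𝒜 C]

lemma homPre_comp {X X' X'' : C} (f : X ⟶ X') (g : X' ⟶ X'') (Y : C) :
    homPre 𝒜 (f ≫ g) Y = grComp (homPre 𝒜 g Y) (homPre 𝒜 f Y) :=
  grHom_ext fun _ _ => Category.assoc _ _ _

lemma homPre_id (X Y : C) {M : GrMod 𝒜} (φ : grHom (homMod 𝒜 X Y) M) :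
    grComp (homPre 𝒜 (𝟙 X) Y) φ = φ :=
  grHom_ext fun i x => congrArg (φ.1 i) (Category.id_comp (X := X) (Y := Y⟦i⟧) x)

lemma homPost_homPre {X X' Y Y' : C} (f : X ⟶ X') (g : Y ⟶ Y') :
    grComp (homPost 𝒜 X' g) (homPre 𝒜 f Y') = grComp (homPre 𝒜 f Y) (homPost 𝒜 X g) :=
  grHom_ext fun _ _ => (Category.assoc _ _ _).symm

end GradedHoms

/-! ### Operations on duality isomorphisms -/

section DualityIsos

universe v₁ u₁ v₂ u₂ v₃ u₃ v₄ u₄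

variable {R : Type v} [Ring R] {𝒜 : ℤ → AddSubgroup R} [GradedRing 𝒜]
variable {C : Type w} [Category.{v} C] [Preadditive C] [HasShift C ℤ]
  [∀ n : ℤ, (shiftFunctor C n).Additive] [RLinear 𝒜 C]
  {A : Type u₁} [Category.{v₁} A] {B : Type u₂} [Category.{v₂} B]
  {U : A ⥤ C} {V : B ⥤ C} {W : A ⥤ C} {I : GrMod 𝒜}

/-- A duality isomorphism may be composed with an isomorphism of its values. -/
noncomputable def DualityIso.ofIso (S : DualityIso 𝒜 U V W I) {W' : A ⥤ C} (e : W ≅ W') :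
    DualityIso 𝒜 U V W' I where
  equiv a b := (S.equiv a b).trans
    { toFun := fun f => f ≫ e.hom.app a
      invFun := fun f => f ≫ e.inv.app a
      left_inv := fun f => by simp
      right_inv := fun f => by simp
      map_add' := fun f g => Preadditive.add_comp _ _ _ _ _ _ }
  naturality_left f b φ := by
    change S.equiv _ _ _ ≫ _ = (S.equiv _ _ _ ≫ _) ≫ _
    rw [S.naturality_left, Category.assoc, Category.assoc, e.hom.naturality]
  naturality_right a b b' g φ := by
    change S.equiv _ _ _ ≫ _ = _ ≫ (S.equiv _ _ _ ≫ _)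
    rw [S.naturality_right, Category.assoc]

/-- A duality isomorphism may be restricted along functors. -/
noncomputable def DualityIso.restrict (S : DualityIso 𝒜 U V W I) {A' : Type u₃}
    [Category.{v₃} A'] {B' : Type u₄} [Category.{v₄} B'] (K : A' ⥤ A) (L : B' ⥤ B) :
    DualityIso 𝒜 (K ⋙ U) (L ⋙ V) (K ⋙ W) I where
  equiv a b := S.equiv (K.obj a) (L.obj b)
  naturality_left f b φ := S.naturality_left (K.map f) (L.obj b) φ
  naturality_right a _ _ g φ := S.naturality_right (K.obj a) (L.map g) φ

/-- The first argument of a duality isomorphism may be changed along a natural transformation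
that induces isomorphisms of graded modules of homomorphisms. -/
noncomputable def DualityIso.ofNatTrans (S : DualityIso 𝒜 U V W I) {U' : A ⥤ C} (ν : U ⟶ U')
    (hν : ∀ a b i, Function.Bijective ((homPre 𝒜 (ν.app a) (V.obj b)).1 i)) :
    DualityIso 𝒜 U' V W I where
  equiv a b := (grPrecompEquiv _ (hν a b) I).symm.trans (S.equiv a b)
  naturality_left {a a'} f b φ := by
    obtain ⟨χ, rfl⟩ := (grPrecompEquiv _ (hν a b) I).surjective φ
    simp only [AddEquiv.trans_apply, AddEquiv.symm_apply_apply]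
    rw [← S.naturality_left]
    congr 1
    rw [AddEquiv.symm_apply_eq, grPrecompEquiv_apply, grPrecompEquiv_apply, ← grComp_assoc,
      ← grComp_assoc, ← homPre_comp, ← homPre_comp, ν.naturality]
  naturality_right a b b' g φ := by
    obtain ⟨χ, rfl⟩ := (grPrecompEquiv _ (hν a b') I).surjective φ
    simp only [AddEquiv.trans_apply, AddEquiv.symm_apply_apply]
    rw [← S.naturality_right]
    congr 1
    rw [AddEquiv.symm_apply_eq, grPrecompEquiv_apply, grPrecompEquiv_apply, ← grComp_assoc,
      ← grComp_assoc, homPost_homPre]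

variable {P : Type u₃} [Category.{v₃} P] {E : P ⥤ C} {W : P ⥤ C} {K : A ⥤ P}

/-- Naturality of a duality isomorphism extends to fractions. -/
lemma DualityIso.naturality_of_fraction (S : DualityIso 𝒜 (K ⋙ E) V (K ⋙ W) I) {a a' a'' : A}
    (m : K.obj a ⟶ K.obj a') (n : a' ⟶ a'') [IsIso (K.map n)] (g : a ⟶ a'')
    (hm : m ≫ K.map n = K.map g) (b : B)
    (φ : grHom (homMod 𝒜 (E.obj (K.obj a)) (V.obj b)) I) :
    S.equiv a' b (grComp (homPre 𝒜 (E.map m) (V.obj b)) φ) = S.equiv a b φ ≫ W.map m := by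
  -- After composition with the invertible `W.map (K.map n)`, only morphisms coming from `A` are
  -- involved.
  rw [← cancel_mono (W.map (K.map n)), Category.assoc, ← Functor.map_comp, hm]
  refine (S.naturality_left n b _).symm.trans (Eq.trans ?_ (S.naturality_left g b φ))
  congr 1
  change grComp (homPre 𝒜 (E.map (K.map n)) _) (grComp (homPre 𝒜 (E.map m) _) φ) =
    grComp (homPre 𝒜 (E.map (K.map g)) _) φ
  rw [← grComp_assoc, ← homPre_comp, ← Functor.map_comp, hm]

/-- A duality isomorphism extends to retracts. -/
theorem DualityIso.nonempty_of_retracts (S : DualityIso 𝒜 (K ⋙ E) V (K ⋙ W) I)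
    (hS : ∀ {a a' : A} (m : K.obj a ⟶ K.obj a') (b : B)
      (φ : grHom (homMod 𝒜 (E.obj (K.obj a)) (V.obj b)) I),
      S.equiv a' b (grComp (homPre 𝒜 (E.map m) (V.obj b)) φ) = S.equiv a b φ ≫ W.map m)
    {A' : Type u₄} [Category.{v₄} A'] (U : A' ⥤ P)
    (hU : ∀ x, ∃ (a : A) (i : U.obj x ⟶ K.obj a) (r : K.obj a ⟶ U.obj x), i ≫ r = 𝟙 _) :
    Nonempty (DualityIso 𝒜 (U ⋙ E) V (U ⋙ W) I) := by
  choose a i r hir using hU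
  have pre : ∀ {X X' X'' : P} (f : X ⟶ X') (g : X' ⟶ X'') (b : B)
      (φ : grHom (homMod 𝒜 (E.obj X) (V.obj b)) I),
      grComp (homPre 𝒜 (E.map g) (V.obj b)) (grComp (homPre 𝒜 (E.map f) (V.obj b)) φ) =
        grComp (homPre 𝒜 (E.map (f ≫ g)) (V.obj b)) φ := fun f g b φ => by
    rw [Functor.map_comp, homPre_comp, grComp_assoc]
  have preId : ∀ {X : P} (b : B) (φ : grHom (homMod 𝒜 (E.obj X) (V.obj b)) I),
      grComp (homPre 𝒜 (E.map (𝟙 X)) (V.obj b)) φ = φ := fun b φ => by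
    rw [CategoryTheory.Functor.map_id, homPre_id]
  have hS' : ∀ {a a' : A} (m : K.obj a ⟶ K.obj a') (b : B) (ψ : V.obj b ⟶ W.obj (K.obj a)),
      (S.equiv a' b).symm (ψ ≫ W.map m) =
        grComp (homPre 𝒜 (E.map m) (V.obj b)) ((S.equiv a b).symm ψ) := fun m b ψ => by
    rw [AddEquiv.symm_apply_eq, hS, AddEquiv.apply_symm_apply]
  -- Transport along `i x`, apply `S`, project along `r x`. Naturality for the idempotent `r x ≫ i
  -- x` shows that the opposite recipe is inverse to this.
  refine ⟨⟨fun x b =>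
    { toFun := fun φ =>
        S.equiv (a x) b (grComp (homPre 𝒜 (E.map (i x)) (V.obj b)) φ) ≫ W.map (r x)
      invFun := fun ψ =>
        grComp (homPre 𝒜 (E.map (r x)) (V.obj b)) ((S.equiv (a x) b).symm (ψ ≫ W.map (i x)))
      left_inv := fun φ => ?_
      right_inv := fun ψ => ?_
      map_add' := fun φ χ => ?_ }, fun {x x'} f b φ => ?_, fun x b b' g φ => ?_⟩⟩
  · beta_reduce
    rw [Category.assoc, ← Functor.map_comp, hS', AddEquiv.symm_apply_apply, pre, pre,
      Category.assoc, hir, Category.comp_id, hir, preId]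
  · beta_reduce
    rw [pre, hS, AddEquiv.apply_symm_apply, Category.assoc, Category.assoc, ← Functor.map_comp,
      ← Functor.map_comp, Category.assoc, hir, Category.comp_id, hir,
      CategoryTheory.Functor.map_id]
    exact Category.comp_id _
  · rw [← Preadditive.add_comp, ← map_add]
    rfl
  · change S.equiv (a x') b (grComp (homPre 𝒜 (E.map (i x')) (V.obj b))
      (grComp (homPre 𝒜 (E.map (U.map f)) (V.obj b)) φ)) ≫ W.map (r x') =
      (S.equiv (a x) b (grComp (homPre 𝒜 (E.map (i x)) (V.obj b)) φ) ≫ W.map (r x)) ≫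
        W.map (U.map f)
    have h1 : U.map f ≫ i x' = i x ≫ (r x ≫ U.map f ≫ i x') := by rw [reassoc_of% (hir x)]
    rw [pre, h1, ← pre, hS, Category.assoc, Category.assoc, ← Functor.map_comp,
      ← Functor.map_comp, Category.assoc, Category.assoc, hir, Category.comp_id]
  · refine Eq.trans (congrArg (· ≫ W.map (r x)) ?_) (Category.assoc _ _ _)
    refine Eq.trans ?_ (S.naturality_right (a x) g _)
    change S.equiv (a x) b (grComp _ (grComp _ φ)) = S.equiv (a x) b (grComp _ (grComp _ φ))
    rw [← grComp_assoc, ← grComp_assoc]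
    exact congrArg (fun u => S.equiv (a x) b (grComp u φ)) (homPost_homPre _ _).symm

end DualityIsos

/-! ### Duality for local torsion objects -/

section LocalDuality

universe v₁ u₁ v₂ u₂

variable {R : Type v} [Ring R] {𝒜 : ℤ → AddSubgroup R} [GradedRing 𝒜]
  {T : Type w} [Category.{v} T] [Preadditive T] [HasShift T ℤ]
  [∀ n : ℤ, (shiftFunctor T n).Additive] [RLinear 𝒜 T] [HasZeroObject T] [Pretriangulated T]
  [HasCoproducts.{v} T] {J : Type v} {G : J → T}
  {p : HSpec 𝒜} {Λ : T ⥤ T} [Λ.CommShift ℤ] {η : 𝟭 T ⟶ Λ}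

/-- The compact `p`-torsion objects. -/
abbrev compactTorsion (T : Type w) [Category.{v} T] [Preadditive T] [HasShift T ℤ]
    [∀ n : ℤ, (shiftFunctor T n).Additive] [RLinear 𝒜 T] [HasZeroObject T] [Pretriangulated T]
    (p : HSpec 𝒜) : ObjectProperty (compacts T).FullSubcategory :=
  (torsionObjects T p).inverseImage (compacts T).ι

lemma torsionObjects_shift {X : T} (hX : torsionObjects T p X) (n : ℤ) :
    torsionObjects T p (X⟦n⟧) :=
  have := (isLocalizing_torsionObjects (T := T) p).isTriangulated
  (torsionObjects T p).le_shift n _ hX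

lemma torsionObjects_map {F : (compacts T).FullSubcategory ⥤ (compacts T).FullSubcategory}
    [F.CommShift ℤ] [F.Additive] (hF : IsRLinearFunctor 𝒜 F)
    {C : (compacts T).FullSubcategory} (hC : torsionObjects T p C.obj) :
    torsionObjects T p (F.obj C).obj :=
  torsionObjects_of_act fun q hq => by
    obtain ⟨a, s, hs, h0⟩ := exists_act_of_torsionObjects C.property hC q hq
    refine ⟨a, s, hs, (act_obj_eq_zero_iff _ s).2 ?_⟩
    rw [← hF.map_act, (act_obj_eq_zero_iff _ s).1 h0, Functor.map_zero, zero_comp]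

namespace IsLocalisationAt

lemma bijective_homPre_app (h : IsLocalisationAt p Λ η) (hG : IsGenerating G) (X : T) {Y : T}
    (hY : localObjects T p Y) (i : ℤ) : Function.Bijective ((homPre 𝒜 (η.app X) Y).1 i) := by
  have := (isLocalizing_localObjects hG p).isTriangulated
  have hY' := (localObjects T p).le_shift i _ hY
  refine ⟨fun f g hfg => h.hom_ext hG hY' hfg, fun f => ?_⟩
  obtain ⟨g, hg⟩ := h.exists_desc hG hY' f
  exact ⟨g, hg.symm⟩

/-- A global Serre functor induces a duality for the `p`-local `p`-torsion objects that are
compact among the `p`-local ones. -/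
theorem nonempty_dualityIso [IsTriangulated T] (hcomm : IsGradedCommutative 𝒜)
    (hnoeth : IsGradedNoetherian 𝒜) (h : IsLocalisationAt p Λ η) (hG : IsGenerating G)
    {Γ : T ⥤ T} {ε : Γ ⟶ Λ} (hε : IsLocalCohomologyAt p ε)
    {F : (compacts T).FullSubcategory ⥤ (compacts T).FullSubcategory}
    [F.CommShift ℤ] [F.Additive] (hF : IsRLinearFunctor 𝒜 F)
    {I : GrMod 𝒜} {d : ℤ} {Tp : (compacts T).FullSubcategory ⥤ T}
    (D : DualityIso 𝒜 (compacts T).ι (𝟭 T) Tp I)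
    (e : F ⋙ (compacts T).ι ⋙ Γ ≅ Tp ⋙ shiftFunctor T d)
    {P : ObjectProperty T} (hP : ∀ C : (compacts T).FullSubcategory, P (Λ.obj C.obj))
    {Fp : P.FullSubcategory ⥤ P.FullSubcategory}
    (α : P.lift ((compacts T).ι ⋙ Λ) hP ⋙ Fp ≅ F ⋙ P.lift ((compacts T).ι ⋙ Λ) hP)
    {A : Type u₁} [Category.{v₁} A] (U : A ⥤ P.FullSubcategory)
    (hU : ∀ x, compactIn (localObjects T p) (U.obj x).obj)
    (hU' : ∀ x, torsionObjects T p (U.obj x).obj)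
    {B : Type u₂} [Category.{v₂} B] (V : B ⥤ T) (hV : ∀ b, localObjects T p (V.obj b)) :
    Nonempty (DualityIso 𝒜 (U ⋙ P.ι) V (U ⋙ Fp ⋙ P.ι ⋙ shiftFunctor T (-d)) I) := by
  let L : (compacts T).FullSubcategory ⥤ P.FullSubcategory := P.lift ((compacts T).ι ⋙ Λ) hP
  let τ := (compactTorsion T p).ι
  have hiso : IsIso (Functor.whiskerLeft (τ ⋙ F ⋙ (compacts T).ι) ε) := by
    have : ∀ X, IsIso ((Functor.whiskerLeft (τ ⋙ F ⋙ (compacts T).ι) ε).app X) := fun X =>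
      hε.isIso_app (h.gammaObjects_obj hG (F.obj X.obj).property (torsionObjects_map hF X.property))
    exact NatIso.isIso_of_isIso_app _
  -- This is `e` desuspended. Then `e₂` replaces `Γ` by `Λ`, which is legitimate on torsion compact
  -- objects because `F` preserves them, and `e₃` moves the localisation across `F` by means of `α`.
  let e₁ : Tp ≅ (F ⋙ (compacts T).ι ⋙ Γ) ⋙ shiftFunctor T (-d) :=
    (Functor.rightUnitor Tp).symm ≪≫
      Functor.isoWhiskerLeft Tp (shiftFunctorCompIsoId T d (-d) (add_neg_cancel d)).symm ≪≫
      (Functor.associator _ _ _).symm ≪≫ Functor.isoWhiskerRight e.symm _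
  let e₂ : τ ⋙ (F ⋙ (compacts T).ι ⋙ Γ) ≅ τ ⋙ (F ⋙ (compacts T).ι ⋙ Λ) :=
    @asIso _ _ _ _ (Functor.whiskerLeft (τ ⋙ F ⋙ (compacts T).ι) ε) hiso
  let e₃ : (τ ⋙ (F ⋙ (compacts T).ι ⋙ Λ)) ⋙ shiftFunctor T (-d) ≅
      (τ ⋙ L) ⋙ Fp ⋙ P.ι ⋙ shiftFunctor T (-d) :=
    Functor.isoWhiskerLeft τ (Functor.isoWhiskerRight α.symm (P.ι ⋙ shiftFunctor T (-d)))
  let S : DualityIso 𝒜 ((τ ⋙ L) ⋙ P.ι) V ((τ ⋙ L) ⋙ Fp ⋙ P.ι ⋙ shiftFunctor T (-d)) I :=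
    (((D.restrict τ V).ofIso
      (Functor.isoWhiskerLeft τ e₁ ≪≫ Functor.isoWhiskerRight e₂ (shiftFunctor T (-d)) ≪≫ e₃)).ofNatTrans
        (Functor.whiskerLeft (τ ⋙ (compacts T).ι) η)
        fun a b i => h.bijective_homPre_app hG _ (hV b) i)
  refine S.nonempty_of_retracts ?_ U ?_
  · intro a a' m b φ
    -- The morphism `m` is the fraction of `g` by `s`; `a''` is the common target of numerator and
    -- denominator.
    obtain ⟨n, s, g, hs, hg⟩ := h.exists_comp_map_act_eq hG a.obj.property (Y := a'.obj.obj) m.hom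
    let a'' : (compactTorsion T p).FullSubcategory :=
      ⟨⟨a'.obj.obj⟦n⟧, IsCompactObject.shift a'.obj.property n⟩,
        torsionObjects_shift a'.property n⟩
    let s' : a' ⟶ a'' := ObjectProperty.homMk (ObjectProperty.homMk (act s a'.obj.obj))
    let g' : a ⟶ a'' := ObjectProperty.homMk (ObjectProperty.homMk g)
    have : IsIso ((τ ⋙ L).map s') := by
      have : IsIso (P.ι.map ((τ ⋙ L).map s')) := h.isIso_map_act hG hs a'.obj.obj
      exact isIso_of_reflects_iso _ P.ι
    exact S.naturality_of_fraction m s' g' (P.ι.map_injective hg) b φ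
  · intro x
    obtain ⟨C, hC, ht, i, r, hir⟩ := h.exists_torsion_retract hcomm hnoeth hG (hU x) (hU' x)
    exact ⟨⟨⟨C, hC⟩, ht⟩, ObjectProperty.homMk i, ObjectProperty.homMk r, P.ι.map_injective hir⟩

end IsLocalisationAt

end LocalDuality

/-! ### Extension of functors to retracts -/

section RetractExtension

universe v₁ u₁ v₂ u₂ v₃ u₃

/-- A functor to a category with split idempotents extends to retracts. -/
theorem exists_extension_of_retracts {A : Type u₁} [Category.{v₁} A] {B : Type u₂}
    [Category.{v₂} B] {E : Type u₃} [Category.{v₃} E] (j : A ⥤ B) [j.Full] [j.Faithful]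
    (hj : ∀ X, ∃ (a : A) (i : X ⟶ j.obj a) (r : j.obj a ⟶ X), i ≫ r = 𝟙 X) (H : A ⥤ E)
    (hE : ∀ (X : E) (e : X ⟶ X), e ≫ e = e → ∃ (Z : E) (u : Z ⟶ X) (q : X ⟶ Z),
      u ≫ q = 𝟙 Z ∧ q ≫ u = e) :
    ∃ K : B ⥤ E, Nonempty (j ⋙ K ≅ H) := by
  choose a i r hir using hj
  -- `N h` represents `h` between the ambient objects, and `N (𝟙 X)` is the idempotent that cuts out
  -- `X`. The extension sends `X` to a splitting of the image of this idempotent under `H`.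
  let N : ∀ {X Y : B}, (X ⟶ Y) → (a X ⟶ a Y) := fun {X Y} h => j.preimage (r X ≫ h ≫ i Y)
  have hN : ∀ {X Y Z : B} (h : X ⟶ Y) (k : Y ⟶ Z), N h ≫ N k = N (h ≫ k) := fun h k =>
    j.map_injective (by simp [N, reassoc_of% hir])
  choose Z u q huq hqu using fun X => hE (H.obj (a X)) (H.map (N (𝟙 X)))
    (by rw [← Functor.map_comp, hN, Category.comp_id])
  have hq : ∀ X, H.map (N (𝟙 X)) ≫ q X = q X := fun X => by
    rw [← hqu, Category.assoc, huq, Category.comp_id]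
  let K : B ⥤ E :=
    { obj := Z
      map := fun {X Y} h => u X ≫ H.map (N h) ≫ q Y
      map_id := fun X => by rw [hq, huq]
      map_comp := fun {X Y W} h k => by
        simp only [Category.assoc]
        rw [reassoc_of% hqu, ← Functor.map_comp_assoc, ← Functor.map_comp_assoc, hN, hN,
          Category.comp_id] }
  let ρ : ∀ X : A, a (j.obj X) ⟶ X := fun X => j.preimage (r (j.obj X))
  let σ : ∀ X : A, X ⟶ a (j.obj X) := fun X => j.preimage (i (j.obj X))
  have hσρ : ∀ X, σ X ≫ ρ X = 𝟙 X := fun X => j.map_injective (by simp [σ, ρ, hir])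
  have hρσ : ∀ X, ρ X ≫ σ X = N (𝟙 (j.obj X)) := fun X => j.map_injective (by simp [N, σ, ρ])
  have hNρ : ∀ {X Y : A} (f : X ⟶ Y), N (j.map f) ≫ ρ Y = ρ X ≫ f := fun f =>
    j.map_injective (by simp [N, ρ, hir])
  refine ⟨K, ⟨NatIso.ofComponents (fun X =>
    { hom := u (j.obj X) ≫ H.map (ρ X)
      inv := H.map (σ X) ≫ q (j.obj X)
      hom_inv_id := ?_
      inv_hom_id := ?_ }) fun {X Y} f => ?_⟩⟩
  · rw [Category.assoc, ← Functor.map_comp_assoc, hρσ, hq, huq]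
    rfl
  · rw [Category.assoc, reassoc_of% hqu, ← hρσ, ← Functor.map_comp, ← Functor.map_comp,
      Category.assoc, hσρ, Category.comp_id, hσρ, CategoryTheory.Functor.map_id]
  · change (u (j.obj X) ≫ H.map (N (j.map f)) ≫ q (j.obj Y)) ≫ u (j.obj Y) ≫ H.map (ρ Y) =
      (u (j.obj X) ≫ H.map (ρ X)) ≫ H.map f
    simp only [Category.assoc]
    rw [reassoc_of% hqu, ← Functor.map_comp, ← Functor.map_comp, ← Functor.map_comp, ← hNρ,
      ← Category.assoc, hN, Category.comp_id]

end RetractExtension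

/-! ### Existence of the induced functor on the compact objects of the local subcategory -/

section InducedFunctorExistence

variable {R : Type v} [Ring R] {𝒜 : ℤ → AddSubgroup R} [GradedRing 𝒜]
  {T : Type w} [Category.{v} T] [Preadditive T] [HasShift T ℤ]
  [∀ n : ℤ, (shiftFunctor T n).Additive] [RLinear 𝒜 T] [HasZeroObject T] [Pretriangulated T]
  [HasCoproducts.{v} T] {J : Type v} {G : J → T}
  {p : HSpec 𝒜} {Λ : T ⥤ T} [Λ.CommShift ℤ] {η : 𝟭 T ⟶ Λ} [IsTriangulated T]

omit [HasCoproducts.{v} T] [IsTriangulated T] in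
lemma localObjects_of_retract (hG : IsGenerating G) {X Y : T} (hY : localObjects T p Y)
    (i : X ⟶ Y) (r : Y ⟶ X) (hir : i ≫ r = 𝟙 X) : localObjects T p X := by
  rw [localObjects_iff hG] at hY ⊢
  intro a s hs
  have := hY a s hs
  refine ⟨i⟦a⟧' ≫ inv (act s Y) ≫ r, ?_, ?_⟩
  · rw [act_naturality_assoc, IsIso.hom_inv_id_assoc, hir]
  · rw [Category.assoc, Category.assoc, ← act_naturality, IsIso.inv_hom_id_assoc,
      ← Functor.map_comp, hir, CategoryTheory.Functor.map_id]

/-- Idempotents split in `T`, and the compact objects of `T_p` are closed under retracts, so a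
functor on localised compact objects extends to all their retracts, which are the compact objects of
`T_p`. -/
theorem IsLocalisationAt.exists_functor_compactIn (h : IsLocalisationAt p Λ η)
    (hG : IsGenerating G)
    {F : (compacts T).FullSubcategory ⥤ (compacts T).FullSubcategory}
    {F' : (imageObjects Λ).FullSubcategory ⥤ (imageObjects Λ).FullSubcategory}
    (e : compactLocalisation Λ ⋙ F' ≅ F ⋙ compactLocalisation Λ)
    (hP : ∀ C : (compacts T).FullSubcategory, compactIn (localObjects T p) (Λ.obj C.obj)) :
    ∃ Fp : (compactIn (localObjects T p)).FullSubcategory ⥤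
      (compactIn (localObjects T p)).FullSubcategory,
      Nonempty ((compactIn (localObjects T p)).lift ((compacts T).ι ⋙ Λ) hP ⋙ Fp ≅
        F ⋙ (compactIn (localObjects T p)).lift ((compacts T).ι ⋙ Λ) hP) := by
  have hloc := isLocalizing_localObjects hG p
  have := hloc.isTriangulated
  have := hloc.of_iso
  have := isClosedUnderIsomorphisms_compactIn (P := localObjects T p)
  have hle : imageObjects Λ ≤ compactIn (localObjects T p) := fun X ⟨C, ⟨e⟩⟩ =>
    (compactIn (localObjects T p)).prop_of_iso e (hP C)
  obtain ⟨Fp, ⟨β⟩⟩ := exists_extension_of_retracts (ObjectProperty.ιOfLE hle) (fun X => by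
      obtain ⟨C, hC, i, r, hir⟩ := h.exists_retract hG X.property
      exact ⟨(compactLocalisation Λ).obj ⟨C, hC⟩, ObjectProperty.homMk i, ObjectProperty.homMk r,
        (compactIn (localObjects T p)).ι.map_injective hir⟩) (F' ⋙ ObjectProperty.ιOfLE hle)
    (fun X f hf => by
      obtain ⟨Y, i, r, hir, hri⟩ := exists_idempotent_splitting f.hom
        (congrArg (compactIn (localObjects T p)).ι.map hf)
      have hY : compactIn (localObjects T p) Y :=
        compactIn_of_retract (localObjects_of_retract hG X.property.1 i r hir) X.property i r hir
      exact ⟨⟨Y, hY⟩, ObjectProperty.homMk i, ObjectProperty.homMk r,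
        (compactIn (localObjects T p)).ι.map_injective hir,
        (compactIn (localObjects T p)).ι.map_injective hri⟩)
  exact ⟨Fp, ⟨Functor.isoWhiskerLeft (compactLocalisation Λ) β ≪≫
    Functor.isoWhiskerRight e (ObjectProperty.ιOfLE hle)⟩⟩

end InducedFunctorExistence

/-! ### Dualities on zero objects and along fully faithful functors -/

section Reflection

universe v₁ u₁ v₂ u₂

variable {R : Type v} [Ring R] {𝒜 : ℤ → AddSubgroup R} [GradedRing 𝒜]
variable {C : Type w} [Category.{v} C] [Preadditive C] [HasShift C ℤ]
  [∀ n : ℤ, (shiftFunctor C n).Additive] [RLinear 𝒜 C]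
  {D : Type w'} [Category.{v} D] [Preadditive D] [HasShift D ℤ]
  [∀ n : ℤ, (shiftFunctor D n).Additive] [RLinear 𝒜 D]

lemma homMod_eq_zero_of_isZero {X : C} (hX : IsZero X) (Y : C) {i : ℤ}
    (α : (homMod 𝒜 X Y).carrier i) : α = 0 :=
  hX.eq_of_src (Y := Y⟦i⟧) α 0

/-- Serves the primes outside the support, where both sides vanish whatever `W` is. -/
lemma DualityIso.nonempty_of_isZero {A : Type u₁} [Category.{v₁} A] {B : Type u₂}
    [Category.{v₂} B] {U : A ⥤ C} {V : B ⥤ C} (W : A ⥤ C) (I : GrMod 𝒜)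
    (hU : ∀ a, IsZero (U.obj a)) (hV : ∀ b, IsZero (V.obj b)) :
    Nonempty (DualityIso 𝒜 U V W I) := by
  refine ⟨⟨fun a b =>
    { toFun := 0
      invFun := 0
      left_inv := fun φ => grHom_ext fun i x => ?_
      right_inv := fun f => (hV b).eq_of_src _ _
      map_add' := fun _ _ => (hV b).eq_of_src _ _ },
    fun _ b _ => (hV b).eq_of_src _ _, fun _ _ _ _ _ => (hV _).eq_of_src _ _⟩⟩
  rw [homMod_eq_zero_of_isZero (hU a) _ x, map_zero, map_zero]

variable {K : C ⥤ D} [K.CommShift ℤ] [K.Additive] [K.Full] [K.Faithful]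
  (hK : IsRLinearFunctor 𝒜 K)

lemma bijective_homMap (X Y : C) (i : ℤ) : Function.Bijective ((homMap 𝒜 K hK X Y).1 i) := by
  refine ⟨fun f g hfg => K.map_injective ((cancel_mono ((K.commShiftIso i).hom.app Y)).1 hfg),
    fun f => ?_⟩
  change K.obj X ⟶ (K.obj Y)⟦i⟧ at f
  refine ⟨K.preimage (f ≫ (K.commShiftIso i).inv.app Y), ?_⟩
  change K.map (K.preimage _) ≫ (K.commShiftIso i).hom.app Y = f
  rw [K.map_preimage, Category.assoc, Iso.inv_hom_id_app]
  exact Category.comp_id f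

omit [K.Full] [K.Faithful] in
lemma homPre_homMap {X X' : C} (f : X ⟶ X') (Y : C) :
    grComp (homPre 𝒜 f Y) (homMap 𝒜 K hK X Y) =
      grComp (homMap 𝒜 K hK X' Y) (homPre 𝒜 (K.map f) (K.obj Y)) :=
  grHom_ext fun i x => by
    change X' ⟶ Y⟦i⟧ at x
    change K.map (f ≫ x) ≫ _ = K.map f ≫ K.map x ≫ _
    rw [K.map_comp, Category.assoc]

omit [K.Full] [K.Faithful] in
lemma homPost_homMap (X : C) {Y Y' : C} (g : Y ⟶ Y') :
    grComp (homPost 𝒜 X g) (homMap 𝒜 K hK X Y') =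
      grComp (homMap 𝒜 K hK X Y) (homPost 𝒜 (K.obj X) (K.map g)) :=
  grHom_ext fun i x => by
    change X ⟶ Y⟦i⟧ at x
    change K.map (x ≫ g⟦i⟧') ≫ (K.commShiftIso i).hom.app Y' =
      (K.map x ≫ (K.commShiftIso i).hom.app Y) ≫ (K.map g)⟦i⟧'
    rw [K.map_comp, Category.assoc, Category.assoc, K.commShiftIso_hom_naturality]

/-- Fully faithful `R`-linear functors reflect dualities. -/
noncomputable def DualityIso.reflect {W : C ⥤ C} {I : GrMod 𝒜} (S : DualityIso 𝒜 K K (W ⋙ K) I) :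
    DualityIso 𝒜 (𝟭 C) (𝟭 C) W I where
  equiv a b := ((grPrecompEquiv _ (bijective_homMap hK a b) I).symm.trans (S.equiv a b)).trans
    { toFun := fun f => K.preimage f
      invFun := fun f => K.map f
      left_inv := fun f => K.map_preimage f
      right_inv := fun f => K.preimage_map f
      map_add' := fun f g => K.map_injective (by
        rw [K.map_add, K.map_preimage, K.map_preimage, K.map_preimage]) }
  naturality_left {a a'} f b φ := by
    obtain ⟨χ, rfl⟩ := (grPrecompEquiv _ (bijective_homMap hK a b) I).surjective φ
    apply K.map_injective
    change K.map (K.preimage (S.equiv _ _ ((grPrecompEquiv _ _ _).symm _))) =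
      K.map (K.preimage (S.equiv _ _ ((grPrecompEquiv _ _ _).symm _)) ≫ W.map f)
    rw [K.map_comp, K.map_preimage, K.map_preimage, AddEquiv.symm_apply_apply]
    refine Eq.trans ?_ (S.naturality_left f b χ)
    congr 1
    rw [AddEquiv.symm_apply_eq, grPrecompEquiv_apply, grPrecompEquiv_apply, ← grComp_assoc,
      ← grComp_assoc]
    exact congrArg (fun u => grComp u χ) (homPre_homMap hK f b)
  naturality_right a b b' g φ := by
    obtain ⟨χ, rfl⟩ := (grPrecompEquiv _ (bijective_homMap hK a b') I).surjective φ
    apply K.map_injective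
    change K.map (K.preimage (S.equiv _ _ ((grPrecompEquiv _ _ _).symm _))) =
      K.map (g ≫ K.preimage (S.equiv _ _ ((grPrecompEquiv _ _ _).symm _)))
    rw [K.map_comp, K.map_preimage, K.map_preimage, AddEquiv.symm_apply_apply]
    refine Eq.trans ?_ (S.naturality_right a g χ)
    congr 1
    rw [AddEquiv.symm_apply_eq, grPrecompEquiv_apply, grPrecompEquiv_apply, ← grComp_assoc,
      ← grComp_assoc]
    exact congrArg (fun u => grComp u χ) (homPost_homMap hK a g)

end Reflection

/-! ### Restriction to objects with torsion endomorphism ring -/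

section EndTorsion

variable {R : Type v} [Ring R] {𝒜 : ℤ → AddSubgroup R} [GradedRing 𝒜]
variable {C : Type w} [Category.{v} C] [Preadditive C] [HasShift C ℤ]
  [∀ n : ℤ, (shiftFunctor C n).Additive] [RLinear 𝒜 C] [HasZeroObject C] [Pretriangulated C]

lemma endTorsion_map_iff {F : C ⥤ C} [F.CommShift ℤ] [F.Additive] [F.Faithful]
    (hF : IsRLinearFunctor 𝒜 F) (p : HSpec 𝒜) (X : C) :
    endTorsion C p (F.obj X) ↔ endTorsion C p X := by
  rw [endTorsion_iff, endTorsion_iff]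
  refine forall₂_congr fun q _ => exists₂_congr fun a s => and_congr_right fun _ => ?_
  exact hF.act_eq_zero_iff X s

/-- An `R`-linear triangle equivalence restricts to the objects with `p`-torsion endomorphism
ring. -/
lemma exists_restriction_endTorsion {F : C ⥤ C} (hF : IsRLinearTriangleEquivalence 𝒜 F)
    (p : HSpec 𝒜) :
    ∃ Fγ : (endTorsion C p).FullSubcategory ⥤ (endTorsion C p).FullSubcategory,
      IsRLinearTriangleEquivalence 𝒜 Fγ ∧
      Nonempty (Fγ ⋙ (endTorsion C p).ι ≅ (endTorsion C p).ι ⋙ F) := by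
  obtain ⟨_, _, _, hF⟩ := hF
  have hmem : ∀ X, endTorsion C p (((endTorsion C p).ι ⋙ F).obj X) := fun X =>
    (endTorsion_map_iff hF p X.obj).2 X.property
  let Fγ := (endTorsion C p).lift ((endTorsion C p).ι ⋙ F) hmem
  have : Fγ.Full := inferInstance
  have : Fγ.Faithful := inferInstance
  have : Fγ.EssSurj := ⟨fun Y => by
    let e := F.objObjPreimageIso Y.obj
    have hX : endTorsion C p (F.objPreimage Y.obj) :=
      (endTorsion_map_iff hF p _).1 ((endTorsion C p).prop_of_iso e.symm Y.property)
    exact ⟨⟨_, hX⟩, ⟨(endTorsion C p).fullyFaithfulι.preimageIso e⟩⟩⟩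
  have : Fγ.IsEquivalence := {}
  exact ⟨Fγ, ⟨inferInstance, inferInstance, inferInstance,
    isRLinearFunctor_lift _ _ _ ((isRLinearFunctor_ι _).comp hF)⟩,
    ⟨(endTorsion C p).liftCompιIso _ hmem⟩⟩

end EndTorsion

/-! ### Local Serre duality at one prime -/

section LocalSerreDuality

variable {R : Type v} [Ring R] {𝒜 : ℤ → AddSubgroup R} [GradedRing 𝒜]
  {T : Type w} [Category.{v} T] [Preadditive T] [HasShift T ℤ]
  [∀ n : ℤ, (shiftFunctor T n).Additive] [RLinear 𝒜 T] [HasZeroObject T] [Pretriangulated T]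
  [HasCoproducts.{v} T] {J : Type v} {G : J → T}
  {p : HSpec 𝒜} {Λ : T ⥤ T} [Λ.CommShift ℤ] {η : 𝟭 T ⟶ Λ} [IsTriangulated T]

/-- The localisation of the category of compact objects, realised inside `T`. -/
noncomputable def IsLocalisationAt.localisedCategory (h : IsLocalisationAt p Λ η)
    (hG : IsGenerating G) [Λ.IsTriangulated] [(imageObjects Λ).IsTriangulated] :
    LocalisedCategory (compacts T).FullSubcategory p where
  Obj := (imageObjects Λ).FullSubcategory
  Q := compactLocalisation Λ
  linear := h.isRLinearFunctor_compactLocalisation hG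
  essSurj := inferInstance
  isLocalisation := h.isLocalisationMap hG _

omit [IsTriangulated T] [HasCoproducts.{v} T] in
lemma torsionObjects_of_endTorsion [(imageObjects Λ).IsTriangulated]
    (X : (endTorsion (imageObjects Λ).FullSubcategory p).FullSubcategory) :
    torsionObjects T p X.obj.obj :=
  torsionObjects_of_act fun q hq => by
    obtain ⟨a, s, hs, h0⟩ := (endTorsion_iff p _).1 X.property q hq
    exact ⟨a, s, hs, (act_obj_eq_zero_iff _ s).2 h0⟩

omit [IsTriangulated T] [Λ.CommShift ℤ] [HasCoproducts.{v} T] in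
-- The unit of `X` factors through `Γ.obj X`, which is zero; as the unit is invertible, `X` is zero.
lemma IsLocalCohomologyAt.isZero_of_gammaObjects {Γ : T ⥤ T} {ε : Γ ⟶ Λ}
    (hε : IsLocalCohomologyAt p ε) (hz : ∀ X, IsZero (Γ.obj X)) {X : T}
    (hX : gammaObjects T p X) [IsIso (η.app X)] : IsZero X := by
  obtain ⟨g, hg, -⟩ := hε.existsUnique X X hX (η.app X)
  have h0 : η.app X = 0 := by rw [← hg, (hz X).eq_of_tgt g 0, zero_comp]
  rw [IsZero.iff_id_eq_zero, ← cancel_mono (η.app X), h0, comp_zero, comp_zero]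

/-- Local Serre duality at a prime, from a duality in the ambient category. -/
theorem IsLocalisationAt.exists_isSerreFunctor (h : IsLocalisationAt p Λ η) (hG : IsGenerating G)
    {F : (compacts T).FullSubcategory ⥤ (compacts T).FullSubcategory}
    [F.CommShift ℤ] [F.IsTriangulated] [F.IsEquivalence] (hF : IsRLinearFunctor 𝒜 F)
    [Λ.IsTriangulated] [(imageObjects Λ).IsTriangulated] (I : GrMod 𝒜) (d : ℤ)
    (hd : ∀ F' : (imageObjects Λ).FullSubcategory ⥤ (imageObjects Λ).FullSubcategory,
      Nonempty (compactLocalisation Λ ⋙ F' ≅ F ⋙ compactLocalisation Λ) →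
      Nonempty (DualityIso 𝒜 ((endTorsion (imageObjects Λ).FullSubcategory p).ι ⋙ (imageObjects Λ).ι)
        ((endTorsion (imageObjects Λ).FullSubcategory p).ι ⋙ (imageObjects Λ).ι)
        ((endTorsion (imageObjects Λ).FullSubcategory p).ι ⋙ F' ⋙ (imageObjects Λ).ι ⋙
          shiftFunctor T (-d)) I)) :
    ∃ (L : LocalisedCategory (compacts T).FullSubcategory p) (Fp : L.Obj ⥤ L.Obj)
      (Fγ : (endTorsion L.Obj p).FullSubcategory ⥤ (endTorsion L.Obj p).FullSubcategory),
      Nonempty (L.Q ⋙ Fp ≅ F ⋙ L.Q) ∧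
      Nonempty (Fγ ⋙ (endTorsion L.Obj p).ι ≅ (endTorsion L.Obj p).ι ⋙ Fp) ∧
      IsSerreFunctor I (Fγ ⋙ shiftFunctor (endTorsion L.Obj p).FullSubcategory (-d)) := by
  obtain ⟨F', hF', he⟩ := h.exists_inducedFunctor hG hF
  obtain ⟨Fγ, hFγ, ⟨β⟩⟩ := exists_restriction_endTorsion hF' p
  obtain ⟨S⟩ := hd F' he
  refine ⟨h.localisedCategory hG, F', Fγ, he, ⟨β⟩,
    hFγ.comp (isRLinearTriangleEquivalence_shiftFunctor _), ?_⟩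
  let K := (endTorsion (imageObjects Λ).FullSubcategory p).ι ⋙ (imageObjects Λ).ι
  have hK : IsRLinearFunctor 𝒜 K := (isRLinearFunctor_ι _).comp (isRLinearFunctor_ι _)
  let e : (endTorsion (imageObjects Λ).FullSubcategory p).ι ⋙ F' ⋙ (imageObjects Λ).ι ⋙
      shiftFunctor T (-d) ≅ (Fγ ⋙ shiftFunctor _ (-d)) ⋙ K :=
    Functor.isoWhiskerRight β.symm ((imageObjects Λ).ι ⋙ shiftFunctor T (-d)) ≪≫
      Functor.isoWhiskerLeft Fγ (K.commShiftIso (-d)).symm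
  exact ⟨(S.ofIso e).reflect hK⟩

end LocalSerreDuality

end LocalSerre

/-! ### Assembly of both statements -/

open LocalSerre in
theorem proposition7p3 {R : Type v} [Ring R] (𝒜 : ℤ → AddSubgroup R) [GradedRing 𝒜]
    (hcomm : IsGradedCommutative 𝒜) (hnoeth : IsGradedNoetherian 𝒜)
    (T : Type w) [Category.{v} T] [Preadditive T] [HasZeroObject T] [HasShift T ℤ]
    [∀ n : ℤ, (shiftFunctor T n).Additive] [Pretriangulated T] [IsTriangulated T]
    [HasCoproducts.{v} T] [RLinear 𝒜 T] (hgen : IsCompactlyGenerated T)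
    (I : HSpec 𝒜 → GrMod 𝒜) (hI : ∀ p, IsInjectiveHull (residue p) (I p))
    (F : (compacts T).FullSubcategory ⥤ (compacts T).FullSubcategory) (d : HSpec 𝒜 → ℤ)
    (hF : IsGlobalSerreFunctor I F d) :
    (∀ p ∈ support 𝒜 T,
      ∃ (hL : ∀ C, compacts T C → compactIn (localObjects T p) ((localisation T p).obj C))
        (hΓ : compactIn (gammaObjects T p) ≤ compactIn (localObjects T p)),
        (∃ Fp, IsInducedFunctor p hL F Fp) ∧
        ∀ Fp, IsInducedFunctor p hL F Fp →
          Nonempty (DualityIso 𝒜 (compactIn (gammaObjects T p)).ι (localObjects T p).ι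
            (ObjectProperty.ιOfLE hΓ ⋙ Fp ⋙ (compactIn (localObjects T p)).ι ⋙
              shiftFunctor T (-(d p))) (I p))) ∧
    SatisfiesLocalSerreDuality (compacts T).FullSubcategory I := by
  obtain ⟨J, G, hG⟩ := hgen.exists_isGenerating
  obtain ⟨hFeq, hdual⟩ := hF
  have hFeq' := hFeq
  obtain ⟨_, _, _, hlin⟩ := hFeq'
  refine ⟨fun p hp => ?_, F, hFeq, fun p => ?_⟩
  · obtain ⟨_, η, h⟩ := exists_isLocalisationAt hG p
    obtain ⟨ε, hε⟩ := exists_isLocalCohomologyAt hcomm hnoeth hG p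
    obtain ⟨Tp, ⟨D⟩, ⟨e⟩⟩ := hdual p hp
    have := h.isTriangulated
    have := h.isTriangulated_and_isLocalization.1
    have hL : ∀ C, compacts T C → compactIn (localObjects T p) ((localisation T p).obj C) :=
      fun C hC => h.compactIn_obj hG hC
    have hΓ := compactIn_gamma_le hcomm hnoeth hG p
    refine ⟨hL, hΓ, ?_, fun Fp ⟨α⟩ => ?_⟩
    · obtain ⟨F', -, ⟨e'⟩⟩ := h.exists_inducedFunctor hG hlin
      exact h.exists_functor_compactIn hG e' fun C => hL C.obj C.property
    · exact h.nonempty_dualityIso hcomm hnoeth hG hε hlin D e (fun C => hL C.obj C.property) α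
        (ObjectProperty.ιOfLE hΓ) (fun X => hΓ _ X.property) (fun X => X.property.1.2)
        (localObjects T p).ι fun Y => Y.property
  · obtain ⟨_, η, h⟩ := exists_isLocalisationAt hG p
    obtain ⟨ε, hε⟩ := exists_isLocalCohomologyAt hcomm hnoeth hG p
    have := h.isTriangulated
    have := h.isTriangulated_and_isLocalization.1
    have hloc := isLocalizing_localObjects hG p
    have := hloc.isTriangulated
    have := hloc.of_iso
    have := isClosedUnderIsomorphisms_compactIn (P := localObjects T p)
    -- In (2) the localised compact objects themselves serve as `C_p`; they are compact in `T_p`, so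
    -- the duality constructed for (1) also covers their torsion objects.
    have hcpt : ∀ X : (imageObjects (localisation T p)).FullSubcategory,
        compactIn (localObjects T p) X.obj := fun ⟨X, C, ⟨e⟩⟩ =>
      (compactIn (localObjects T p)).prop_of_iso e (h.compactIn_obj hG C.property)
    by_cases hp : p ∈ support 𝒜 T
    · obtain ⟨Tp, ⟨D⟩, ⟨e⟩⟩ := hdual p hp
      exact ⟨d p, h.exists_isSerreFunctor hG hlin (I p) (d p) fun F' ⟨α⟩ =>
        h.nonempty_dualityIso hcomm hnoeth hG hε hlin D e _ α _ (fun X => hcpt X.obj)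
          torsionObjects_of_endTorsion _ fun X => (hcpt X.obj).1⟩
    · have hz : ∀ X : (endTorsion (imageObjects (localisation T p)).FullSubcategory p).FullSubcategory,
          IsZero X.obj.obj := fun X =>
        have := h.isIso_app hG (hcpt X.obj).1
        hε.isZero_of_gammaObjects (η := η) (isZero_localCohomology_of_notMem_support hp)
          ⟨(hcpt X.obj).1, torsionObjects_of_endTorsion X⟩
      -- Outside the support γ_p C consists of zero objects, so any shift would do.
      exact ⟨0, h.exists_isSerreFunctor hG hlin (I p) 0 fun F' _ =>
        DualityIso.nonempty_of_isZero _ _ hz hz⟩
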